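/- Let $\mathbb{T}=\mathbb{R}\cup\{\infty\}$ and let $V$ be a valuated matroid of rank $d$ on a finite set $E$: a vector $(V_B)\in\mathbb{T}^{\binom{E}{d}}$, not identically $\infty$ and taken up to adding a real constant, such that for all $A\in\binom{E}{d-1}$ and $C\in\binom{E}{d+1}$ the minimum of $V_{A\cup\{j\}}+V_{C\setminus\{j\}}$ over $j\in C\setminus A$ is attained at least twice. Its underlying matroid $\underline V$ has as bases the $B$ with $V_B<\infty$. For $x\in\mathbb{R}^E$ the initial matroid $V^x$ has as bases the $B$ that minimize $V_B-\sum_{i\in B}x_i$. Let $\mathcal{M}(V)$ be the set of initial matroids of $V$ all of whose loops are loops of $\underline V$. For a matroid $M$, a cyclic flat is a flat of $M$ whose complement is a flat of $M^*$. Let $\mathcal{CF}(M)$ be the lattice of cyclic flats, $\mu$ its Möbius function, $\operatorname{cork}(F)=\operatorname{rk}(M)-\operatorname{rk}(F)$, and for $F\in\mathcal{CF}(M)$ put $$\tau_M(F)=\sum_{F'\in\mathcal{CF}(M),\ F\subseteq F'}\mu(F,F')\operatorname{cork}(F').$$ Let $\overline{\mathcal{M}}(V)=\bigcup_{F\in\mathcal{CF}(\underline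 V)}\mathcal{M}(V/F)$, where $V/F$ is the contraction: the valuated matroid on $E\setminus F$ with $(V/F)_B=V_{B\cup I}$ for any fixed basis $I$ of $F$ in $\underline V$. Suppose that $V$ has transversal facets, i.e. every initial matroid $V^x$ whose set of bases is maximal under inclusion among all initial matroids of $V$ is a transversal matroid. Then $\tau_M(\emptyset)\ge 0$ for every $M\in\overline{\mathcal{M}}(V)$ all of whose coloops are coloops of $\underline V$. Hence there is a multiset $\mathcal{DM}(V)$, the distinguished multiset of matroids of $V$, which contains each such $M$ with multiplicity exactly $\tau_M(\emptyset)$ and contains nothing else. It has exactly $d$ elements, counted with multiplicity. -/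

import Mathlib

/-- A coordinate vector of a valuated matroid: a finite ground set, a rank `d`, and one tropical
number (an element of `ℝ ∪ {∞}`) for each `d`-element subset of the ground set, not all equal to
`∞`, subject to the tropical Plücker relations.  The function `val` is extended by `∞` to all other
finite sets.  A valuated matroid is such a vector up to the addition of a real scalar; every notion
below is invariant under this. -/
structure ValuatedMatroid (α : Type*) [DecidableEq α] where
  ground : Finset α
  rank : ℕ
  val : Finset α → WithTop ℝ
  subset_card_of_ne_top : ∀ B, val B ≠ ⊤ → B ⊆ ground ∧ B.card = rank
  exists_ne_top : ∃ B, val B ≠ ⊤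
  /-- The minimum of `V (A ∪ {j}) + V (C \ {j})` over `j ∈ C \ A` is attained at least twice. -/
  plucker : ∀ A C : Finset α, A ⊆ ground → C ⊆ ground → A.card + 1 = rank → C.card = rank + 1 →
    ∃ i ∈ C \ A, ∃ j ∈ C \ A, i ≠ j ∧
      (∀ k ∈ C \ A, val (insert i A) + val (C.erase i) ≤ val (insert k A) + val (C.erase k)) ∧
      (∀ k ∈ C \ A, val (insert j A) + val (C.erase j) ≤ val (insert k A) + val (C.erase k))

theorem exchangeProperty_coe {α : Type*} [DecidableEq α] (P : Finset α → Prop)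
    (hex : ∀ X Y, P X → P Y → ∀ a ∈ X \ Y, ∃ b ∈ Y \ X, P (insert b (X.erase a))) :
    Matroid.ExchangeProperty (fun B : Set α => ∃ B' : Finset α, (B' : Set α) = B ∧ P B') := by
  rintro _ _ ⟨X, rfl, hX⟩ ⟨Y, rfl, hY⟩ a ha
  obtain ⟨b, hb, hP⟩ := hex X Y hX hY a (by simpa using ha)
  exact ⟨b, by simpa using hb, _, by simp, hP⟩

/-- The matroid on the finite set `E` with a prescribed family of bases. -/
def matroidOfBases {α : Type*} [DecidableEq α] (E : Finset α) (P : Finset α → Prop)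
    (hne : ∃ B, P B) (hE : ∀ B, P B → B ⊆ E)
    (hex : ∀ X Y, P X → P Y → ∀ a ∈ X \ Y, ∃ b ∈ Y \ X, P (insert b (X.erase a))) : Matroid α :=
  Matroid.ofIsBaseOfFinite E.finite_toSet (fun B => ∃ B' : Finset α, (B' : Set α) = B ∧ P B')
    (hne.elim fun B hB => ⟨B, B, rfl, hB⟩)
    (exchangeProperty_coe P hex)
    (fun _ ⟨X, hXB, hX⟩ => hXB ▸ Finset.coe_subset.2 (hE X hX))

theorem matroidOfBases_ground {α : Type*} [DecidableEq α] (E : Finset α) (P : Finset α → Prop)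
    (hne hE hex) : (matroidOfBases E P hne hE hex).E = E := rfl

theorem matroidOfBases_isBase {α : Type*} [DecidableEq α] (E : Finset α)
    (P : Finset α → Prop) (hne hE hex) (B : Finset α) :
    (matroidOfBases E P hne hE hex).IsBase B ↔ P B :=
  ⟨fun ⟨_, h, hB⟩ => Finset.coe_injective h ▸ hB, fun h => ⟨B, rfl, h⟩⟩

namespace ValuatedMatroid

variable {α : Type*} [DecidableEq α]

/-- For `a ∈ X \ Y` with `X`, `Y` of finite value there is an exchange partner that does not
increase the sum of the values. -/
theorem exists_exchange (V : ValuatedMatroid α) {X Y : Finset α} (hX : V.val X ≠ ⊤)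
    (hY : V.val Y ≠ ⊤) {a : α} (ha : a ∈ X \ Y) :
    ∃ b ∈ Y \ X, V.val (insert b (X.erase a)) + V.val ((insert a Y).erase b)
      ≤ V.val X + V.val Y := by
  obtain ⟨haX, haY⟩ := Finset.mem_sdiff.1 ha
  obtain ⟨hXE, hXc⟩ := V.subset_card_of_ne_top X hX
  obtain ⟨hYE, hYc⟩ := V.subset_card_of_ne_top Y hY
  have key := V.plucker (X.erase a) (insert a Y) ((Finset.erase_subset _ _).trans hXE)
    (Finset.insert_subset (hXE haX) hYE) (by rw [Finset.card_erase_add_one haX, hXc])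
    (by rw [Finset.card_insert_of_notMem haY, hYc])
  have hamem : a ∈ insert a Y \ X.erase a := by simp
  have hfin : ∀ i ∈ insert a Y \ X.erase a, i ≠ a →
      (∀ k ∈ insert a Y \ X.erase a, V.val (insert i (X.erase a)) + V.val ((insert a Y).erase i)
        ≤ V.val (insert k (X.erase a)) + V.val ((insert a Y).erase k)) →
      ∃ b ∈ Y \ X, V.val (insert b (X.erase a)) + V.val ((insert a Y).erase b)
        ≤ V.val X + V.val Y := by
    intro i hi hia hmin
    refine ⟨i, ?_, ?_⟩
    · simp only [Finset.mem_sdiff, Finset.mem_insert, Finset.mem_erase] at hi ⊢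
      tauto
    · have := hmin a hamem
      rwa [Finset.insert_erase haX, Finset.erase_insert haY] at this
  obtain ⟨i, hi, j, hj, hij, hmi, hmj⟩ := key
  by_cases hia : i = a
  · exact hfin j hj (fun h => hij (hia.trans h.symm)) hmj
  · exact hfin i hi hia hmi

/-- The matroid underlying `V`: its bases are the sets of finite value. -/
def underlying (V : ValuatedMatroid α) : Matroid α :=
  matroidOfBases V.ground (fun B => V.val B ≠ ⊤) V.exists_ne_top
    (fun B hB => (V.subset_card_of_ne_top B hB).1)
    (by
      intro X Y hX hY a ha
      obtain ⟨b, hb, h⟩ := V.exists_exchange hX hY ha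
      refine ⟨b, hb, fun htop => ?_⟩
      rw [htop, top_add, top_le_iff, WithTop.add_eq_top] at h
      exact h.elim hX hY)

/-- The quantity `V_B - ∑ i ∈ B, x i`. -/
noncomputable def tilt (V : ValuatedMatroid α) (x : α → ℝ) (B : Finset α) : WithTop ℝ :=
  V.val B + ((-∑ i ∈ B, x i : ℝ) : WithTop ℝ)

/-- `B` indexes a vertex of the cell selected by `x`: `V_B` is finite and `B` minimizes
`V_B - ∑ i ∈ B, x i`. -/
def IsInitialBase (V : ValuatedMatroid α) (x : α → ℝ) (B : Finset α) : Prop :=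
  V.val B ≠ ⊤ ∧ ∀ B', V.tilt x B ≤ V.tilt x B'

theorem exists_isInitialBase (V : ValuatedMatroid α) (x : α → ℝ) :
    ∃ B, V.IsInitialBase x B := by
  classical
  obtain ⟨B₀, hB₀⟩ := V.exists_ne_top
  obtain ⟨B, hB, hmin⟩ := Finset.exists_min_image V.ground.powerset (V.tilt x)
    ⟨B₀, Finset.mem_powerset.2 (V.subset_card_of_ne_top B₀ hB₀).1⟩
  have hle : ∀ B', V.tilt x B ≤ V.tilt x B' := by
    intro B'
    by_cases h : V.val B' = ⊤
    · simp [tilt, h]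
    · exact hmin B' (Finset.mem_powerset.2 (V.subset_card_of_ne_top B' h).1)
  refine ⟨B, fun htop => ?_, hle⟩
  have h0 := hle B₀
  rw [tilt, htop, top_add, top_le_iff, tilt, WithTop.add_eq_top] at h0
  exact h0.elim hB₀ WithTop.coe_ne_top

theorem tilt_ne_top (V : ValuatedMatroid α) (x : α → ℝ) {B : Finset α} (h : V.val B ≠ ⊤) :
    V.tilt x B ≠ ⊤ := by
  rw [tilt, Ne, WithTop.add_eq_top]
  exact fun h' => h'.elim h WithTop.coe_ne_top

theorem isInitialBase_exchange (V : ValuatedMatroid α) (x : α → ℝ) (X Y : Finset α)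
    (hX : V.IsInitialBase x X) (hY : V.IsInitialBase x Y) (a : α) (ha : a ∈ X \ Y) :
    ∃ b ∈ Y \ X, V.IsInitialBase x (insert b (X.erase a)) := by
  obtain ⟨b, hb, h⟩ := V.exists_exchange hX.1 hY.1 ha
  obtain ⟨haX, haY⟩ := Finset.mem_sdiff.1 ha
  obtain ⟨hbY, hbX⟩ := Finset.mem_sdiff.1 hb
  have hsum : (-∑ i ∈ insert b (X.erase a), x i) + (-∑ i ∈ (insert a Y).erase b, x i)
      = (-∑ i ∈ X, x i) + (-∑ i ∈ Y, x i) := by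
    have h1 : ∑ i ∈ insert b (X.erase a), x i = x b + ∑ i ∈ X.erase a, x i :=
      Finset.sum_insert (fun h => hbX (Finset.mem_of_mem_erase h))
    have h2 : ∑ i ∈ X.erase a, x i + x a = ∑ i ∈ X, x i := Finset.sum_erase_add _ _ haX
    have h3 : ∑ i ∈ (insert a Y).erase b, x i + x b = ∑ i ∈ insert a Y, x i :=
      Finset.sum_erase_add _ _ (Finset.mem_insert_of_mem hbY)
    have h4 : ∑ i ∈ insert a Y, x i = x a + ∑ i ∈ Y, x i := Finset.sum_insert haY
    linarith
  have htilt : V.tilt x (insert b (X.erase a)) + V.tilt x ((insert a Y).erase b)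
      ≤ V.tilt x X + V.tilt x Y := by
    simp only [tilt]
    rw [add_add_add_comm, add_add_add_comm (V.val X), ← WithTop.coe_add, ← WithTop.coe_add, hsum]
    gcongr
  have hle : V.tilt x (insert b (X.erase a)) ≤ V.tilt x X := by
    by_contra hlt
    rw [not_le] at hlt
    exact absurd htilt (not_le.2
      (WithTop.add_lt_add_of_lt_of_le (V.tilt_ne_top x hY.1) hlt (hY.2 _)))
  refine ⟨b, hb, fun htop => ?_, fun B' => hle.trans (hX.2 B')⟩
  rw [tilt, htop, top_add, top_le_iff] at hle
  exact V.tilt_ne_top x hX.1 hle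

/-- The initial matroid `V^x`. -/
noncomputable def initialMatroid (V : ValuatedMatroid α) (x : α → ℝ) : Matroid α :=
  matroidOfBases V.ground (V.IsInitialBase x) (V.exists_isInitialBase x)
    (fun B hB => (V.subset_card_of_ne_top B hB.1).1) (V.isInitialBase_exchange x)

theorem initialMatroid_ground (V : ValuatedMatroid α) (x : α → ℝ) :
    (V.initialMatroid x).E = V.ground := rfl

/-- The set `𝓜(V)` of the initial matroids of `V` all of whose loops are loops of `V`. -/
def initialMatroids (V : ValuatedMatroid α) : Set (Matroid α) :=
  {M | (∃ x : α → ℝ, M = V.initialMatroid x) ∧ ∀ e, M.IsLoop e → V.underlying.IsLoop e}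

theorem exists_finset_isBasis' (V : ValuatedMatroid α) (F : Finset α) :
    ∃ I : Finset α, V.underlying.IsBasis' (I : Set α) (F : Set α) := by
  obtain ⟨I, hI⟩ := V.underlying.exists_isBasis' (F : Set α)
  obtain ⟨I', rfl⟩ := (F.finite_toSet.subset hI.subset).exists_finset_coe
  exact ⟨I', hI⟩

/-- A chosen basis of `F` in the underlying matroid. -/
noncomputable def basisOf (V : ValuatedMatroid α) (F : Finset α) : Finset α :=
  (V.exists_finset_isBasis' F).choose

theorem basisOf_isBasis' (V : ValuatedMatroid α) (F : Finset α) :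
    V.underlying.IsBasis' (V.basisOf F : Set α) (F : Set α) :=
  (V.exists_finset_isBasis' F).choose_spec

theorem basisOf_subset (V : ValuatedMatroid α) (F : Finset α) : V.basisOf F ⊆ F := by
  exact_mod_cast (V.basisOf_isBasis' F).subset

/-- The contraction `V / F`, on the ground set `E \ F`: `(V / F)_B = V_{B ∪ I}` for a basis `I` of
`F` in the underlying matroid.  Another choice of `I` changes the vector by a real scalar only, and
this is the vector of `(V* | (E \ F))*`. -/
noncomputable def contract (V : ValuatedMatroid α) (F : Finset α) : ValuatedMatroid α where
  ground := V.ground \ F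
  rank := V.rank - (V.basisOf F).card
  val B := if B ⊆ V.ground \ F then V.val (B ∪ V.basisOf F) else ⊤
  subset_card_of_ne_top := by
    intro B hB
    by_cases h : B ⊆ V.ground \ F
    · refine ⟨h, ?_⟩
      rw [if_pos h] at hB
      have hd : Disjoint B (V.basisOf F) :=
        Finset.disjoint_of_subset_left h
          (Finset.disjoint_of_subset_right (V.basisOf_subset F) Finset.sdiff_disjoint)
      have := (V.subset_card_of_ne_top _ hB).2
      rw [Finset.card_union_of_disjoint hd] at this
      omega
    · rw [if_neg h] at hB
      exact absurd rfl hB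
  exists_ne_top := by
    have hI := V.basisOf_isBasis' F
    obtain ⟨B, hB, hIB⟩ := hI.indep.exists_isBase_superset
    obtain ⟨B', rfl, hB'⟩ := hB
    have hIB' : V.basisOf F ⊆ B' := by exact_mod_cast hIB
    have hsub : B' \ V.basisOf F ⊆ V.ground \ F := by
      intro e he
      obtain ⟨heB, heI⟩ := Finset.mem_sdiff.1 he
      refine Finset.mem_sdiff.2 ⟨(V.subset_card_of_ne_top _ hB').1 heB, fun heF => heI ?_⟩
      have hind : V.underlying.Indep (insert e (V.basisOf F : Set α)) :=
        (show V.underlying.IsBase (B' : Set α) from ⟨B', rfl, hB'⟩).indep.subset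
          (Set.insert_subset (Finset.mem_coe.2 heB) hIB)
      exact Finset.mem_coe.1 (hI.mem_of_insert_indep heF hind)
    refine ⟨B' \ V.basisOf F, ?_⟩
    rwa [if_pos hsub, Finset.sdiff_union_of_subset hIB']
  plucker := by
    intro A C hA hC hAc hCc
    have hI := V.basisOf_subset F
    have hIE : V.basisOf F ⊆ V.ground := by
      exact_mod_cast (V.basisOf_isBasis' F).indep.subset_ground
    have hdj : ∀ S : Finset α, S ⊆ V.ground \ F → Disjoint S (V.basisOf F) := fun S hS =>
      Finset.disjoint_of_subset_left hS
        (Finset.disjoint_of_subset_right hI Finset.sdiff_disjoint)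
    have hset : (C ∪ V.basisOf F) \ (A ∪ V.basisOf F) = C \ A := by
      ext e
      have : e ∈ C → e ∉ V.basisOf F := fun h => Finset.disjoint_left.1 (hdj C hC) h
      simp only [Finset.mem_sdiff, Finset.mem_union]
      tauto
    have key := V.plucker (A ∪ V.basisOf F) (C ∪ V.basisOf F)
      (Finset.union_subset (hA.trans Finset.sdiff_subset) hIE)
      (Finset.union_subset (hC.trans Finset.sdiff_subset) hIE)
      (by rw [Finset.card_union_of_disjoint (hdj A hA)]; omega)
      (by rw [Finset.card_union_of_disjoint (hdj C hC)]; omega)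
    rw [hset] at key
    have hval : ∀ k ∈ C \ A,
        (if insert k A ⊆ V.ground \ F then V.val (insert k A ∪ V.basisOf F) else ⊤)
          + (if C.erase k ⊆ V.ground \ F then V.val (C.erase k ∪ V.basisOf F) else ⊤)
        = V.val (insert k (A ∪ V.basisOf F)) + V.val ((C ∪ V.basisOf F).erase k) := by
      intro k hk
      obtain ⟨hkC, hkA⟩ := Finset.mem_sdiff.1 hk
      have hkI : k ∉ V.basisOf F := Finset.disjoint_left.1 (hdj C hC) hkC
      rw [if_pos (Finset.insert_subset (hC hkC) hA),
        if_pos ((Finset.erase_subset _ _).trans hC), Finset.insert_union,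
        Finset.erase_union_distrib, Finset.erase_eq_of_notMem hkI]
    obtain ⟨i, hi, j, hj, hij, hmi, hmj⟩ := key
    refine ⟨i, hi, j, hj, hij, fun k hk => ?_, fun k hk => ?_⟩
    · rw [hval i hi, hval k hk]; exact hmi k hk
    · rw [hval j hj, hval k hk]; exact hmj k hk

theorem contract_ground (V : ValuatedMatroid α) (F : Finset α) :
    (V.contract F).ground = V.ground \ F := rfl

end ValuatedMatroid

namespace Matroid

variable {α : Type*}

/-- The rank of `X`, as a natural number (used for matroids on finite sets only). -/
noncomputable def natRk (M : Matroid α) (X : Set α) : ℕ := (M.eRk X).toNat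

/-- The corank `rk(M) - rk(X)`. -/
noncomputable def corank (M : Matroid α) (X : Set α) : ℤ := (M.natRk M.E : ℤ) - (M.natRk X : ℤ)

/-- `F` is a flat of `M` and its complement is a flat of the dual. -/
def IsCyclicFlat (M : Matroid α) (F : Set α) : Prop := M.IsFlat F ∧ M✶.IsFlat (M.E \ F)

/-- The finite cyclic flats of `M`, ordered by inclusion; for a matroid on a finite set this is the
lattice of cyclic flats. -/
abbrev CyclicFlat (M : Matroid α) : Type _ := {F : Finset α // M.IsCyclicFlat (F : Set α)}

open Classical in
/-- `τ_M(F) = ∑ μ(F, F') cork(F')`, the sum over the cyclic flats `F'` containing the cyclic flat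
`F`, where `μ` is the Möbius function of the lattice of cyclic flats.  The value is `0` if `F` is
not a cyclic flat. -/
noncomputable def tau [Fintype α] (M : Matroid α) (F : Finset α) : ℤ :=
  if hF : M.IsCyclicFlat (F : Set α) then
    ∑ F' : M.CyclicFlat with (⟨F, hF⟩ : M.CyclicFlat) ≤ F',
      IncidenceAlgebra.mu ℤ (⟨F, hF⟩ : M.CyclicFlat) F' * M.corank ((F' : Finset α) : Set α)
  else 0

/-- A matroid of rank `d` is transversal if there are `d` subsets of the ground set such that the
independent sets are exactly the partial transversals. -/
def IsTransversal (M : Matroid α) : Prop :=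
  ∃ A : Fin (M.natRk M.E) → Set α, (∀ i, A i ⊆ M.E) ∧
    ∀ J : Set α, M.Indep J ↔
      ∃ f : J → Fin (M.natRk M.E), Function.Injective f ∧ ∀ j : J, (j : α) ∈ A (f j)

end Matroid

namespace ValuatedMatroid

variable {α : Type*} [DecidableEq α]

/-- `M` is a facet of the regular subdivision of the matroid polytope induced by `V`: it is an
initial matroid of `V` whose cell is maximal under inclusion.  Cells are compared through their
vertex sets, which are indexed by the bases. -/
def IsFacet (V : ValuatedMatroid α) (M : Matroid α) : Prop :=
  (∃ x : α → ℝ, M = V.initialMatroid x) ∧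
    ∀ y : α → ℝ, (∀ B, M.IsBase B → (V.initialMatroid y).IsBase B) →
      ∀ B, (V.initialMatroid y).IsBase B → M.IsBase B

/-- Every facet of the regular subdivision induced by `V` is a transversal matroid. -/
def HasTransversalFacets (V : ValuatedMatroid α) : Prop :=
  ∀ M, V.IsFacet M → M.IsTransversal

/-- The union of the sets `𝓜(V / F)` over the cyclic flats `F` of the underlying matroid. -/
def initialMatroidsBar (V : ValuatedMatroid α) : Set (Matroid α) :=
  {M | ∃ F : Finset α, V.underlying.IsCyclicFlat (F : Set α) ∧ M ∈ (V.contract F).initialMatroids}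

/-- The matroids that are counted in the distinguished multiset: the members of the union above all
of whose coloops are coloops of `V`. -/
def distinguishedCandidates (V : ValuatedMatroid α) : Set (Matroid α) :=
  {M | M ∈ V.initialMatroidsBar ∧ ∀ e, M.IsColoop e → V.underlying.IsColoop e}

theorem finite_distinguishedCandidates (V : ValuatedMatroid α) :
    V.distinguishedCandidates.Finite := by
  refine (Matroid.finite_setOfPred_matroid V.ground.finite_toSet).subset ?_
  rintro M ⟨⟨F, -, ⟨x, rfl⟩, -⟩, -⟩
  have h : (V.contract F).ground ⊆ V.ground := by
    rw [contract_ground]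
    exact Finset.sdiff_subset
  rw [Set.mem_ofPred_eq, initialMatroid_ground]
  exact Finset.coe_subset.2 h

/-- The distinguished multiset of matroids of `V`: each candidate `M` with multiplicity
`τ_M(∅)` (read as `0` should it be negative). -/
noncomputable def distinguishedMatroids [Fintype α] (V : ValuatedMatroid α) :
    Multiset (Matroid α) :=
  ∑ M ∈ V.finite_distinguishedCandidates.toFinset, Multiset.replicate (M.tau ∅).toNat M

end ValuatedMatroid

/-- A function on finite sets which is the rank function of a matroid. -/
structure IsRankFn {α : Type*} [DecidableEq α] (r : Finset α → ℕ) : Prop where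
  mono : ∀ S T, S ⊆ T → r S ≤ r T
  submod : ∀ S T, r (S ∪ T) + r (S ∩ T) ≤ r S + r T
  le_card : ∀ S, r S ≤ S.card

/-- The nullity of a set. -/
def nullity {α : Type*} (r : Finset α → ℕ) (S : Finset α) : ℤ := S.card - r S

/-- The flats in `G` of the rank function `r`. -/
def IsRkFlat {α : Type*} [DecidableEq α] (r : Finset α → ℕ) (G F : Finset α) : Prop :=
  ∀ e ∈ G, e ∉ F → r F < r (insert e F)

/-- The sets without coloops of the rank function `r`. -/
def IsRkCyclic {α : Type*} [DecidableEq α] (r : Finset α → ℕ) (F : Finset α) : Prop :=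
  ∀ e ∈ F, r (F.erase e) = r F

open Classical in
/-- The cyclic flats in `G` of the rank function `r`. -/
noncomputable def cyclicFlats {α : Type*} [DecidableEq α] (r : Finset α → ℕ) (G : Finset α) :
    Finset (Finset α) :=
  G.powerset.filter fun F => IsRkFlat r G F ∧ IsRkCyclic r F

/-- The largest cyclic subset of `S`. -/
def cyclicPart {α : Type*} [DecidableEq α] (r : Finset α → ℕ) (S : Finset α) : Finset α :=
  S.filter fun e => r (S.erase e) = r S

theorem mem_cyclicFlats {α : Type*} [DecidableEq α] {r : Finset α → ℕ} {G F : Finset α} :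
    F ∈ cyclicFlats r G ↔ F ⊆ G ∧ IsRkFlat r G F ∧ IsRkCyclic r F := by
  simp [cyclicFlats]

namespace IsRankFn

variable {α : Type*} [DecidableEq α] {r : Finset α → ℕ}

theorem empty (hr : IsRankFn r) : r ∅ = 0 := by simpa using hr.le_card ∅

theorem le_add_card_sdiff (hr : IsRankFn r) {S T : Finset α} :
    r T ≤ r S + (T \ S).card := by
  have h1 := hr.submod S (T \ S)
  have h2 := hr.le_card (T \ S)
  have h3 := hr.mono T (S ∪ T \ S) (by intro x hx; simp; tauto)
  omega

theorem insert_le (hr : IsRankFn r) (S : Finset α) (e : α) : r (insert e S) ≤ r S + 1 := by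
  have h := hr.le_add_card_sdiff (S := S) (T := insert e S)
  have h2 : (insert e S \ S).card ≤ 1 := by
    calc (insert e S \ S).card ≤ ({e} : Finset α).card :=
          Finset.card_le_card (by intro x hx; simp at hx ⊢; tauto)
      _ = 1 := by simp
  omega

theorem nullity_mono (hr : IsRankFn r) {S T : Finset α} (h : S ⊆ T) :
    nullity r S ≤ nullity r T := by
  have h1 := hr.le_add_card_sdiff (S := S) (T := T)
  have h2 := Finset.card_sdiff_add_card_eq_card h
  unfold nullity
  omega

theorem nullity_supermod (hr : IsRankFn r) (S T : Finset α) :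
    nullity r S + nullity r T ≤ nullity r (S ∪ T) + nullity r (S ∩ T) := by
  have h1 := hr.submod S T
  have h2 := Finset.card_union_add_card_inter S T
  unfold nullity
  omega

theorem nullity_nonneg (hr : IsRankFn r) (S : Finset α) : 0 ≤ nullity r S := by
  have := hr.le_card S
  unfold nullity
  omega

theorem nullity_empty (hr : IsRankFn r) : nullity r ∅ = 0 := by
  simp [nullity, hr.empty]

theorem nullity_insert_iff (hr : IsRankFn r) {F : Finset α} {e : α} (he : e ∉ F) :
    r F < r (insert e F) ↔ nullity r (insert e F) = nullity r F := by
  have := hr.insert_le F e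
  have h := hr.mono F (insert e F) (Finset.subset_insert _ _)
  unfold nullity
  rw [Finset.card_insert_of_notMem he]
  push_cast
  omega

theorem nullity_erase_iff (hr : IsRankFn r) {F : Finset α} {e : α} (he : e ∈ F) :
    r (F.erase e) = r F ↔ nullity r (F.erase e) < nullity r F := by
  have h1 := hr.insert_le (F.erase e) e
  rw [Finset.insert_erase he] at h1
  have h := hr.mono (F.erase e) F (Finset.erase_subset _ _)
  have := Finset.card_erase_add_one he
  unfold nullity
  omega

theorem cyclic_subset_cyclicPart (hr : IsRankFn r) {C S : Finset α} (hC : IsRkCyclic r C)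
    (h : C ⊆ S) : C ⊆ cyclicPart r S := by
  intro e he
  refine Finset.mem_filter.2 ⟨h he, ?_⟩
  rw [hr.nullity_erase_iff (h he)]
  have h1 := (hr.nullity_erase_iff he).1 (hC e he)
  have h2 := hr.nullity_supermod C (S.erase e)
  have e1 : C ∪ S.erase e = S := by
    ext x
    by_cases hx : x = e
    · subst hx; simp [he, h he]
    · have := @h x
      simp [hx]; tauto
  have e2 : C ∩ S.erase e = C.erase e := by
    ext x
    have := @h x
    simp; tauto
  rw [e1, e2] at h2
  omega

theorem nullity_sdiff_eq (hr : IsRankFn r) {S : Finset α} (D : Finset α)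
    (hD : ∀ e ∈ D, nullity r (S.erase e) = nullity r S) : nullity r (S \ D) = nullity r S := by
  induction D using Finset.induction_on with
  | empty => simp
  | insert e D he ih =>
    have ih := ih fun x hx => hD x (Finset.mem_insert_of_mem hx)
    have h1 := hD e (Finset.mem_insert_self _ _)
    have h2 := hr.nullity_supermod (S \ D) (S.erase e)
    have h3 := hr.nullity_mono (S := (S \ D) ∪ S.erase e) (T := S)
      (Finset.union_subset Finset.sdiff_subset (Finset.erase_subset _ _))
    have e2 : (S \ D) ∩ S.erase e = S \ insert e D := by
      ext x
      simp; tauto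
    rw [e2] at h2
    have h4 := hr.nullity_mono (S := S \ insert e D) (T := S) Finset.sdiff_subset
    omega

theorem cyclicPart_subset (r : Finset α → ℕ) (S : Finset α) : cyclicPart r S ⊆ S :=
  Finset.filter_subset _ _

theorem nullity_cyclicPart (hr : IsRankFn r) (S : Finset α) :
    nullity r (cyclicPart r S) = nullity r S := by
  rw [← Finset.sdiff_sdiff_eq_self (cyclicPart_subset r S)]
  apply hr.nullity_sdiff_eq
  intro e he
  obtain ⟨heS, he⟩ := Finset.mem_sdiff.1 he
  have h : ¬ r (S.erase e) = r S := fun h => he (Finset.mem_filter.2 ⟨heS, h⟩)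
  rw [hr.nullity_erase_iff heS] at h
  exact le_antisymm (hr.nullity_mono (Finset.erase_subset _ _)) (not_lt.1 h)

theorem isRkCyclic_cyclicPart (hr : IsRankFn r) (S : Finset α) :
    IsRkCyclic r (cyclicPart r S) := by
  intro e he
  rw [hr.nullity_erase_iff he, hr.nullity_cyclicPart]
  obtain ⟨heS, h⟩ := Finset.mem_filter.1 he
  rw [hr.nullity_erase_iff heS] at h
  exact lt_of_le_of_lt (hr.nullity_mono
    (Finset.erase_subset_erase _ (cyclicPart_subset r S))) h

theorem isRkFlat_cyclicPart (hr : IsRankFn r) {G S : Finset α} (hS : IsRkFlat r G S) :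
    IsRkFlat r G (cyclicPart r S) := by
  intro e heG he
  rw [hr.nullity_insert_iff he, hr.nullity_cyclicPart]
  refine le_antisymm ?_ ?_
  · by_cases heS : e ∈ S
    · exact hr.nullity_mono (Finset.insert_subset heS (cyclicPart_subset r S))
    · rw [← (hr.nullity_insert_iff heS).1 (hS e heG heS)]
      exact hr.nullity_mono (Finset.insert_subset_insert _ (cyclicPart_subset r S))
  · rw [← hr.nullity_cyclicPart]
    exact hr.nullity_mono (Finset.subset_insert _ _)

theorem cyclicPart_mem (hr : IsRankFn r) {G S : Finset α} (hSG : S ⊆ G) (hS : IsRkFlat r G S) :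
    cyclicPart r S ∈ cyclicFlats r G :=
  mem_cyclicFlats.2 ⟨(cyclicPart_subset r S).trans hSG, hr.isRkFlat_cyclicPart hS,
    hr.isRkCyclic_cyclicPart S⟩

theorem cyclicPart_eq_iff (hr : IsRankFn r) {F S : Finset α} (hF : IsRkCyclic r F) :
    cyclicPart r S = F ↔ F ⊆ S ∧ nullity r S = nullity r F := by
  constructor
  · rintro rfl
    exact ⟨cyclicPart_subset r S, (hr.nullity_cyclicPart S).symm⟩
  · rintro ⟨hFS, hn⟩
    refine Finset.Subset.antisymm (fun e he => ?_) (hr.cyclic_subset_cyclicPart hF hFS)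
    by_contra heF
    obtain ⟨heS, h⟩ := Finset.mem_filter.1 he
    rw [hr.nullity_erase_iff heS] at h
    have := hr.nullity_mono (Finset.subset_erase.2 ⟨hFS, heF⟩)
    omega

theorem cyclicPart_of_cyclic (hr : IsRankFn r) {F : Finset α} (hF : IsRkCyclic r F) :
    cyclicPart r F = F := (hr.cyclicPart_eq_iff hF).2 ⟨subset_rfl, rfl⟩

theorem isRkCyclic_empty (r : Finset α → ℕ) : IsRkCyclic r ∅ := by simp [IsRkCyclic]

theorem isRkCyclic_union (hr : IsRankFn r) {S T : Finset α} (hS : IsRkCyclic r S)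
    (hT : IsRkCyclic r T) : IsRkCyclic r (S ∪ T) := by
  have : cyclicPart r (S ∪ T) = S ∪ T :=
    Finset.Subset.antisymm (cyclicPart_subset r _) (Finset.union_subset
      (hr.cyclic_subset_cyclicPart hS Finset.subset_union_left)
      (hr.cyclic_subset_cyclicPart hT Finset.subset_union_right))
  rw [← this]
  exact hr.isRkCyclic_cyclicPart _

/-- A new element raises the rank of each subset of a set whose rank it raises. -/
theorem lt_insert_of_subset (hr : IsRankFn r) {S T : Finset α} {e : α} (h : S ⊆ T) (he : e ∉ T)
    (hT : r T < r (insert e T)) : r S < r (insert e S) := by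
  have h1 := hr.submod (insert e S) T
  have e1 : insert e S ∪ T = insert e T := by
    ext x
    have := @h x
    simp; tauto
  have e2 : insert e S ∩ T = S := by
    ext x
    have := @h x
    by_cases hx : x = e
    · subst hx; simp [he]; tauto
    · simp [hx]; tauto
  rw [e1, e2] at h1
  omega

theorem isRkFlat_inter (hr : IsRankFn r) {G S T : Finset α} (hS : IsRkFlat r G S)
    (hT : IsRkFlat r G T) : IsRkFlat r G (S ∩ T) := by
  intro e heG he
  by_cases heS : e ∈ S
  · have heT : e ∉ T := fun h => he (Finset.mem_inter.2 ⟨heS, h⟩)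
    exact hr.lt_insert_of_subset Finset.inter_subset_right heT (hT e heG heT)
  · exact hr.lt_insert_of_subset Finset.inter_subset_left heS (hS e heG heS)

theorem nullity_cyclicPart_inter_eq_zero (hr : IsRankFn r) (S T : Finset α) :
    nullity r (cyclicPart r S ∩ T) = 0 ↔ nullity r (S ∩ T) = 0 := by
  constructor
  · intro h
    have h1 : cyclicPart r (S ∩ T) ⊆ cyclicPart r S ∩ T :=
      Finset.subset_inter (hr.cyclic_subset_cyclicPart (hr.isRkCyclic_cyclicPart _)
        ((cyclicPart_subset r _).trans Finset.inter_subset_left))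
        ((cyclicPart_subset r _).trans Finset.inter_subset_right)
    have h2 := hr.nullity_mono h1
    rw [hr.nullity_cyclicPart, h] at h2
    exact le_antisymm h2 (hr.nullity_nonneg _)
  · intro h
    have h2 := hr.nullity_mono
      (Finset.inter_subset_inter_right (cyclicPart_subset r S) (u := T))
    rw [h] at h2
    exact le_antisymm h2 (hr.nullity_nonneg _)

theorem cyclicPart_eq_empty_iff (hr : IsRankFn r) (S : Finset α) :
    cyclicPart r S = ∅ ↔ nullity r S = 0 := by
  rw [hr.cyclicPart_eq_iff (isRkCyclic_empty r), hr.nullity_empty]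
  simp

/-- If `F` and `A` are complementary and `r F + r A = r (F ∪ A)` then the rank is additive. -/
theorem rk_eq_add_of_separated (hr : IsRankFn r) {F A X : Finset α}
    (hd : Disjoint F A) (hsep : r F + r A = r (F ∪ A)) (hX : X ⊆ F ∪ A) :
    r X = r (X ∩ F) + r (X ∩ A) := by
  have e1 : X ∩ F ∪ X ∩ A = X := by
    rw [← Finset.inter_union_distrib_left, Finset.inter_eq_left.2 hX]
  have h1 := hr.submod (X ∩ F) (X ∩ A)
  rw [e1] at h1
  have h2 := hr.submod X F
  have h3 := hr.submod (X ∪ F) A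
  have e3 : (X ∪ F) ∪ A = F ∪ A := by
    rw [Finset.union_assoc, Finset.union_eq_right.2 hX]
  have e4 : (X ∪ F) ∩ A = X ∩ A := by
    rw [Finset.union_inter_distrib_right, Finset.disjoint_iff_inter_eq_empty.1 hd,
      Finset.union_empty]
  rw [e3, e4] at h3
  omega

end IsRankFn

/-! ### Möbius inversion over a finite family of sets -/

section Mob

variable {α : Type*} [DecidableEq α]

/-- The function whose sum over the members of `𝓕` above `F` is `c F`. -/
def mob (𝓕 : Finset (Finset α)) (c : Finset α → ℤ) (F : Finset α) : ℤ :=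
  c F - ∑ F' ∈ (𝓕.filter (F ⊂ ·)).attach, mob 𝓕 c F'
termination_by (𝓕.filter (F ⊂ ·)).card
decreasing_by
  obtain ⟨_, hlt⟩ := Finset.mem_filter.1 F'.2
  apply Finset.card_lt_card
  refine (Finset.ssubset_iff_of_subset ?_).2 ⟨F', F'.2, by simp⟩
  intro X hX
  simp only [Finset.mem_filter] at hX ⊢
  exact ⟨hX.1, hlt.trans hX.2⟩

theorem sum_superset_eq (𝓕 : Finset (Finset α)) (f : Finset α → ℤ) {F : Finset α} (hF : F ∈ 𝓕) :
    ∑ F' ∈ 𝓕 with F ⊆ F', f F' = f F + ∑ F' ∈ 𝓕 with F ⊂ F', f F' := by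
  have : 𝓕.filter (F ⊆ ·) = insert F (𝓕.filter (F ⊂ ·)) := by
    ext X
    simp only [Finset.mem_filter, Finset.mem_insert, subset_iff_ssubset_or_eq]
    constructor
    · rintro ⟨hX, h | h⟩
      · exact Or.inr ⟨hX, h⟩
      · exact Or.inl h.symm
    · rintro (rfl | h)
      · exact ⟨hF, Or.inr rfl⟩
      · exact ⟨h.1, Or.inl h.2⟩
  rw [this, Finset.sum_insert (by simp)]

theorem sum_mob (𝓕 : Finset (Finset α)) (c : Finset α → ℤ) {F : Finset α} (hF : F ∈ 𝓕) :
    ∑ F' ∈ 𝓕 with F ⊆ F', mob 𝓕 c F' = c F := by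
  rw [sum_superset_eq 𝓕 _ hF, mob, Finset.sum_attach _ (fun F' => mob 𝓕 c F')]
  ring

/-- Induction from the top of a finite family of sets. -/
theorem family_induction (𝓕 : Finset (Finset α)) {P : Finset α → Prop}
    (h : ∀ F ∈ 𝓕, (∀ F' ∈ 𝓕, F ⊂ F' → P F') → P F) : ∀ F ∈ 𝓕, P F := by
  have key : ∀ n : ℕ, ∀ F ∈ 𝓕, (𝓕.sup id).card - F.card ≤ n → P F := by
    intro n
    induction n with
    | zero =>
      intro F hF hn
      refine h F hF fun F' hF' hlt => ?_
      have h1 := Finset.card_lt_card hlt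
      have h2 := Finset.card_le_card (Finset.le_sup (f := id) hF')
      simp only [id] at h2
      omega
    | succ n ih =>
      intro F hF hn
      refine h F hF fun F' hF' hlt => ih F' hF' ?_
      have h1 := Finset.card_lt_card hlt
      have h2 := Finset.card_le_card (Finset.le_sup (f := id) hF')
      simp only [id] at h2
      omega
  exact fun F hF => key _ F hF le_rfl

theorem eq_of_sum_superset_eq (𝓕 : Finset (Finset α)) {f g : Finset α → ℤ}
    (h : ∀ F ∈ 𝓕, ∑ F' ∈ 𝓕 with F ⊆ F', f F' = ∑ F' ∈ 𝓕 with F ⊆ F', g F') :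
    ∀ F ∈ 𝓕, f F = g F := by
  refine family_induction 𝓕 fun F hF ih => ?_
  have h1 := h F hF
  rw [sum_superset_eq 𝓕 f hF, sum_superset_eq 𝓕 g hF,
    Finset.sum_congr rfl (fun F' hF' => ih F' (Finset.mem_filter.1 hF').1
      (Finset.mem_filter.1 hF').2)] at h1
  exact add_right_cancel h1

theorem mob_congr {𝓕 : Finset (Finset α)} {c c' : Finset α → ℤ} (h : ∀ F ∈ 𝓕, c F = c' F) :
    ∀ F ∈ 𝓕, mob 𝓕 c F = mob 𝓕 c' F :=
  eq_of_sum_superset_eq 𝓕 fun F hF => by rw [sum_mob 𝓕 c hF, sum_mob 𝓕 c' hF, h F hF]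

theorem cyclicFlats_congr {r ρ : Finset α → ℕ} {G : Finset α} (h : ∀ S ⊆ G, r S = ρ S) :
    cyclicFlats r G = cyclicFlats ρ G := by
  ext F
  simp only [mem_cyclicFlats]
  refine and_congr_right fun hF => and_congr ?_ ?_
  · refine forall_congr' fun e => forall_congr' fun he => forall_congr' fun _ => ?_
    rw [h F hF, h _ (Finset.insert_subset he hF)]
  · refine forall_congr' fun e => forall_congr' fun he => ?_
    rw [h F hF, h _ ((Finset.erase_subset _ _).trans hF)]

end Mob

namespace IsRankFn

variable {α : Type*} [DecidableEq α] {r : Finset α → ℕ}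

theorem mem_cyclicFlats_minor (hr : IsRankFn r) {ρ : Finset α → ℕ} {G T H S : Finset α}
    (hT : T ∈ cyclicFlats r G) (hH : H ∈ cyclicFlats r G) (hHT : H ⊆ T)
    (hρ : ∀ S ⊆ T \ H, ρ S + r H = r (H ∪ S)) (hS : S ⊆ T \ H) :
    S ∈ cyclicFlats ρ (T \ H) ↔ H ∪ S ∈ cyclicFlats r G := by
  obtain ⟨hTG, hTf, hTc⟩ := mem_cyclicFlats.1 hT
  obtain ⟨hHG, hHf, hHc⟩ := mem_cyclicFlats.1 hH
  have hdis : ∀ e ∈ S, e ∉ H := fun e he => (Finset.mem_sdiff.1 (hS he)).2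
  have hST : S ⊆ T := hS.trans Finset.sdiff_subset
  have h0 := hρ S hS
  have hins : ∀ e ∈ T \ H, (r (H ∪ S) < r (insert e (H ∪ S)) ↔ ρ S < ρ (insert e S)) := by
    intro e he
    have := hρ (insert e S) (Finset.insert_subset he hS)
    rw [Finset.union_insert] at this
    omega
  have her : ∀ e ∈ S, (r ((H ∪ S).erase e) = r (H ∪ S) ↔ ρ (S.erase e) = ρ S) := by
    intro e he
    have := hρ (S.erase e) ((Finset.erase_subset _ _).trans hS)
    rw [Finset.erase_union_distrib, Finset.erase_eq_of_notMem (hdis e he)]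
    omega
  simp only [mem_cyclicFlats]
  constructor
  · rintro ⟨-, hf, hc⟩
    refine ⟨Finset.union_subset hHG (hST.trans hTG), ?_, ?_⟩
    · intro e heG he
      by_cases heT : e ∈ T
      · have he' : e ∈ T \ H :=
          Finset.mem_sdiff.2 ⟨heT, fun h => he (Finset.mem_union_left _ h)⟩
        exact (hins e he').2 (hf e he' fun h => he (Finset.mem_union_right _ h))
      · exact hr.lt_insert_of_subset (Finset.union_subset hHT hST) heT (hTf e heG heT)
    · intro e he
      by_cases heH : e ∈ H
      · exact (Finset.mem_filter.1
          (hr.cyclic_subset_cyclicPart hHc Finset.subset_union_left heH)).2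
      · have heS : e ∈ S := (Finset.mem_union.1 he).resolve_left heH
        exact (her e heS).2 (hc e heS)
  · rintro ⟨-, hf, hc⟩
    refine ⟨hS, ?_, ?_⟩
    · intro e he heS
      refine (hins e he).1 (hf e (hTG (Finset.mem_sdiff.1 he).1) ?_)
      rw [Finset.mem_union, not_or]
      exact ⟨(Finset.mem_sdiff.1 he).2, heS⟩
    · intro e he
      exact (her e he).1 (hc e (Finset.mem_union_right _ he))

/-- The Möbius function sum of a minor `T / H` at its least element, as a sum over the cyclic
flats which meet `T` in `H`, up to coloops. -/
theorem mob_minor (hr : IsRankFn r) {ρ : Finset α → ℕ} {G T H : Finset α} {d d' : ℤ}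
    (hT : T ∈ cyclicFlats r G) (hH : H ∈ cyclicFlats r G) (hHT : H ⊂ T)
    (hρ : ∀ S ⊆ T \ H, ρ S + r H = r (H ∪ S)) :
    mob (cyclicFlats ρ (T \ H)) (fun S => d' - ρ S) ∅ =
      ∑ F ∈ cyclicFlats r G with cyclicPart r (F ∩ T) = H,
        mob (cyclicFlats r G) (fun S => d - r S) F := by
  set 𝓕 := cyclicFlats r G with h𝓕
  set 𝓖 := cyclicFlats ρ (T \ H) with h𝓖
  set t := mob 𝓕 (fun S => d - r S) with ht
  have hmem : ∀ S ⊆ T \ H, (S ∈ 𝓖 ↔ H ∪ S ∈ 𝓕) := fun S hS =>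
    hr.mem_cyclicFlats_minor hT hH hHT.1 hρ hS
  have h𝓖s : ∀ S ∈ 𝓖, S ⊆ T \ H := fun S hS => (mem_cyclicFlats.1 hS).1
  let U : Finset α → ℤ := fun K => ∑ F ∈ 𝓕 with cyclicPart r (F ∩ T) = K, t F
  obtain ⟨hTG, hTf, hTc⟩ := mem_cyclicFlats.1 hT
  have hHTe : H ∪ T \ H = T := Finset.union_sdiff_of_subset hHT.1
  have hsumU : ∀ S ∈ 𝓖, ∑ S' ∈ 𝓖 with S ⊆ S', U (H ∪ S') = d - r (H ∪ S) := by
    intro S hS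
    have hK := (hmem S (h𝓖s S hS)).1 hS
    rw [← sum_mob 𝓕 (fun S => d - r S) hK]
    have hmap : ∀ F ∈ 𝓕.filter (H ∪ S ⊆ ·),
        cyclicPart r (F ∩ T) \ H ∈ 𝓖.filter (S ⊆ ·) ∧
          H ∪ (cyclicPart r (F ∩ T) \ H) = cyclicPart r (F ∩ T) := by
      intro F hF
      obtain ⟨hF, hKF⟩ := Finset.mem_filter.1 hF
      have hc : cyclicPart r (F ∩ T) ∈ 𝓕 :=
        hr.cyclicPart_mem (Finset.inter_subset_right.trans hTG)
          (hr.isRkFlat_inter (mem_cyclicFlats.1 hF).2.1 hTf)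
      have hKc : H ∪ S ⊆ cyclicPart r (F ∩ T) :=
        hr.cyclic_subset_cyclicPart (mem_cyclicFlats.1 hK).2.2 (Finset.subset_inter hKF
          (Finset.union_subset hHT.1 ((h𝓖s S hS).trans Finset.sdiff_subset)))
      have he := Finset.union_sdiff_of_subset (Finset.union_subset_left hKc)
      have hcT : cyclicPart r (F ∩ T) \ H ⊆ T \ H := Finset.sdiff_subset_sdiff
        ((cyclicPart_subset r _).trans Finset.inter_subset_right) subset_rfl
      refine ⟨Finset.mem_filter.2 ⟨(hmem _ hcT).2 (he.symm ▸ hc), fun x hx => ?_⟩, he⟩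
      exact Finset.mem_sdiff.2 ⟨hKc (Finset.mem_union_right _ hx),
        (Finset.mem_sdiff.1 (h𝓖s S hS hx)).2⟩
    rw [← Finset.sum_fiberwise_of_maps_to (fun F hF => (hmap F hF).1) t]
    refine Finset.sum_congr rfl fun S' hS' => ?_
    obtain ⟨hS', hSS'⟩ := Finset.mem_filter.1 hS'
    refine Finset.sum_congr ?_ fun _ _ => rfl
    ext F
    simp only [Finset.mem_filter]
    constructor
    · rintro ⟨hF, hFe⟩
      have : H ∪ S ⊆ F := (Finset.union_subset_union_right hSS').trans
        (hFe ▸ (cyclicPart_subset r _).trans Finset.inter_subset_left)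
      refine ⟨⟨hF, this⟩, ?_⟩
      rw [hFe, Finset.union_sdiff_cancel_left]
      exact Finset.disjoint_of_subset_right (h𝓖s S' hS') Finset.disjoint_sdiff
    · rintro ⟨⟨hF, hFs⟩, hFe⟩
      refine ⟨hF, ?_⟩
      rw [← (hmap F (Finset.mem_filter.2 ⟨hF, hFs⟩)).2, hFe]
  have h0 : (∅ : Finset α) ∈ 𝓖 := (hmem ∅ (Finset.empty_subset _)).2 (by simpa using hH)
  have hA : T \ H ∈ 𝓖 := (hmem _ subset_rfl).2 (by rwa [hHTe])
  have hne : ∅ ≠ T \ H := fun h => hHT.2 (Finset.sdiff_eq_empty_iff_subset.1 h.symm)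
  have hUA : U (H ∪ T \ H) = d - r T := by
    have := hsumU _ hA
    rw [Finset.filter_congr (fun S' hS' =>
      (⟨fun h => (h𝓖s S' hS').antisymm h, fun h => h ▸ subset_rfl⟩ :
        T \ H ⊆ S' ↔ S' = T \ H)), Finset.filter_eq', if_pos hA, Finset.sum_singleton,
      hHTe] at this
    rw [hHTe, this]
  let g : Finset α → ℤ := fun S => U (H ∪ S) + if S = T \ H then d' - d + r H else 0
  have key := eq_of_sum_superset_eq 𝓖 (f := mob 𝓖 (fun S => d' - ρ S)) (g := g) ?_ ∅ h0
  · rw [key]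
    simp only [g, if_neg hne, add_zero, Finset.union_empty, U]
  · intro S hS
    rw [sum_mob 𝓖 _ hS, Finset.sum_add_distrib, hsumU S hS, Finset.sum_ite_eq',
      if_pos (Finset.mem_filter.2 ⟨hA, h𝓖s S hS⟩)]
    have := hρ S (h𝓖s S hS)
    push_cast [← this]
    ring

/-- The Möbius function sum vanishes where the rank function is separated. -/
theorem mob_eq_zero_of_separated (hr : IsRankFn r) {G F A S : Finset α} {d : ℤ}
    (hFA : F ∪ A = G) (hd : Disjoint F A) (hF : IsRkCyclic r F) (hA : IsRkCyclic r A)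
    (hsep : r F + r A = r G) (hS : S ∈ cyclicFlats r G) (hSF : ¬ F ⊆ S) (hSA : ¬ A ⊆ S) :
    mob (cyclicFlats r G) (fun S => d - r S) S = 0 := by
  set 𝓕 := cyclicFlats r G with h𝓕
  have hadd : ∀ X ⊆ G, r X = r (X ∩ F) + r (X ∩ A) := fun X hX =>
    hr.rk_eq_add_of_separated hd (by rw [hsep, hFA]) (hFA ▸ hX)
  have hG : G ∈ 𝓕 := mem_cyclicFlats.2 ⟨subset_rfl, fun e h h' => absurd h h',
    hFA ▸ hr.isRkCyclic_union hF hA⟩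
  have hFG : F ⊆ G := hFA ▸ Finset.subset_union_left
  have hAG : A ⊆ G := hFA ▸ Finset.subset_union_right
  have hun : ∀ P ⊆ G, ∀ P' ⊆ G, P ∪ P' = G → IsRkCyclic r P →
      (∀ X ⊆ G, r X = r (X ∩ P) + r (X ∩ P')) → Disjoint P P' → ∀ S ∈ 𝓕, S ∪ P ∈ 𝓕 := by
    intro P hPG P' hP'G hPP hP hadd hd S hS
    obtain ⟨hSG, hSf, hSc⟩ := mem_cyclicFlats.1 hS
    refine mem_cyclicFlats.2 ⟨Finset.union_subset hSG hPG, ?_, hr.isRkCyclic_union hSc hP⟩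
    intro e heG he
    rw [Finset.mem_union, not_or] at he
    have heP' : e ∈ P' := by
      rw [← hPP, Finset.mem_union] at heG
      exact heG.resolve_left he.2
    have h1 := hSf e heG he.1
    rw [hadd _ hSG, hadd _ (Finset.insert_subset heG hSG), Finset.insert_inter_of_notMem he.2,
      Finset.insert_inter_of_mem heP'] at h1
    rw [hadd _ (Finset.union_subset hSG hPG),
      hadd _ (Finset.insert_subset heG (Finset.union_subset hSG hPG))]
    have e1 : (S ∪ P) ∩ P' = S ∩ P' := by
      rw [Finset.union_inter_distrib_right, Finset.disjoint_iff_inter_eq_empty.1 hd,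
        Finset.union_empty]
    rw [Finset.insert_inter_of_notMem he.2, Finset.insert_inter_of_mem heP', e1]
    omega
  have hadd' : ∀ X ⊆ G, r X = r (X ∩ A) + r (X ∩ F) := fun X hX => by rw [hadd X hX, add_comm]
  refine family_induction 𝓕 (P := fun S => ¬ F ⊆ S → ¬ A ⊆ S →
    mob 𝓕 (fun S => d - r S) S = 0) ?_ S hS hSF hSA
  intro S hS ih hSF hSA
  have hSG := (mem_cyclicFlats.1 hS).1
  have h1 := sum_mob 𝓕 (fun S => d - r S) hS
  have hSF' := hun F hFG A hAG hFA hF hadd hd S hS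
  have hSA' := hun A hAG F hFG (by rwa [Finset.union_comm]) hA hadd' hd.symm S hS
  have h2 := sum_mob 𝓕 (fun S => d - r S) hSF'
  have h3 := sum_mob 𝓕 (fun S => d - r S) hSA'
  have h4 := sum_mob 𝓕 (fun S => d - r S) hG
  set t := mob 𝓕 (fun S => d - r S)
  have hinc : ∑ F' ∈ 𝓕 with S ⊂ F', t F' = (∑ F' ∈ 𝓕 with S ∪ F ⊆ F', t F')
      + (∑ F' ∈ 𝓕 with S ∪ A ⊆ F', t F') - ∑ F' ∈ 𝓕 with G ⊆ F', t F' := by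
    simp only [Finset.sum_filter]
    rw [← Finset.sum_add_distrib, ← Finset.sum_sub_distrib]
    refine Finset.sum_congr rfl fun X hX => ?_
    have hGX : G ⊆ X ↔ F ⊆ X ∧ A ⊆ X := by rw [← hFA, Finset.union_subset_iff]
    by_cases hSX : S ⊂ X
    · have hSX' := hSX.1
      by_cases a : F ⊆ X <;> by_cases b : A ⊆ X <;>
        simp [hSX, hSX', a, b, hGX, Finset.union_subset_iff]
      exact ih X hX hSX a b
    · have hnot : S ⊆ X → S = X := fun h => by
        by_contra hne
        exact hSX (Finset.ssubset_iff_subset_ne.2 ⟨h, hne⟩)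
      have n1 : ¬ S ∪ F ⊆ X := fun h => by
        have := hnot (Finset.union_subset_left h)
        exact hSF (this ▸ Finset.union_subset_right h)
      have n2 : ¬ S ∪ A ⊆ X := fun h => by
        have := hnot (Finset.union_subset_left h)
        exact hSA (this ▸ Finset.union_subset_right h)
      have n3 : ¬ G ⊆ X := fun h => n1 (Finset.union_subset (hSG.trans h) (hFG.trans h))
      simp [hSX, n1, n2, n3]
  rw [sum_superset_eq 𝓕 t hS, hinc, h2, h3, h4] at h1
  have m1 := hadd S hSG
  have m2 := hadd _ (Finset.union_subset hSG hFG)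
  have m3 := hadd _ (Finset.union_subset hSG hAG)
  have e1 : (S ∪ F) ∩ A = S ∩ A := by
    rw [Finset.union_inter_distrib_right, Finset.disjoint_iff_inter_eq_empty.1 hd,
      Finset.union_empty]
  have e2 : (S ∪ A) ∩ F = S ∩ F := by
    rw [Finset.union_inter_distrib_right, Finset.disjoint_iff_inter_eq_empty.1 hd.symm,
      Finset.union_empty]
  rw [e1, Finset.inter_eq_right.2 Finset.subset_union_right] at m2
  rw [e2, Finset.inter_eq_right.2 Finset.subset_union_right] at m3
  push_cast [m2, m3, m1, ← hsep] at h1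
  linarith

/-- The Möbius function sum is nonnegative if the cyclic sets have as many neighbours as their
rank in some system of `d` sets. -/
theorem mob_nonneg_of_neighbours (hr : IsRankFn r) {G : Finset α} {ι : Type*} [Fintype ι]
    [DecidableEq ι] (N : Finset α → Finset ι) (hN : ∀ S T, N (S ∪ T) = N S ∪ N T)
    (hcard : ∀ C ⊆ G, IsRkCyclic r C → (N C).card = r C) {F : Finset α}
    (h0 : IsRkFlat r G ∅) (hF : F ∈ cyclicFlats r G) :
    0 ≤ mob (cyclicFlats r G) (fun S => (Fintype.card ι : ℤ) - r S) F := by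
  set 𝓕 := cyclicFlats r G with h𝓕
  have hNmono : ∀ S T, S ⊆ T → N S ⊆ N T := fun S T h => by
    rw [← Finset.union_eq_right.2 h, hN]
    exact Finset.subset_union_left
  have hdir : ∀ i, ∀ F₁ ∈ 𝓕, i ∉ N F₁ → ∀ F₂ ∈ 𝓕, i ∉ N F₂ →
      ∃ F₃ ∈ 𝓕, i ∉ N F₃ ∧ F₁ ⊆ F₃ ∧ F₂ ⊆ F₃ := by
    intro i F₁ h1 hi1 F₂ h2 hi2
    obtain ⟨g1, f1, c1⟩ := mem_cyclicFlats.1 h1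
    obtain ⟨g2, f2, c2⟩ := mem_cyclicFlats.1 h2
    have hc := hr.isRkCyclic_union c1 c2
    have hX : F₁ ∪ F₂ ⊆ G := Finset.union_subset g1 g2
    obtain ⟨Y, hY, hmax⟩ := Finset.exists_max_image
      (G.powerset.filter fun Y => F₁ ∪ F₂ ⊆ Y ∧ r Y = r (F₁ ∪ F₂)) Finset.card
      ⟨F₁ ∪ F₂, by simp [hX]⟩
    simp only [Finset.mem_filter, Finset.mem_powerset] at hY hmax
    obtain ⟨hYG, hXY, hYr⟩ := hY
    have hYc : IsRkCyclic r Y := by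
      intro e he
      by_cases heX : e ∈ F₁ ∪ F₂
      · exact (Finset.mem_filter.1 (hr.cyclic_subset_cyclicPart hc hXY heX)).2
      · have h1 := hr.mono (F₁ ∪ F₂) (Y.erase e) (Finset.subset_erase.2 ⟨hXY, heX⟩)
        have h2 := hr.mono _ _ (Finset.erase_subset e Y)
        omega
    have hYm : Y ∈ 𝓕 := by
      refine mem_cyclicFlats.2 ⟨hYG, fun e heG he => ?_, hYc⟩
      by_contra hlt
      have h1 := hr.mono Y (insert e Y) (Finset.subset_insert _ _)
      have := hmax (insert e Y) ⟨Finset.insert_subset heG hYG,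
        hXY.trans (Finset.subset_insert _ _), by omega⟩
      rw [Finset.card_insert_of_notMem he] at this
      omega
    refine ⟨Y, hYm, ?_, Finset.union_subset_left hXY, Finset.union_subset_right hXY⟩
    have he : N (F₁ ∪ F₂) = N Y := Finset.eq_of_subset_of_card_le (hNmono _ _ hXY)
      (by rw [hcard Y hYG hYc, hcard _ hX hc, hYr])
    rw [← he, hN, Finset.mem_union, not_or]
    exact ⟨hi1, hi2⟩
  have h0m : (∅ : Finset α) ∈ 𝓕 := mem_cyclicFlats.2 ⟨Finset.empty_subset _, h0,
    isRkCyclic_empty r⟩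
  have hN0 : N ∅ = ∅ := by
    rw [← Finset.card_eq_zero, hcard ∅ (Finset.empty_subset _) (isRkCyclic_empty r), hr.empty]
  have hgr : ∀ i, ∃ K ∈ 𝓕, i ∉ N K ∧ ∀ F ∈ 𝓕, i ∉ N F → F ⊆ K := by
    intro i
    obtain ⟨K, hK, hmax⟩ := Finset.exists_max_image (𝓕.filter fun F => i ∉ N F) Finset.card
      ⟨∅, by simp [h0m, hN0]⟩
    simp only [Finset.mem_filter] at hK hmax
    refine ⟨K, hK.1, hK.2, fun F hF hi => ?_⟩
    obtain ⟨F₃, h3, hi3, hK3, hF3⟩ := hdir i K hK.1 hK.2 F hF hi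
    rw [Finset.eq_of_subset_of_card_le hK3 (hmax F₃ ⟨h3, hi3⟩)]
    exact hF3
  choose κ hκ hκN hκmax using hgr
  have key := eq_of_sum_superset_eq 𝓕 (f := mob 𝓕 (fun S => (Fintype.card ι : ℤ) - r S))
    (g := fun K => ∑ i : ι with κ i = K, (1 : ℤ)) ?_ F hF
  · rw [key]
    exact Finset.sum_nonneg fun _ _ => zero_le_one
  · intro F hF
    obtain ⟨hFG, -, hFc⟩ := mem_cyclicFlats.1 hF
    rw [sum_mob 𝓕 _ hF]
    have h1 : ∑ F' ∈ 𝓕 with F ⊆ F', ∑ i : ι with κ i = F', (1 : ℤ)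
        = ∑ i : ι with i ∉ N F, 1 := by
      rw [← Finset.sum_fiberwise_of_maps_to (s := Finset.univ.filter (· ∉ N F))
        (t := 𝓕.filter (F ⊆ ·)) (g := κ)
        (fun i hi => Finset.mem_filter.2 ⟨hκ i, hκmax i F hF (Finset.mem_filter.1 hi).2⟩)]
      refine Finset.sum_congr rfl fun F' hF' => Finset.sum_congr ?_ fun _ _ => rfl
      ext i
      simp only [Finset.mem_filter, Finset.mem_univ, true_and]
      constructor
      · rintro rfl
        exact ⟨fun h => hκN i (hNmono _ _ (Finset.mem_filter.1 hF').2 h), rfl⟩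
      · exact fun h => h.2
    rw [h1, ← hcard F hFG hFc, Finset.sum_const, nsmul_eq_mul, mul_one]
    have h2 := Finset.card_compl (N F)
    have h3 : (Finset.univ.filter (· ∉ N F)) = (N F)ᶜ := by ext; simp
    rw [h3, h2, Nat.cast_sub (Finset.card_le_univ _)]

end IsRankFn

namespace BaseFamily

variable {α : Type*} [DecidableEq α]

set_option linter.unusedSectionVars false

/-- The rank of `S` with respect to a family of bases. -/
def rk (𝓑 : Finset (Finset α)) (S : Finset α) : ℕ := 𝓑.sup fun B => (B ∩ S).card

open Classical in
/-- The members of `𝓑` that minimize `f`. -/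
noncomputable def argmin (𝓑 : Finset (Finset α)) (f : Finset α → ℝ) : Finset (Finset α) :=
  𝓑.filter fun B => ∀ B' ∈ 𝓑, f B ≤ f B'

/-- The quantity `v B - ∑ i ∈ B, x i`. -/
def cost (v : Finset α → ℝ) (x : α → ℝ) (B : Finset α) : ℝ := v B - ∑ i ∈ B, x i

/-- The bases that meet `F` in a set of maximal size. -/
def face (𝓑 : Finset (Finset α)) (F : Finset α) : Finset (Finset α) :=
  𝓑.filter fun B => (B ∩ F).card = rk 𝓑 F

/-- Addition of `s` to the coordinates in `F`. -/
def shift (x : α → ℝ) (F : Finset α) (s : ℝ) : α → ℝ := fun e => x e + if e ∈ F then s else 0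

/-- No element of `S` is a loop or a coloop of the family `𝓒`. -/
def Good (𝓒 : Finset (Finset α)) (S : Finset α) : Prop :=
  ∀ e ∈ S, (∃ B ∈ 𝓒, e ∈ B) ∧ ∃ B ∈ 𝓒, e ∉ B

/-- `𝓑` is the family of bases of a valuated matroid with values `v`, all of whose elements
outside `G` are loops or coloops. -/
structure IsValuated (𝓑 : Finset (Finset α)) (v : Finset α → ℝ) (G : Finset α) : Prop where
  nonempty : 𝓑.Nonempty
  card_eq : ∀ X ∈ 𝓑, ∀ Y ∈ 𝓑, X.card = Y.card
  rest : ∀ X ∈ 𝓑, ∀ Y ∈ 𝓑, X \ G = Y \ G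
  exchange : ∀ X ∈ 𝓑, ∀ Y ∈ 𝓑, ∀ a ∈ X \ Y, ∃ b ∈ Y \ X, insert b (X.erase a) ∈ 𝓑 ∧
    insert a (Y.erase b) ∈ 𝓑 ∧ v (insert b (X.erase a)) + v (insert a (Y.erase b)) ≤ v X + v Y

theorem mem_argmin {𝓑 : Finset (Finset α)} {f : Finset α → ℝ} {B : Finset α} :
    B ∈ argmin 𝓑 f ↔ B ∈ 𝓑 ∧ ∀ B' ∈ 𝓑, f B ≤ f B' := by
  simp [argmin]

theorem mem_face {𝓑 : Finset (Finset α)} {F B : Finset α} :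
    B ∈ face 𝓑 F ↔ B ∈ 𝓑 ∧ (B ∩ F).card = rk 𝓑 F := by
  simp [face]

theorem argmin_subset (𝓑 : Finset (Finset α)) (f : Finset α → ℝ) : argmin 𝓑 f ⊆ 𝓑 :=
  Finset.filter_subset _ _

theorem face_subset (𝓑 : Finset (Finset α)) (F : Finset α) : face 𝓑 F ⊆ 𝓑 :=
  Finset.filter_subset _ _

theorem argmin_nonempty {𝓑 : Finset (Finset α)} (h : 𝓑.Nonempty) (f : Finset α → ℝ) :
    (argmin 𝓑 f).Nonempty := by
  obtain ⟨B, hB, hmin⟩ := 𝓑.exists_min_image f h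
  exact ⟨B, mem_argmin.2 ⟨hB, hmin⟩⟩

theorem card_le_rk {𝓑 : Finset (Finset α)} {B : Finset α} (hB : B ∈ 𝓑) (S : Finset α) :
    (B ∩ S).card ≤ rk 𝓑 S :=
  Finset.le_sup (f := fun B => (B ∩ S).card) hB

theorem exists_card_eq_rk {𝓑 : Finset (Finset α)} (h : 𝓑.Nonempty) (S : Finset α) :
    ∃ B ∈ 𝓑, (B ∩ S).card = rk 𝓑 S := by
  obtain ⟨B, hB, he⟩ := Finset.exists_mem_eq_sup 𝓑 h (fun B => (B ∩ S).card)
  exact ⟨B, hB, he.symm⟩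

theorem rk_le {𝓑 : Finset (Finset α)} {S : Finset α} {n : ℕ}
    (h : ∀ B ∈ 𝓑, (B ∩ S).card ≤ n) : rk 𝓑 S ≤ n := Finset.sup_le h

theorem rk_mono_family {𝓑 𝓒 : Finset (Finset α)} (h : 𝓑 ⊆ 𝓒) (S : Finset α) :
    rk 𝓑 S ≤ rk 𝓒 S := rk_le fun _ hB => card_le_rk (h hB) S

theorem face_nonempty {𝓑 : Finset (Finset α)} (h : 𝓑.Nonempty) (F : Finset α) :
    (face 𝓑 F).Nonempty := by
  obtain ⟨B, hB, he⟩ := exists_card_eq_rk h F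
  exact ⟨B, mem_face.2 ⟨hB, he⟩⟩

theorem rk_eq_of_const {𝓑 : Finset (Finset α)} (h : 𝓑.Nonempty) {S : Finset α} {n : ℕ}
    (hn : ∀ B ∈ 𝓑, (B ∩ S).card = n) : rk 𝓑 S = n := by
  obtain ⟨B, hB, he⟩ := exists_card_eq_rk h S
  rw [← he, hn B hB]

theorem rk_face_self {𝓑 : Finset (Finset α)} (h : 𝓑.Nonempty) (F : Finset α) :
    rk (face 𝓑 F) F = rk 𝓑 F :=
  rk_eq_of_const (face_nonempty h F) fun _ hB => (mem_face.1 hB).2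

theorem face_face {𝓑 : Finset (Finset α)} (h : 𝓑.Nonempty) (F : Finset α) :
    face (face 𝓑 F) F = face 𝓑 F := by
  ext B
  rw [mem_face, rk_face_self h, mem_face]
  tauto

theorem Good.mono {𝓑 𝓒 : Finset (Finset α)} {S T : Finset α} (h : Good 𝓑 S) (h𝓑 : 𝓑 ⊆ 𝓒)
    (hT : T ⊆ S) : Good 𝓒 T := fun e he =>
  let ⟨⟨B, hB, h1⟩, ⟨B', hB', h2⟩⟩ := h e (hT he)
  ⟨⟨B, h𝓑 hB, h1⟩, ⟨B', h𝓑 hB', h2⟩⟩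

theorem card_inter_eq_sum (X S : Finset α) :
    (X ∩ S).card = ∑ i ∈ X, if i ∈ S then 1 else 0 := by
  rw [← Finset.card_filter, Finset.filter_mem_eq_inter]

theorem sum_exchange {M : Type*} [AddCommMonoid M] {X : Finset α} {a b : α} (ha : a ∈ X)
    (hb : b ∉ X) (f : α → M) :
    ∑ i ∈ insert b (X.erase a), f i + f a = ∑ i ∈ X, f i + f b := by
  rw [Finset.sum_insert (fun h => hb (Finset.mem_of_mem_erase h)), add_assoc,
    Finset.sum_erase_add _ _ ha, add_comm]

theorem card_inter_exchange {X : Finset α} {a b : α} (ha : a ∈ X) (hb : b ∉ X) (S : Finset α) :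
    (insert b (X.erase a) ∩ S).card + (if a ∈ S then 1 else 0)
      = (X ∩ S).card + if b ∈ S then 1 else 0 := by
  rw [card_inter_eq_sum, card_inter_eq_sum]
  exact sum_exchange ha hb _

theorem card_sdiff_exchange_lt {X Y : Finset α} {a b : α} (ha : a ∉ Y) (hbY : b ∈ Y)
    (hbX : b ∉ X) : (Y \ insert b (X.erase a)).card < (Y \ X).card := by
  apply Finset.card_lt_card
  refine (Finset.ssubset_iff_of_subset ?_).2 ⟨b, by simp [hbY, hbX], by simp⟩
  intro y hy
  have : y ≠ a := fun h => ha (h ▸ (Finset.mem_sdiff.1 hy).1)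
  simp at hy ⊢
  tauto

theorem cost_exchange {v : Finset α → ℝ} {X : Finset α} {a b : α} (ha : a ∈ X) (hb : b ∉ X)
    (x : α → ℝ) : cost v x (insert b (X.erase a))
      = v (insert b (X.erase a)) - v X + cost v x X + x a - x b := by
  have := sum_exchange ha hb x
  unfold cost
  linarith

theorem cost_shift (v : Finset α → ℝ) (x : α → ℝ) (F : Finset α) (s : ℝ) (B : Finset α) :
    cost v (shift x F s) B = cost v x B - s * (B ∩ F).card := by
  unfold cost shift
  rw [Finset.sum_add_distrib, card_inter_eq_sum]
  push_cast
  rw [Finset.mul_sum]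
  have : ∀ i, (if i ∈ F then s else 0) = s * if i ∈ F then (1 : ℝ) else 0 := by
    intro i; split <;> simp
  simp only [this]
  ring

/-- Moving a little in a direction `F` selects the bases that meet `F` in a maximal set. -/
theorem argmin_shift {𝓑 : Finset (Finset α)} {v : Finset α → ℝ} {x : α → ℝ} {F : Finset α}
    {s : ℝ} (hne : 𝓑.Nonempty) (hs : 0 < s)
    (h : ∀ B₀ ∈ argmin 𝓑 (cost v x), ∀ B ∈ 𝓑, rk (argmin 𝓑 (cost v x)) F < (B ∩ F).card →
      cost v x B₀ - s * rk (argmin 𝓑 (cost v x)) F < cost v x B - s * (B ∩ F).card) :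
    argmin 𝓑 (cost v (shift x F s)) = face (argmin 𝓑 (cost v x)) F := by
  set 𝓒 := argmin 𝓑 (cost v x) with h𝓒
  obtain ⟨B₀, hB₀⟩ := face_nonempty (argmin_nonempty hne (cost v x)) F
  obtain ⟨hB₀m, hB₀k⟩ := mem_face.1 hB₀
  obtain ⟨hB₀𝓑, hB₀min⟩ := mem_argmin.1 hB₀m
  have hle : ∀ B ∈ 𝓑, cost v (shift x F s) B₀ ≤ cost v (shift x F s) B ∧
      (cost v (shift x F s) B ≤ cost v (shift x F s) B₀ → B ∈ face 𝓒 F) := by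
    intro B hB
    rw [cost_shift, cost_shift, hB₀k]
    have hmin := hB₀min B hB
    rcases lt_trichotomy (rk 𝓒 F) (B ∩ F).card with hlt | heq | hgt
    · have := h B₀ hB₀m B hB hlt
      exact ⟨this.le, fun h' => absurd h' (not_le.2 this)⟩
    · rw [← heq]
      refine ⟨by linarith, fun h' => mem_face.2 ⟨mem_argmin.2 ⟨hB, fun B' hB' => ?_⟩, heq.symm⟩⟩
      have := hB₀min B' hB'
      linarith
    · have : ((B ∩ F).card : ℝ) < rk 𝓒 F := by exact_mod_cast hgt
      have := mul_lt_mul_of_pos_left this hs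
      exact ⟨by linarith, fun h' => by linarith⟩
  ext B
  rw [mem_argmin]
  constructor
  · rintro ⟨hB, hmin⟩
    exact (hle B hB).2 (hmin B₀ hB₀𝓑)
  · intro hB
    obtain ⟨hBm, hBk⟩ := mem_face.1 hB
    obtain ⟨hB𝓑, hBmin⟩ := mem_argmin.1 hBm
    refine ⟨hB𝓑, fun B' hB' => le_trans ?_ (hle B' hB').1⟩
    rw [cost_shift, cost_shift, hB₀k, hBk]
    have := hBmin B₀ hB₀𝓑
    linarith

/-- In a direction `F` either all bases that are met have minimal cost already, or there is a
first point at which further bases become minimal. -/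
theorem exists_first_change {𝓑 : Finset (Finset α)} (hne : 𝓑.Nonempty) (v : Finset α → ℝ)
    (x : α → ℝ) (F : Finset α) (h : rk (argmin 𝓑 (cost v x)) F < rk 𝓑 F) :
    ∃ t > 0, (∀ s, 0 < s → s < t →
        argmin 𝓑 (cost v (shift x F s)) = face (argmin 𝓑 (cost v x)) F) ∧
      face (argmin 𝓑 (cost v x)) F ⊆ argmin 𝓑 (cost v (shift x F t)) ∧
      (∀ B ∈ argmin 𝓑 (cost v (shift x F t)), rk (argmin 𝓑 (cost v x)) F ≤ (B ∩ F).card ∧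
        ((B ∩ F).card = rk (argmin 𝓑 (cost v x)) F → B ∈ argmin 𝓑 (cost v x))) ∧
      ∃ B ∈ argmin 𝓑 (cost v (shift x F t)), rk (argmin 𝓑 (cost v x)) F < (B ∩ F).card := by
  set 𝓒 := argmin 𝓑 (cost v x) with h𝓒
  set k := rk 𝓒 F with hk
  obtain ⟨B₀, hB₀⟩ := face_nonempty (argmin_nonempty hne (cost v x)) F
  obtain ⟨hB₀m, hB₀k⟩ := mem_face.1 hB₀
  obtain ⟨hB₀𝓑, hB₀min⟩ := mem_argmin.1 hB₀m
  set m := cost v x B₀ with hm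
  let g : Finset α → ℝ := fun B => (cost v x B - m) / ((B ∩ F).card - k)
  obtain ⟨B₁', hB₁', hB₁k'⟩ := exists_card_eq_rk hne F
  obtain ⟨B₁, hB₁, hmin⟩ := Finset.exists_min_image (𝓑.filter fun B => k < (B ∩ F).card) g
    ⟨B₁', by simp [hB₁', hB₁k', h]⟩
  simp only [Finset.mem_filter] at hB₁ hmin
  have hcost : ∀ B ∈ 𝓑, k < (B ∩ F).card → g B * ((B ∩ F).card - k) = cost v x B - m := by
    intro B hB hlt
    have : ((k : ℕ) : ℝ) < (B ∩ F).card := by exact_mod_cast hlt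
    exact div_mul_cancel₀ _ (by linarith)
  have ht : 0 < g B₁ := by
    have h1 : ((k : ℕ) : ℝ) < (B₁ ∩ F).card := by exact_mod_cast hB₁.2
    refine div_pos ?_ (by linarith)
    have h2 := hB₀min B₁ hB₁.1
    rcases h2.lt_or_eq with h2 | h2
    · linarith
    · have : B₁ ∈ 𝓒 := mem_argmin.2 ⟨hB₁.1, fun B' hB' => h2 ▸ hB₀min B' hB'⟩
      exact absurd (card_le_rk this F) (not_le.2 hB₁.2)
  have hB₀eq : ∀ B ∈ 𝓒, cost v x B = m := fun B hB =>
    le_antisymm ((mem_argmin.1 hB).2 B₀ hB₀𝓑) (hB₀min B (mem_argmin.1 hB).1)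
  set t := g B₁ with htdef
  have hlow : ∀ B ∈ 𝓑, m - t * k ≤ cost v (shift x F t) B ∧
      (cost v (shift x F t) B ≤ m - t * k → k ≤ (B ∩ F).card ∧
        ((B ∩ F).card = k → B ∈ 𝓒)) := by
    intro B hB
    rw [cost_shift]
    have hBmin := hB₀min B hB
    rcases lt_trichotomy k (B ∩ F).card with hlt | heq | hgt
    · have h1 : (k : ℝ) < (B ∩ F).card := by exact_mod_cast hlt
      have h2 := mul_le_mul_of_nonneg_right (hmin B ⟨hB, hlt⟩) (sub_nonneg.2 h1.le)
      rw [hcost B hB hlt] at h2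
      exact ⟨by linarith, fun _ => ⟨hlt.le, fun h => absurd h hlt.ne'⟩⟩
    · rw [← heq]
      refine ⟨by linarith, fun h' => ⟨le_rfl, fun _ => mem_argmin.2 ⟨hB, fun B' hB' => ?_⟩⟩⟩
      have := hB₀min B' hB'
      linarith
    · have : ((B ∩ F).card : ℝ) < k := by exact_mod_cast hgt
      have := mul_lt_mul_of_pos_left this ht
      exact ⟨by linarith, fun h' => by linarith⟩
  have hmem : ∀ B ∈ 𝓑, cost v (shift x F t) B = m - t * k →
      B ∈ argmin 𝓑 (cost v (shift x F t)) := fun B hB he =>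
    mem_argmin.2 ⟨hB, fun B' hB' => he ▸ (hlow B' hB').1⟩
  have hfm : ∀ B ∈ face 𝓒 F, B ∈ argmin 𝓑 (cost v (shift x F t)) := by
    intro B hB
    obtain ⟨h1, h2⟩ := mem_face.1 hB
    exact hmem B (mem_argmin.1 h1).1 (by rw [cost_shift, hB₀eq B h1, h2])
  refine ⟨t, ht, fun s hs hst => argmin_shift hne hs fun B hB B' hB' hlt => ?_, hfm,
    fun B hB => ?_, B₁, hmem B₁ hB₁.1 ?_, hB₁.2⟩
  · have h1 : (k : ℝ) < (B' ∩ F).card := by exact_mod_cast hlt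
    have h2 := mul_le_mul_of_nonneg_right (hmin B' ⟨hB', hlt⟩) (sub_nonneg.2 h1.le)
    rw [hcost B' hB' hlt] at h2
    have h3 := mul_lt_mul_of_pos_right hst (sub_pos.2 h1)
    rw [hB₀eq B hB]
    linarith
  · obtain ⟨hB𝓑, hBmin⟩ := mem_argmin.1 hB
    refine (hlow B hB𝓑).2 ((hBmin B₀ hB₀𝓑).trans ?_)
    rw [cost_shift, hB₀k]
  · rw [cost_shift]
    have := hcost B₁ hB₁.1 hB₁.2
    rw [← htdef] at this
    linarith

namespace IsValuated

variable {𝓑 : Finset (Finset α)} {v : Finset α → ℝ} {G : Finset α}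

theorem mem_of_mem_sdiff (h : IsValuated 𝓑 v G) {X Y : Finset α} (hX : X ∈ 𝓑) (hY : Y ∈ 𝓑)
    {b : α} (hb : b ∈ X \ Y) : b ∈ G := by
  by_contra hG
  obtain ⟨h1, h2⟩ := Finset.mem_sdiff.1 hb
  have : b ∈ X \ G := Finset.mem_sdiff.2 ⟨h1, hG⟩
  rw [h.rest X hX Y hY] at this
  exact h2 (Finset.mem_sdiff.1 this).1

theorem card_inter_eq (h : IsValuated 𝓑 v G) {X Y : Finset α} (hX : X ∈ 𝓑) (hY : Y ∈ 𝓑) :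
    (X ∩ G).card = (Y ∩ G).card := by
  have h1 := Finset.card_sdiff_add_card_inter X G
  have h2 := Finset.card_sdiff_add_card_inter Y G
  have h3 := h.card_eq X hX Y hY
  rw [h.rest X hX Y hY] at h1
  omega

theorem card_inter_ground (h : IsValuated 𝓑 v G) {X : Finset α} (hX : X ∈ 𝓑) :
    (X ∩ G).card = rk 𝓑 G :=
  (rk_eq_of_const h.nonempty fun _ hB => h.card_inter_eq hB hX).symm

theorem argmin (h : IsValuated 𝓑 v G) (x : α → ℝ) :
    IsValuated (argmin 𝓑 (cost v x)) v G where
  nonempty := argmin_nonempty h.nonempty _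
  card_eq X hX Y hY := h.card_eq X (argmin_subset _ _ hX) Y (argmin_subset _ _ hY)
  rest X hX Y hY := h.rest X (argmin_subset _ _ hX) Y (argmin_subset _ _ hY)
  exchange X hX Y hY a ha := by
    obtain ⟨hX𝓑, hXm⟩ := mem_argmin.1 hX
    obtain ⟨hY𝓑, hYm⟩ := mem_argmin.1 hY
    obtain ⟨b, hb, h1, h2, h3⟩ := h.exchange X hX𝓑 Y hY𝓑 a ha
    obtain ⟨haX, haY⟩ := Finset.mem_sdiff.1 ha
    obtain ⟨hbY, hbX⟩ := Finset.mem_sdiff.1 hb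
    have c1 := cost_exchange (v := v) haX hbX x
    have c2 := cost_exchange (v := v) hbY haY x
    have m1 := hXm _ h1
    have m2 := hYm _ h2
    refine ⟨b, hb, mem_argmin.2 ⟨h1, fun B hB => ?_⟩, mem_argmin.2 ⟨h2, fun B hB => ?_⟩, h3⟩
    · have := hXm B hB
      linarith
    · have := hYm B hB
      linarith

theorem face (h : IsValuated 𝓑 v G) (F : Finset α) : IsValuated (face 𝓑 F) v G where
  nonempty := face_nonempty h.nonempty _
  card_eq X hX Y hY := h.card_eq X (face_subset _ _ hX) Y (face_subset _ _ hY)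
  rest X hX Y hY := h.rest X (face_subset _ _ hX) Y (face_subset _ _ hY)
  exchange X hX Y hY a ha := by
    obtain ⟨hX𝓑, hXm⟩ := mem_face.1 hX
    obtain ⟨hY𝓑, hYm⟩ := mem_face.1 hY
    obtain ⟨b, hb, h1, h2, h3⟩ := h.exchange X hX𝓑 Y hY𝓑 a ha
    obtain ⟨haX, haY⟩ := Finset.mem_sdiff.1 ha
    obtain ⟨hbY, hbX⟩ := Finset.mem_sdiff.1 hb
    have c1 := card_inter_exchange haX hbX F
    have c2 := card_inter_exchange hbY haY F
    have m1 := card_le_rk h1 F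
    have m2 := card_le_rk h2 F
    exact ⟨b, hb, mem_face.2 ⟨h1, by omega⟩, mem_face.2 ⟨h2, by omega⟩, h3⟩

/-- There is a base that meets both members of a chain in sets of maximal size. -/
theorem exists_card_eq_rk_pair (h : IsValuated 𝓑 v G) {S T : Finset α} (hST : S ⊆ T) :
    ∃ B ∈ 𝓑, (B ∩ S).card = rk 𝓑 S ∧ (B ∩ T).card = rk 𝓑 T := by
  obtain ⟨B₀, hB₀, hB₀T⟩ := exists_card_eq_rk h.nonempty T
  obtain ⟨B, hB, hmin⟩ := Finset.exists_min_image (BaseFamily.face 𝓑 S)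
    (fun B => (B₀ \ B).card) (face_nonempty h.nonempty S)
  obtain ⟨hB𝓑, hBS⟩ := mem_face.1 hB
  refine ⟨B, hB𝓑, hBS, le_antisymm (card_le_rk hB𝓑 T) ?_⟩
  by_contra hlt
  rw [not_le, ← hB₀T] at hlt
  have hc := h.card_eq B hB𝓑 B₀ hB₀
  have e1 := Finset.card_sdiff_add_card_inter B T
  have e2 := Finset.card_sdiff_add_card_inter B₀ T
  have : ¬ B \ T ⊆ B₀ \ T := fun hs => by
    have := Finset.card_le_card hs
    omega
  obtain ⟨a, ha, ha'⟩ := Finset.not_subset.1 this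
  obtain ⟨haB, haT⟩ := Finset.mem_sdiff.1 ha
  have haB₀ : a ∉ B₀ := fun h' => ha' (Finset.mem_sdiff.2 ⟨h', haT⟩)
  obtain ⟨b, hb, h1, -⟩ := h.exchange B hB𝓑 B₀ hB₀ a (Finset.mem_sdiff.2 ⟨haB, haB₀⟩)
  obtain ⟨hbB₀, hbB⟩ := Finset.mem_sdiff.1 hb
  have c1 := card_inter_exchange haB hbB S
  have m1 := card_le_rk h1 S
  rw [if_neg fun h' => haT (hST h')] at c1
  have := hmin _ (mem_face.2 ⟨h1, by omega⟩)
  exact absurd (card_sdiff_exchange_lt haB₀ hbB₀ hbB) (not_lt.2 this)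

theorem isRankFn (h : IsValuated 𝓑 v G) : IsRankFn (rk 𝓑) where
  mono S T hST := rk_le fun B hB =>
    (Finset.card_le_card (Finset.inter_subset_inter_left hST)).trans (card_le_rk hB T)
  submod S T := by
    obtain ⟨B, hB, h1, h2⟩ := h.exists_card_eq_rk_pair
      (Finset.inter_subset_union (s := S) (t := T))
    have h3 := Finset.card_union_add_card_inter (B ∩ S) (B ∩ T)
    rw [← Finset.inter_union_distrib_left, ← Finset.inter_inter_distrib_left] at h3
    have h4 := card_le_rk hB S
    have h5 := card_le_rk hB T
    omega
  le_card S := rk_le fun B _ => Finset.card_le_card Finset.inter_subset_right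

/-- Exchange between initial bases at two points. -/
theorem exchange_cost (h : IsValuated 𝓑 v G) {F B X : Finset α} {x u : α → ℝ} {e : α}
    (hB : B ∈ BaseFamily.argmin 𝓑 (cost v x))
    (hX : X ∈ BaseFamily.argmin (BaseFamily.face 𝓑 F) (cost v u)) (he : e ∈ X \ B)
    (heF : e ∉ F) : ∃ b ∈ B \ X, b ∉ F ∧ x e - u e ≤ x b - u b ∧
      (x b - u b ≤ x e - u e → insert e (B.erase b) ∈ BaseFamily.argmin 𝓑 (cost v x)) := by
  obtain ⟨hB𝓑, hBm⟩ := mem_argmin.1 hB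
  obtain ⟨hXf, hXm⟩ := mem_argmin.1 hX
  obtain ⟨hX𝓑, hXk⟩ := mem_face.1 hXf
  obtain ⟨b, hb, h1, h2, h3⟩ := h.exchange X hX𝓑 B hB𝓑 e he
  obtain ⟨heX, heB⟩ := Finset.mem_sdiff.1 he
  obtain ⟨hbB, hbX⟩ := Finset.mem_sdiff.1 hb
  have c1 := card_inter_exchange heX hbX F
  have m1 := card_le_rk h1 F
  rw [if_neg heF] at c1
  have hbF : b ∉ F := fun hbF => by
    rw [if_pos hbF] at c1
    omega
  rw [if_neg hbF] at c1
  have d1 := cost_exchange (v := v) heX hbX u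
  have d2 := cost_exchange (v := v) hbB heB x
  have n1 := hXm _ (mem_face.2 ⟨h1, by omega⟩)
  have n2 := hBm _ h2
  refine ⟨b, hb, hbF, by linarith, fun hle => mem_argmin.2 ⟨h2, fun B' hB' => ?_⟩⟩
  have := hBm B' hB'
  linarith

theorem exchange_face (h : IsValuated 𝓑 v G) {F X Y : Finset α} (hX : X ∈ BaseFamily.face 𝓑 F)
    (hY : Y ∈ BaseFamily.face 𝓑 F) {a : α} (ha : a ∈ X \ Y) (haF : a ∈ F) :
    ∃ b ∈ Y \ X, b ∈ F ∧ insert b (X.erase a) ∈ BaseFamily.face 𝓑 F ∧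
      insert a (Y.erase b) ∈ BaseFamily.face 𝓑 F ∧
      v (insert b (X.erase a)) + v (insert a (Y.erase b)) ≤ v X + v Y := by
  obtain ⟨b, hb, h1, h2, h3⟩ := (h.face F).exchange X hX Y hY a ha
  refine ⟨b, hb, ?_, h1, h2, h3⟩
  by_contra hbF
  have c1 := card_inter_exchange (Finset.mem_sdiff.1 ha).1 (Finset.mem_sdiff.1 hb).2 F
  rw [if_pos haF, if_neg hbF, (mem_face.1 h1).2, (mem_face.1 hX).2] at c1
  omega

theorem eq_of_card_sdiff_inter {F X Y : Finset α} (hX : X ∈ BaseFamily.face 𝓑 F)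
    (hY : Y ∈ BaseFamily.face 𝓑 F) (hn : ((X \ Y) ∩ F).card = 0) : X ∩ F = Y ∩ F := by
  refine Finset.eq_of_subset_of_card_le (fun e he => ?_)
    (by rw [(mem_face.1 hX).2, (mem_face.1 hY).2])
  obtain ⟨heX, heF⟩ := Finset.mem_inter.1 he
  refine Finset.mem_inter.2 ⟨?_, heF⟩
  by_contra heY
  have : e ∈ (X \ Y) ∩ F := by simp [heX, heF, heY]
  rw [Finset.card_eq_zero.1 hn] at this
  simp at this

theorem card_sdiff_inter_exchange {F X Y : Finset α} {a b : α} (ha : a ∈ (X \ Y) ∩ F)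
    (hb : b ∈ Y \ X) :
    ((insert b (X.erase a) \ Y) ∩ F).card + 1 = ((X \ Y) ∩ F).card := by
  have hbY := (Finset.mem_sdiff.1 hb).1
  have : ((insert b (X.erase a) \ Y) ∩ F) = ((X \ Y) ∩ F).erase a := by
    ext x
    by_cases hxb : x = b
    · subst hxb; simp [hbY]
    · simp [hxb]; tauto
  rw [this, Finset.card_erase_add_one ha]

theorem swap_mem (h : IsValuated 𝓑 v G) {F : Finset α} (n : ℕ) :
    ∀ X ∈ BaseFamily.face 𝓑 F, ∀ Y ∈ BaseFamily.face 𝓑 F, ((X \ Y) ∩ F).card = n →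
      (X \ F) ∪ (Y ∩ F) ∈ BaseFamily.face 𝓑 F := by
  induction n with
  | zero =>
    intro X hX Y hY hn
    rwa [← eq_of_card_sdiff_inter hX hY hn, Finset.sdiff_union_inter]
  | succ n ih =>
    intro X hX Y hY hn
    obtain ⟨a, ha⟩ := Finset.card_pos.1 (by omega : 0 < ((X \ Y) ∩ F).card)
    obtain ⟨haXY, haF⟩ := Finset.mem_inter.1 ha
    obtain ⟨b, hb, hbF, h1, -, -⟩ := h.exchange_face hX hY haXY haF
    have := ih _ h1 Y hY (by have := card_sdiff_inter_exchange ha hb; omega)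
    rwa [Finset.insert_sdiff_of_mem _ hbF, Finset.erase_sdiff_comm,
      Finset.erase_eq_of_notMem (by simp [haF])] at this

/-- Two bases that meet `F` maximally may swap their intersections with `F`. -/
theorem swap (h : IsValuated 𝓑 v G) {F : Finset α} (n : ℕ) :
    ∀ X ∈ BaseFamily.face 𝓑 F, ∀ Y ∈ BaseFamily.face 𝓑 F, ((X \ Y) ∩ F).card = n →
      v ((X \ F) ∪ (Y ∩ F)) + v ((Y \ F) ∪ (X ∩ F)) ≤ v X + v Y := by
  induction n with
  | zero =>
    intro X hX Y hY hn
    have heq := eq_of_card_sdiff_inter hX hY hn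
    rw [← heq, Finset.sdiff_union_inter, heq, Finset.sdiff_union_inter]
  | succ n ih =>
    intro X hX Y hY hn
    obtain ⟨a, ha⟩ := Finset.card_pos.1 (by omega : 0 < ((X \ Y) ∩ F).card)
    obtain ⟨haXY, haF⟩ := Finset.mem_inter.1 ha
    obtain ⟨haX, haY⟩ := Finset.mem_sdiff.1 haXY
    obtain ⟨b, hb, hbF, h1, -, -⟩ := h.exchange_face hX hY haXY haF
    obtain ⟨hbY, hbX⟩ := Finset.mem_sdiff.1 hb
    have hab : a ≠ b := fun h => haY (h ▸ hbY)
    have i1 := ih _ h1 Y hY (by have := card_sdiff_inter_exchange ha hb; omega)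
    rw [Finset.insert_sdiff_of_mem _ hbF, Finset.erase_sdiff_comm,
      Finset.erase_eq_of_notMem (by simp [haF] : a ∉ X \ F)] at i1
    set Z := (Y \ F) ∪ (insert b (X.erase a) ∩ F) with hZ
    have hZm : Z ∈ BaseFamily.face 𝓑 F := h.swap_mem _ Y hY _ h1 rfl
    have haZ : a ∈ X \ Z := by simp [hZ, haX, haF, hab]
    obtain ⟨c, hc, hcF, -, -, h3⟩ := h.exchange_face hX hZm haZ haF
    have hcb : c = b := by
      simp only [hZ, Finset.mem_sdiff, Finset.mem_union, Finset.mem_inter, Finset.mem_insert,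
        Finset.mem_erase] at hc
      tauto
    subst hcb
    have e1 : insert a (Z.erase c) = (Y \ F) ∪ (X ∩ F) := by
      ext y
      by_cases hya : y = a
      · subst hya; simp [haX, haF]
      · by_cases hyc : y = c
        · subst hyc; simp [hya, hbX, hbF]
        · simp [hZ, hya, hyc]
    rw [e1] at h3
    linarith

/-- The part outside `F` of the initial bases of the face of `F` depends only on the coordinates
outside `F`, up to a constant. -/
theorem exists_argmin_face_of_eq (h : IsValuated 𝓑 v G) {F B : Finset α} {x u : α → ℝ} {c : ℝ}
    (hu : ∀ e ∈ G, e ∉ F → u e = x e + c)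
    (hB : B ∈ BaseFamily.argmin (BaseFamily.face 𝓑 F) (cost v x)) :
    ∃ B' ∈ BaseFamily.argmin (BaseFamily.face 𝓑 F) (cost v u), B' \ F = B \ F := by
  obtain ⟨X, hX⟩ := ((h.face F).argmin u).nonempty
  obtain ⟨hBf, hBm⟩ := mem_argmin.1 hB
  obtain ⟨hXf, hXm⟩ := mem_argmin.1 hX
  have s1 := h.swap_mem _ X hXf B hBf rfl
  have s2 := h.swap_mem _ B hBf X hXf rfl
  have s3 := h.swap _ X hXf B hBf rfl
  have hd1 : Disjoint (X \ F) (B ∩ F) :=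
    Finset.disjoint_of_subset_right Finset.inter_subset_right Finset.sdiff_disjoint
  have hd2 : Disjoint (B \ F) (X ∩ F) :=
    Finset.disjoint_of_subset_right Finset.inter_subset_right Finset.sdiff_disjoint
  have hsp : ∀ (f : α → ℝ) (Y : Finset α), ∑ i ∈ Y, f i = ∑ i ∈ Y \ F, f i + ∑ i ∈ Y ∩ F, f i :=
    fun f Y => by
      rw [← Finset.sum_union (Finset.disjoint_of_subset_right Finset.inter_subset_right
        Finset.sdiff_disjoint), Finset.sdiff_union_inter]
  have hG : ∀ (f : α → ℝ) (Y : Finset α), ∑ i ∈ Y \ F, f i =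
      ∑ i ∈ (Y \ F) \ G, f i + ∑ i ∈ (Y \ F) ∩ G, f i := fun f Y => by
    rw [← Finset.sum_union (Finset.disjoint_of_subset_right Finset.inter_subset_right
      Finset.sdiff_disjoint), Finset.sdiff_union_inter]
  have hrest : (X \ F) \ G = (B \ F) \ G := by
    have := h.rest X (mem_face.1 hXf).1 B (mem_face.1 hBf).1
    rw [sdiff_right_comm, this, sdiff_right_comm]
  have hcard : ((X \ F) ∩ G).card = ((B \ F) ∩ G).card := by
    have c1 := Finset.card_sdiff_add_card_inter X F
    have c2 := Finset.card_sdiff_add_card_inter B F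
    have c3 := h.card_eq X (mem_face.1 hXf).1 B (mem_face.1 hBf).1
    have c4 := (mem_face.1 hXf).2
    have c5 := (mem_face.1 hBf).2
    have c6 := Finset.card_sdiff_add_card_inter (X \ F) G
    have c7 := Finset.card_sdiff_add_card_inter (B \ F) G
    rw [hrest] at c6
    omega
  have hux : ∀ Y : Finset α, ∑ i ∈ (Y \ F) ∩ G, u i
      = ∑ i ∈ (Y \ F) ∩ G, x i + ((Y \ F) ∩ G).card * c := fun Y => by
    rw [Finset.sum_congr rfl fun i hi => hu i (Finset.mem_inter.1 hi).2
      (Finset.mem_sdiff.1 (Finset.mem_inter.1 hi).1).2, Finset.sum_add_distrib,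
      Finset.sum_const, nsmul_eq_mul]
  refine ⟨(B \ F) ∪ (X ∩ F), mem_argmin.2 ⟨s2, fun Y hY => ?_⟩, ?_⟩
  · have m1 := hBm _ s1
    have m2 := hXm Y hY
    have m3 : cost v x ((X \ F) ∪ (B ∩ F)) + cost v u ((B \ F) ∪ (X ∩ F))
        ≤ cost v x B + cost v u X := by
      unfold cost
      rw [Finset.sum_union hd1, Finset.sum_union hd2, hsp x B, hsp u X, hG x X, hG u B, hG x B,
        hG u X, hux X, hux B, hrest, hcard]
      linarith
    linarith
  · ext e
    simp
    tauto

end IsValuated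

end BaseFamily

namespace BaseFamily

variable {α : Type*} [DecidableEq α] {𝓑 𝓒 𝓒₁ : Finset (Finset α)} {v : Finset α → ℝ}
  {G F : Finset α}

theorem card_inter_union {B S T : Finset α} (h : Disjoint S T) :
    (B ∩ (S ∪ T)).card = (B ∩ S).card + (B ∩ T).card := by
  rw [Finset.inter_union_distrib_left, Finset.card_union_of_disjoint]
  exact Finset.disjoint_of_subset_left Finset.inter_subset_right
    (Finset.disjoint_of_subset_right Finset.inter_subset_right h)

theorem card_inter_sdiff {B S T : Finset α} (h : S ⊆ T) :
    (B ∩ S).card + (B ∩ (T \ S)).card = (B ∩ T).card := by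
  rw [← card_inter_union Finset.disjoint_sdiff, Finset.union_sdiff_of_subset h]

theorem inter_erase_of_notMem {B S : Finset α} {e : α} (h : e ∉ B) : B ∩ S.erase e = B ∩ S := by
  ext x
  have : x ∈ B → x ≠ e := fun hx he => h (he ▸ hx)
  simp
  tauto

theorem card_inter_insert {B S : Finset α} {e : α} (h : e ∈ B) (hS : e ∉ S) :
    (B ∩ insert e S).card = (B ∩ S).card + 1 := by
  rw [Finset.inter_insert_of_mem h, Finset.card_insert_of_notMem (by simp [hS])]

theorem card_inter_erase_of_mem {B S : Finset α} {e : α} (h : e ∈ B) (hS : e ∈ S) :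
    (B ∩ S.erase e).card + 1 = (B ∩ S).card := by
  rw [← card_inter_insert h (Finset.notMem_erase e S), Finset.insert_erase hS]

/-- A base that avoids `e`, given that `e` is not a coloop of a set of constant size. -/
theorem rk_erase_eq_of_const {S : Finset α} {n : ℕ} (hn : ∀ B ∈ 𝓒, (B ∩ S).card = n) {e : α}
    (h : ∃ B ∈ 𝓒, e ∉ B) : rk 𝓒 (S.erase e) = rk 𝓒 S := by
  obtain ⟨B, hB, he⟩ := h
  refine le_antisymm (rk_le fun B' hB' => (Finset.card_le_card (Finset.inter_subset_inter_left
    (Finset.erase_subset _ _))).trans (card_le_rk hB' S)) ?_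
  refine rk_le fun B' hB' => ?_
  rw [hn B' hB', ← hn B hB, ← inter_erase_of_notMem he]
  exact card_le_rk hB _

theorem isRkCyclic_of_const {S : Finset α} {n : ℕ} (hn : ∀ B ∈ 𝓒, (B ∩ S).card = n)
    (hg : Good 𝓒 S) : IsRkCyclic (rk 𝓒) S := fun e he => rk_erase_eq_of_const hn (hg e he).2

theorem isRkFlat_empty (hg : Good 𝓒 G) : IsRkFlat (rk 𝓒) G ∅ := by
  intro e he _
  obtain ⟨B, hB, heB⟩ := (hg e he).1
  have h1 := card_le_rk hB (insert e ∅)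
  have h2 : rk 𝓒 ∅ = 0 := Nat.le_zero.1 (rk_le fun B _ => by simp)
  rw [card_inter_insert heB (by simp)] at h1
  omega

theorem empty_mem_cyclicFlats (hg : Good 𝓒 G) : ∅ ∈ cyclicFlats (rk 𝓒) G :=
  mem_cyclicFlats.2 ⟨Finset.empty_subset _, isRkFlat_empty hg, IsRankFn.isRkCyclic_empty _⟩

/-- The Möbius function sum vanishes at the bottom if the family is separated. -/
theorem mob_eq_zero_of_const (h𝓒 : IsValuated 𝓒 v G) {A S : Finset α} {n m : ℕ} {d : ℤ}
    (hA : ∀ B ∈ 𝓒, (B ∩ A).card = m) (hg : Good 𝓒 A) (hSA : S ⊆ A)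
    (hS : ∀ B ∈ 𝓒, (B ∩ S).card = n) (hne : S.Nonempty) (hne' : (A \ S).Nonempty) :
    mob (cyclicFlats (rk 𝓒) A) (fun X => d - rk 𝓒 X) ∅ = 0 := by
  have hS' : ∀ B ∈ 𝓒, (B ∩ (A \ S)).card = m - n := fun B hB => by
    have := card_inter_sdiff (B := B) hSA
    rw [hA B hB, hS B hB] at this
    omega
  have hnm : n ≤ m := by
    obtain ⟨B, hB⟩ := h𝓒.nonempty
    rw [← hA B hB, ← hS B hB]
    exact Finset.card_le_card (Finset.inter_subset_inter_left hSA)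
  refine h𝓒.isRankFn.mob_eq_zero_of_separated (Finset.union_sdiff_of_subset hSA)
    Finset.disjoint_sdiff (isRkCyclic_of_const hS (hg.mono subset_rfl hSA))
    (isRkCyclic_of_const hS' (hg.mono subset_rfl Finset.sdiff_subset)) ?_
    (empty_mem_cyclicFlats hg) ?_ ?_
  · rw [rk_eq_of_const h𝓒.nonempty hS, rk_eq_of_const h𝓒.nonempty hS',
      rk_eq_of_const h𝓒.nonempty hA]
    omega
  · rw [Finset.subset_empty]
    exact hne.ne_empty
  · rw [Finset.subset_empty]
    exact hne'.ne_empty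

/-- The family `𝓒₁` contains the face of `𝓒` for `F`, as the part that meets `F` the least. -/
structure IsAdjacent (𝓒 𝓒₁ : Finset (Finset α)) (F : Finset α) : Prop where
  sub : face 𝓒 F ⊆ 𝓒₁
  le : ∀ B ∈ 𝓒₁, rk 𝓒 F ≤ (B ∩ F).card
  mem : ∀ B ∈ 𝓒₁, (B ∩ F).card = rk 𝓒 F → B ∈ 𝓒

theorem isAdjacent_face (𝓒 : Finset (Finset α)) (F : Finset α) : IsAdjacent 𝓒 (face 𝓒 F) F where
  sub := subset_rfl
  le _ hB := (mem_face.1 hB).2.ge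
  mem _ hB _ := (mem_face.1 hB).1

theorem good_face (h𝓒 : IsValuated 𝓒 v G) (hg : Good 𝓒 G)
    (hF : F ∈ cyclicFlats (rk 𝓒) G) : Good (face 𝓒 F) G := by
  obtain ⟨hFG, hFf, hFc⟩ := mem_cyclicFlats.1 hF
  intro e he
  by_cases heF : e ∈ F
  · constructor
    · obtain ⟨B, hB, h1, h2⟩ := h𝓒.exists_card_eq_rk_pair (Finset.singleton_subset_iff.2 heF)
      refine ⟨B, mem_face.2 ⟨hB, h2⟩, ?_⟩
      by_contra heB
      have h3 := isRkFlat_empty hg e he (Finset.notMem_empty e)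
      rw [insert_empty_eq, ← h1, Finset.inter_singleton_of_notMem heB] at h3
      simp at h3
    · obtain ⟨B, hB, h1⟩ := exists_card_eq_rk h𝓒.nonempty (F.erase e)
      rw [hFc e heF] at h1
      have h2 := card_le_rk hB F
      have h3 : (B ∩ F.erase e).card ≤ (B ∩ F).card :=
        Finset.card_le_card (Finset.inter_subset_inter_left (Finset.erase_subset _ _))
      refine ⟨B, mem_face.2 ⟨hB, by omega⟩, fun heB => ?_⟩
      have := card_inter_erase_of_mem heB heF
      omega
  · constructor
    · obtain ⟨B, hB, h1, h2⟩ := h𝓒.exists_card_eq_rk_pair (Finset.subset_insert e F)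
      refine ⟨B, mem_face.2 ⟨hB, h1⟩, ?_⟩
      by_contra heB
      have h3 := hFf e he heF
      rw [← h2, ← h1, Finset.inter_insert_of_notMem heB] at h3
      exact lt_irrefl _ h3
    · obtain ⟨B, hB, h1, h2⟩ := h𝓒.exists_card_eq_rk_pair (Finset.subset_erase.2 ⟨hFG, heF⟩)
      refine ⟨B, mem_face.2 ⟨hB, h1⟩, fun heB => ?_⟩
      rw [rk_erase_eq_of_const (fun B hB => h𝓒.card_inter_ground hB) (hg e he).2] at h2
      have h3 := card_inter_erase_of_mem heB he
      have h4 := card_le_rk hB G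
      omega

namespace IsAdjacent

theorem rk_ground (ha : IsAdjacent 𝓒 𝓒₁ F) (h𝓒 : IsValuated 𝓒 v G) (h1 : IsValuated 𝓒₁ v G) :
    rk 𝓒₁ G = rk 𝓒 G := by
  obtain ⟨B, hB⟩ := face_nonempty h𝓒.nonempty F
  rw [← h1.card_inter_ground (ha.sub hB), ← h𝓒.card_inter_ground (mem_face.1 hB).1]

theorem rk_add (ha : IsAdjacent 𝓒 𝓒₁ F) (h𝓒 : IsValuated 𝓒 v G) (h1 : IsValuated 𝓒₁ v G)
    (hFG : F ⊆ G) {S : Finset α} (hS : S ⊆ G \ F) : rk 𝓒₁ S + rk 𝓒 F = rk 𝓒 (F ∪ S) := by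
  have hd : Disjoint F S := Finset.disjoint_of_subset_right hS Finset.disjoint_sdiff
  apply le_antisymm
  · obtain ⟨B, hB, hBS, hBA⟩ := h1.exists_card_eq_rk_pair hS
    obtain ⟨B₀, hB₀⟩ := face_nonempty h𝓒.nonempty F
    have c1 := card_inter_sdiff (B := B) hFG
    have c2 := card_inter_sdiff (B := B₀) hFG
    have c3 := h1.card_inter_eq hB (ha.sub hB₀)
    have c4 := card_le_rk (ha.sub hB₀) (G \ F)
    have c5 := (mem_face.1 hB₀).2
    have c6 := ha.le B hB
    have hB𝓒 := ha.mem B hB (by omega)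
    have := card_le_rk hB𝓒 (F ∪ S)
    rw [card_inter_union hd] at this
    omega
  · obtain ⟨B, hB, hBF, hBS⟩ := h𝓒.exists_card_eq_rk_pair (Finset.subset_union_left (s₁ := F)
      (s₂ := S))
    rw [← hBS, card_inter_union hd, hBF, add_comm]
    exact Nat.add_le_add_right (card_le_rk (ha.sub (mem_face.2 ⟨hB, hBF⟩)) S) _

theorem rk_compl (ha : IsAdjacent 𝓒 𝓒₁ F) (h𝓒 : IsValuated 𝓒 v G) (h1 : IsValuated 𝓒₁ v G)
    (hFG : F ⊆ G) : rk 𝓒₁ (G \ F) + rk 𝓒 F = rk 𝓒 G := by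
  rw [ha.rk_add h𝓒 h1 hFG subset_rfl, Finset.union_sdiff_of_subset hFG]

theorem card_inter_compl (ha : IsAdjacent 𝓒 𝓒₁ F) (h𝓒 : IsValuated 𝓒 v G)
    (h1 : IsValuated 𝓒₁ v G) (hFG : F ⊆ G) {B : Finset α} (hB : B ∈ BaseFamily.face 𝓒 F) :
    (B ∩ (G \ F)).card = rk 𝓒₁ (G \ F) := by
  have c1 := ha.rk_compl h𝓒 h1 hFG
  have c2 := card_inter_sdiff (B := B) hFG
  have c3 := h𝓒.card_inter_ground (mem_face.1 hB).1
  have c4 := (mem_face.1 hB).2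
  omega

theorem nullity_add (ha : IsAdjacent 𝓒 𝓒₁ F) (h𝓒 : IsValuated 𝓒 v G) (h1 : IsValuated 𝓒₁ v G)
    (hFG : F ⊆ G) {S : Finset α} (hS : S ⊆ G \ F) :
    nullity (rk 𝓒) (F ∪ S) = nullity (rk 𝓒) F + nullity (rk 𝓒₁) S := by
  have hd : Disjoint F S := Finset.disjoint_of_subset_right hS Finset.disjoint_sdiff
  have := ha.rk_add h𝓒 h1 hFG hS
  unfold nullity
  rw [Finset.card_union_of_disjoint hd]
  push_cast
  omega

theorem good (ha : IsAdjacent 𝓒 𝓒₁ F) (h𝓒 : IsValuated 𝓒 v G) (hg : Good 𝓒 G)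
    (hF : F ∈ cyclicFlats (rk 𝓒) G) : Good 𝓒₁ G :=
  (good_face h𝓒 hg hF).mono ha.sub subset_rfl

theorem compl_mem (ha : IsAdjacent 𝓒 𝓒₁ F) (h𝓒 : IsValuated 𝓒 v G) (h1 : IsValuated 𝓒₁ v G)
    (hg : Good 𝓒 G) (hF : F ∈ cyclicFlats (rk 𝓒) G) : G \ F ∈ cyclicFlats (rk 𝓒₁) G := by
  have hFG := (mem_cyclicFlats.1 hF).1
  have hgf := good_face h𝓒 hg hF
  have hc := fun {B} => ha.card_inter_compl h𝓒 h1 hFG (B := B)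
  refine mem_cyclicFlats.2 ⟨Finset.sdiff_subset, fun e he heA => ?_, fun e he => ?_⟩
  · obtain ⟨B, hB, heB⟩ := (hgf e he).1
    rw [← hc hB]
    refine lt_of_lt_of_le ?_ (card_le_rk (ha.sub hB) _)
    rw [card_inter_insert heB heA]
    exact Nat.lt_succ_self _
  · obtain ⟨B, hB, heB⟩ := (hgf e (Finset.mem_sdiff.1 he).1).2
    refine le_antisymm (h1.isRankFn.mono _ _ (Finset.erase_subset _ _)) ?_
    rw [← hc hB, ← inter_erase_of_notMem heB]
    exact card_le_rk (ha.sub hB) _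

/-- The potential decreases in a step from `F` to a cyclic flat of the adjacent family that is
independent in the complement of `F`. -/
theorem potential (ha : IsAdjacent 𝓒 𝓒₁ F) (h𝓒 : IsValuated 𝓒 v G) (h1 : IsValuated 𝓒₁ v G)
    (hg : Good 𝓒 G) (hF : F ∈ cyclicFlats (rk 𝓒) G) (hlt : ∃ B ∈ 𝓒₁, rk 𝓒 F < (B ∩ F).card)
    {F' : Finset α} (hF' : F' ∈ cyclicFlats (rk 𝓒₁) G)
    (hnull : nullity (rk 𝓒₁) (F' ∩ (G \ F)) = 0) :
    nullity (rk 𝓒₁) F' < nullity (rk 𝓒) F ∨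
      nullity (rk 𝓒₁) F' = nullity (rk 𝓒) F ∧ F.card < F'.card := by
  have hFG := (mem_cyclicFlats.1 hF).1
  have hF'G := (mem_cyclicFlats.1 hF').1
  have hr := h1.isRankFn
  have hs := hr.nullity_supermod F' (G \ F)
  have hUG : F' ∪ G \ F ⊆ G := Finset.union_subset hF'G Finset.sdiff_subset
  have hm := hr.nullity_mono hUG
  have hc := ha.rk_compl h𝓒 h1 hFG
  have hcG := ha.rk_ground h𝓒 h1
  have hcard := Finset.card_sdiff_add_card_eq_card hFG
  have key : nullity (rk 𝓒₁) G = nullity (rk 𝓒₁) (G \ F) + nullity (rk 𝓒) F := by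
    unfold nullity
    omega
  rcases lt_or_eq_of_le (by omega : nullity (rk 𝓒₁) F' ≤ nullity (rk 𝓒) F) with h | h
  · exact Or.inl h
  · refine Or.inr ⟨h, ?_⟩
    have hGU : G ⊆ F' ∪ G \ F := by
      intro e he
      by_contra heU
      have hcyc := isRkCyclic_of_const (fun B hB => h1.card_inter_ground hB)
        (ha.good h𝓒 hg hF) e he
      rw [hr.nullity_erase_iff he] at hcyc
      have := hr.nullity_mono (Finset.subset_erase.2 ⟨hUG, heU⟩)
      omega
    have hFF' : F ⊆ F' := fun e he => by
      have := hGU (hFG he)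
      simp only [Finset.mem_union, Finset.mem_sdiff] at this
      tauto
    apply Finset.card_lt_card
    refine Finset.ssubset_iff_subset_ne.2 ⟨hFF', ?_⟩
    rintro rfl
    obtain ⟨B, hB, hlt⟩ := hlt
    have := card_le_rk hB F
    unfold nullity at h
    omega

end IsAdjacent

/-! ### Comparison of two points -/

open Classical in
/-- The elements of `D` at which `u - x` is minimal. -/
noncomputable def minset (u x : α → ℝ) (D : Finset α) : Finset α :=
  D.filter fun e => ∀ e' ∈ D, u e - x e ≤ u e' - x e'

theorem mem_minset {u x : α → ℝ} {D : Finset α} {e : α} :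
    e ∈ minset u x D ↔ e ∈ D ∧ ∀ e' ∈ D, u e - x e ≤ u e' - x e' := by
  simp [minset]

theorem minset_subset (u x : α → ℝ) (D : Finset α) : minset u x D ⊆ D := Finset.filter_subset _ _

theorem minset_nonempty (u x : α → ℝ) {D : Finset α} (h : D.Nonempty) :
    (minset u x D).Nonempty := by
  obtain ⟨e, he, hmin⟩ := D.exists_min_image (fun e => u e - x e) h
  exact ⟨e, mem_minset.2 ⟨he, hmin⟩⟩

theorem mem_minset_of_le {u x : α → ℝ} {D : Finset α} {e b : α} (he : e ∈ minset u x D)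
    (hb : b ∈ D) (h : x e - u e ≤ x b - u b) : b ∈ minset u x D ∧ x b - u b ≤ x e - u e := by
  obtain ⟨heD, hem⟩ := mem_minset.1 he
  have := hem b hb
  refine ⟨mem_minset.2 ⟨hb, fun e' he' => ?_⟩, by linarith⟩
  have := hem e' he'
  linarith

/-- The elements at which `u - x` is not minimal form a flat at `x`. -/
theorem isRkFlat_compl_minset (h : IsValuated 𝓑 v G) {F : Finset α} {x u : α → ℝ}
    (hg : Good (argmin (face 𝓑 F) (cost v u)) (G \ F)) :
    IsRkFlat (rk (argmin 𝓑 (cost v x))) G (G \ minset u x (G \ F)) := by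
  intro e heG he
  set S := minset u x (G \ F) with hS
  have heS : e ∈ S := by
    by_contra h'
    exact he (Finset.mem_sdiff.2 ⟨heG, h'⟩)
  obtain ⟨B, hB, hBk⟩ := exists_card_eq_rk ((h.argmin x).nonempty) (G \ S)
  suffices H : ∃ B' ∈ argmin 𝓑 (cost v x), e ∈ B' ∧
      (B' ∩ (G \ S)).card = (B ∩ (G \ S)).card by
    obtain ⟨B', hB', heB', hc⟩ := H
    rw [← hBk, ← hc]
    refine lt_of_lt_of_le ?_ (card_le_rk hB' _)
    rw [card_inter_insert heB' he]
    exact Nat.lt_succ_self _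
  by_cases heB : e ∈ B
  · exact ⟨B, hB, heB, rfl⟩
  · have heD := minset_subset _ _ _ heS
    obtain ⟨X, hX, heX⟩ := (hg e heD).1
    obtain ⟨b, hb, hbF, hle, himp⟩ := h.exchange_cost hB hX (Finset.mem_sdiff.2 ⟨heX, heB⟩)
      (Finset.mem_sdiff.1 heD).2
    have hbG := h.mem_of_mem_sdiff (argmin_subset _ _ hB)
      (face_subset _ _ (argmin_subset _ _ hX)) hb
    obtain ⟨hbS, hle'⟩ := mem_minset_of_le heS (Finset.mem_sdiff.2 ⟨hbG, hbF⟩) hle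
    refine ⟨_, himp hle', Finset.mem_insert_self _ _, ?_⟩
    have := card_inter_exchange (Finset.mem_sdiff.1 hb).1 heB (G \ S)
    rwa [if_neg (fun h' => (Finset.mem_sdiff.1 h').2 hbS), if_neg he, add_zero, add_zero] at this

theorem card_inter_minset_le (h : IsValuated 𝓑 v G) {F : Finset α} {x u : α → ℝ} {X : Finset α}
    (hX : X ∈ argmin (face 𝓑 F) (cost v u)) (n : ℕ) :
    ∀ B ∈ argmin (face 𝓑 F) (cost v x), (X \ B).card = n →
      (X ∩ minset u x (G \ F)).card ≤ (B ∩ minset u x (G \ F)).card := by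
  set S := minset u x (G \ F) with hS
  induction n using Nat.strong_induction_on with
  | _ n ih =>
    intro B hB hn
    by_cases hsub : X ∩ S ⊆ B ∩ S
    · exact Finset.card_le_card hsub
    · obtain ⟨e, he, he'⟩ := Finset.not_subset.1 hsub
      obtain ⟨heX, heS⟩ := Finset.mem_inter.1 he
      have heB : e ∉ B := fun h' => he' (Finset.mem_inter.2 ⟨h', heS⟩)
      have heD := minset_subset _ _ _ heS
      have hX' : X ∈ argmin (face (face 𝓑 F) F) (cost v u) := by rwa [face_face h.nonempty]
      obtain ⟨b, hb, hbF, hle, himp⟩ := (h.face F).exchange_cost hB hX'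
        (Finset.mem_sdiff.2 ⟨heX, heB⟩) (Finset.mem_sdiff.1 heD).2
      have hbG := (h.face F).mem_of_mem_sdiff (argmin_subset _ _ hB) (argmin_subset _ _ hX) hb
      obtain ⟨hbS, hle'⟩ := mem_minset_of_le heS (Finset.mem_sdiff.2 ⟨hbG, hbF⟩) hle
      obtain ⟨hbB, hbX⟩ := Finset.mem_sdiff.1 hb
      have c := card_inter_exchange hbB heB S
      rw [if_pos hbS, if_pos heS] at c
      have := ih _ (hn ▸ card_sdiff_exchange_lt hbX heX heB) _ (himp hle') rfl
      omega

/-- The complement of `minset` in the shifted situation, for a direction `F`. -/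
theorem minset_of_shift {u x : α → ℝ} {F D G : Finset α} {s : ℝ} (hs : 0 < s)
    {a : α} (ha : a ∈ minset u (shift x F s) D) (haF : a ∉ F) :
    F ∩ minset u x D = ∅ ∧
      (G \ minset u x D) ∩ (G \ F) = (G \ minset u (shift x F s) D) ∩ (G \ F) := by
  obtain ⟨haD, ham⟩ := mem_minset.1 ha
  simp only [shift, if_neg haF, add_zero] at ham
  have hF : F ∩ minset u x D = ∅ := by
    ext e
    simp only [Finset.mem_inter, Finset.notMem_empty, iff_false, not_and]
    intro heF he
    obtain ⟨heD, hem⟩ := mem_minset.1 he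
    have h1 := ham e heD
    have h2 := hem a haD
    rw [if_pos heF] at h1
    linarith
  refine ⟨hF, ?_⟩
  have key : ∀ e, e ∉ F → (e ∈ minset u x D ↔ e ∈ minset u (shift x F s) D) := by
    intro e heF
    simp only [mem_minset, shift, if_neg heF, add_zero]
    refine and_congr_right fun heD => ⟨fun h e' he' => ?_, fun h e' he' => ?_⟩
    · have h1 := h a haD
      have h2 := ham e' he'
      linarith
    · have h1 := h e' he'
      split_ifs at h1 <;> linarith
  ext e
  simp only [Finset.mem_inter, Finset.mem_sdiff]
  have := key e
  tauto

end BaseFamily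

namespace BaseFamily

variable {α : Type*} [DecidableEq α] {𝓑 𝓒 𝓒₁ : Finset (Finset α)} {v : Finset α → ℝ}
  {G F : Finset α}

/-- The Möbius function sums of the family `𝓒` on the ground set `G`. -/
noncomputable def mobRk (𝓒 : Finset (Finset α)) (G : Finset α) (d : ℤ) (F : Finset α) : ℤ :=
  mob (cyclicFlats (rk 𝓒) G) (fun S => d - rk 𝓒 S) F

/-- A system that lists, for each cyclic flat `F` of `𝓑`, the initial families of the face of `F`
that have neither loops nor coloops outside `F`, with their multiplicities. -/
structure IsPointSystem {ι : Type*} (𝓑 : Finset (Finset α)) (v : Finset α → ℝ) (G : Finset α)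
    (d : ℤ) (Q : Finset ι) (Fl : ι → Finset α) (u : ι → α → ℝ) (τ : ι → ℤ) : Prop where
  flat : ∀ q ∈ Q, Fl q ∈ cyclicFlats (rk 𝓑) G
  good : ∀ q ∈ Q, Good (argmin (face 𝓑 (Fl q)) (cost v (u q))) (G \ Fl q)
  mult : ∀ q ∈ Q, τ q =
    mobRk (argmin (face 𝓑 (Fl q)) (cost v (u q))) (G \ Fl q) (d - rk 𝓑 (Fl q)) ∅
  unique : ∀ q ∈ Q, ∀ q' ∈ Q, Fl q = Fl q' → (∃ c, ∀ e ∈ G \ Fl q, u q e = u q' e + c) → q = q'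
  exists_point : ∀ F ∈ cyclicFlats (rk 𝓑) G, ∀ x,
    Good (argmin (face 𝓑 F) (cost v x)) (G \ F) → ∃ q ∈ Q, Fl q = F ∧
      ∀ S ⊆ G \ F, rk (argmin (face 𝓑 F) (cost v (u q))) S
        = rk (argmin (face 𝓑 F) (cost v x)) S

variable {ι : Type*} {d : ℤ} {Q : Finset ι} {Fl : ι → Finset α} {u : ι → α → ℝ} {τ : ι → ℤ}

/-- The multiplicity of the cyclic flat `F` at `x` is the sum of the multiplicities of the points
which are seen from `x` in the direction `F`. -/
def IsBalanced (𝓑 : Finset (Finset α)) (v : Finset α → ℝ) (G : Finset α) (d : ℤ)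
    (Q : Finset ι) (Fl : ι → Finset α) (u : ι → α → ℝ) (τ : ι → ℤ) (x : α → ℝ)
    (F : Finset α) : Prop :=
  mobRk (argmin 𝓑 (cost v x)) G d F = ∑ q ∈ Q with
    cyclicPart (rk (argmin 𝓑 (cost v x))) (G \ minset (u q) x (G \ Fl q)) = F, τ q

theorem Good.isRkCyclic (hg : Good 𝓒 G) (h : IsValuated 𝓒 v G) : IsRkCyclic (rk 𝓒) G :=
  isRkCyclic_of_const (fun _ hB => h.card_inter_ground hB) hg

theorem isRkCyclic_face (h : IsValuated 𝓒 v G) (hg : Good 𝓒 G)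
    (hF : F ∈ cyclicFlats (rk 𝓒) G) : IsRkCyclic (rk (face 𝓒 F)) F :=
  isRkCyclic_of_const (fun _ hB => (mem_face.1 hB).2)
    ((good_face h hg hF).mono subset_rfl (mem_cyclicFlats.1 hF).1)

theorem nullity_pos_of_isRkCyclic {r : Finset α → ℕ} (hr : IsRankFn r) {C : Finset α}
    (hC : IsRkCyclic r C) (hne : C.Nonempty) : 0 < nullity r C := by
  obtain ⟨e, he⟩ := hne
  have := (hr.nullity_erase_iff he).1 (hC e he)
  have := hr.nullity_nonneg (C.erase e)
  omega

theorem nullity_lt_of_ssubset {r : Finset α → ℕ} (hr : IsRankFn r) {C S : Finset α}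
    (hC : IsRkCyclic r C) (h : S ⊂ C) : nullity r S < nullity r C := by
  obtain ⟨e, heC, heS⟩ := Finset.exists_of_ssubset h
  have h1 := (hr.nullity_erase_iff heC).1 (hC e heC)
  have h2 := hr.nullity_mono (Finset.subset_erase.2 ⟨h.1, heS⟩)
  omega

/-- A cyclic set of a separated family that is independent in one part avoids this part. -/
theorem inter_eq_empty_of_separated {r : Finset α → ℕ} (hr : IsRankFn r) {A K : Finset α}
    (hd : Disjoint F A) (hsep : r F + r A = r (F ∪ A)) (hK : K ⊆ F ∪ A) (hKc : IsRkCyclic r K)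
    (h0 : nullity r (K ∩ A) = 0) : K ∩ A = ∅ := by
  by_contra hne
  have hd' : Disjoint (K ∩ F) (K ∩ A) := Finset.disjoint_of_subset_left Finset.inter_subset_right
    (Finset.disjoint_of_subset_right Finset.inter_subset_right hd)
  have h1 : nullity r (K ∩ F) < nullity r K := by
    apply nullity_lt_of_ssubset hr hKc
    refine Finset.ssubset_iff_subset_ne.2 ⟨Finset.inter_subset_left, fun he => hne ?_⟩
    rw [← he, Finset.inter_assoc, Finset.disjoint_iff_inter_eq_empty.1 hd, Finset.inter_empty]
  have h2 := hr.rk_eq_add_of_separated hd hsep hK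
  have h3 : (K ∩ F).card + (K ∩ A).card = K.card := by
    rw [← Finset.card_union_of_disjoint hd', ← Finset.inter_union_distrib_left,
      Finset.inter_eq_left.2 hK]
  unfold nullity at *
  omega

theorem mobRk_contract (h : IsValuated 𝓒 v G) (h₁ : IsValuated 𝓒₁ v G) (hg : Good 𝓒 G)
    (hF : F ∈ cyclicFlats (rk 𝓒) G) (ha : IsAdjacent 𝓒 𝓒₁ F) {d : ℤ} :
    mobRk 𝓒 G d F = mobRk 𝓒₁ (G \ F) (d - rk 𝓒 F) ∅ := by
  have hFG := (mem_cyclicFlats.1 hF).1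
  have hGm : G ∈ cyclicFlats (rk 𝓒) G :=
    mem_cyclicFlats.2 ⟨subset_rfl, fun e he he' => absurd he he', hg.isRkCyclic h⟩
  rcases hFG.eq_or_ssubset with rfl | hss
  · have h1 := sum_mob (cyclicFlats (rk 𝓒) F) (fun S => d - rk 𝓒 S) hGm
    have e1 : (cyclicFlats (rk 𝓒) F).filter (F ⊆ ·) = {F} := by
      ext X
      simp only [Finset.mem_filter, Finset.mem_singleton]
      refine ⟨fun hX => (mem_cyclicFlats.1 hX.1).1.antisymm hX.2, ?_⟩
      rintro rfl
      exact ⟨hGm, subset_rfl⟩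
    have h0 : ∅ ∈ cyclicFlats (rk 𝓒₁) (F \ F) := empty_mem_cyclicFlats (by simp [Good])
    have h2 := sum_mob (cyclicFlats (rk 𝓒₁) (F \ F)) (fun S => d - rk 𝓒 F - rk 𝓒₁ S) h0
    have e2 : (cyclicFlats (rk 𝓒₁) (F \ F)).filter (∅ ⊆ ·) = {∅} := by
      ext X
      simp only [Finset.mem_filter, Finset.mem_singleton]
      constructor
      · intro hX
        have := (mem_cyclicFlats.1 hX.1).1
        rwa [Finset.sdiff_self, Finset.subset_empty] at this
      · rintro rfl
        exact ⟨h0, subset_rfl⟩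
    rw [e1, Finset.sum_singleton] at h1
    rw [e2, Finset.sum_singleton] at h2
    rw [mobRk, mobRk, h1, h2, h₁.isRankFn.empty]
    simp
  · rw [mobRk, mobRk, h.isRankFn.mob_minor (d := d) hGm hF hss fun S hS => ha.rk_add h h₁ hFG hS]
    symm
    rw [Finset.sum_eq_single_of_mem F]
    · rw [Finset.mem_filter, Finset.inter_eq_left.2 hFG]
      exact ⟨hF, h.isRankFn.cyclicPart_of_cyclic (mem_cyclicFlats.1 hF).2.2⟩
    · intro X hX hne
      obtain ⟨hX, he⟩ := Finset.mem_filter.1 hX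
      obtain ⟨hXG, -, hXc⟩ := mem_cyclicFlats.1 hX
      rw [Finset.inter_eq_left.2 hXG, h.isRankFn.cyclicPart_of_cyclic hXc] at he
      exact absurd he hne

/-- The point `u` comes into sight in both parts `F` and `G \ F`. -/
def IsCrossing (G F : Finset α) (u : α → ℝ) (x : α → ℝ) (F₀ : Finset α) (s : ℝ) : Prop :=
  (∃ e ∈ F, e ∈ minset u (shift x F s) (G \ F₀)) ∧
    ∃ e ∈ G \ F, e ∈ minset u (shift x F s) (G \ F₀)

theorem IsCrossing.unique {u x : α → ℝ} {F₀ : Finset α} {s s' : ℝ}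
    (h : IsCrossing G F u x F₀ s) (h' : IsCrossing G F u x F₀ s') : s = s' := by
  obtain ⟨⟨e, heF, he⟩, a, ha, hea⟩ := h
  obtain ⟨⟨e', heF', he'⟩, a', ha', hea'⟩ := h'
  have haF := (Finset.mem_sdiff.1 ha).2
  have haF' := (Finset.mem_sdiff.1 ha').2
  rw [mem_minset] at he hea he' hea'
  have h1 := he.2 a hea.1
  have h2 := hea.2 e he.1
  have h3 := he'.2 a' hea'.1
  have h4 := hea'.2 e' he'.1
  have h5 := he.2 e' he'.1
  have h6 := he'.2 e he.1
  have h7 := hea.2 a' hea'.1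
  have h8 := hea'.2 a hea.1
  simp only [shift, if_pos heF, if_pos heF', if_neg haF, if_neg haF'] at *
  linarith

theorem cyclicPart_eq_iff_of_shift (h : IsValuated 𝓑 v G) {x w : α → ℝ} {F₀ : Finset α} {s : ℝ}
    (hF : F ∈ cyclicFlats (rk (argmin 𝓑 (cost v x))) G) (h₁ : IsValuated 𝓒₁ v G)
    (ha : IsAdjacent (argmin 𝓑 (cost v x)) 𝓒₁ F) (hs : 0 < s)
    (hA : ∃ a ∈ G \ F, a ∈ minset w (shift x F s) (G \ F₀)) :
    cyclicPart (rk (argmin 𝓑 (cost v x))) (G \ minset w x (G \ F₀)) = F ↔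
      nullity (rk 𝓒₁) ((G \ minset w (shift x F s) (G \ F₀)) ∩ (G \ F)) = 0 := by
  obtain ⟨a, haA, ham⟩ := hA
  obtain ⟨hFG, -, hFc⟩ := mem_cyclicFlats.1 hF
  obtain ⟨h1, h2⟩ := minset_of_shift (G := G) hs ham (Finset.mem_sdiff.1 haA).2
  have hFs : F ⊆ G \ minset w x (G \ F₀) := by
    intro e he
    refine Finset.mem_sdiff.2 ⟨hFG he, fun he' => ?_⟩
    have : e ∈ F ∩ minset w x (G \ F₀) := Finset.mem_inter.2 ⟨he, he'⟩
    rw [h1] at this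
    simp at this
  have he : G \ minset w x (G \ F₀) = F ∪ ((G \ minset w x (G \ F₀)) ∩ (G \ F)) := by
    ext e
    have := @hFs e
    have := @hFG e
    simp only [Finset.mem_union, Finset.mem_inter, Finset.mem_sdiff] at *
    tauto
  rw [(h.argmin x).isRankFn.cyclicPart_eq_iff hFc, ← h2, he,
    ha.nullity_add (h.argmin x) h₁ hFG Finset.inter_subset_right]
  have : (F ∪ (G \ minset w x (G \ F₀)) ∩ (G \ F)) ∩ (G \ F)
      = (G \ minset w x (G \ F₀)) ∩ (G \ F) := by
    ext e
    simp only [Finset.mem_union, Finset.mem_inter, Finset.mem_sdiff]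
    tauto
  rw [this]
  constructor
  · rintro ⟨-, h'⟩
    omega
  · intro h'
    exact ⟨Finset.subset_union_left, by omega⟩

theorem crossing_iff (h : IsValuated 𝓑 v G) {x w : α → ℝ} {F₀ : Finset α} {s : ℝ}
    (hg : Good (argmin 𝓑 (cost v x)) G)
    (hF : F ∈ cyclicFlats (rk (argmin 𝓑 (cost v x))) G) (hne : (G \ F).Nonempty) (hs : 0 < s) :
    (cyclicPart (rk (argmin 𝓑 (cost v x))) (G \ minset w x (G \ F₀)) = F ∧
        IsCrossing G F w x F₀ s) ↔
      cyclicPart (rk (face (argmin 𝓑 (cost v x)) F))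
        (G \ minset w (shift x F s) (G \ F₀)) ⊂ F := by
  have hx := h.argmin x
  have hy := hx.face F
  have ha := isAdjacent_face (argmin 𝓑 (cost v x)) F
  have hFG := (mem_cyclicFlats.1 hF).1
  set Φ := G \ minset w (shift x F s) (G \ F₀) with hΦ
  set r := rk (face (argmin 𝓑 (cost v x)) F) with hr
  have hΦG : Φ ⊆ G := Finset.sdiff_subset
  have hFA : F ∪ G \ F = G := Finset.union_sdiff_of_subset hFG
  have hFc : IsRkCyclic r F := isRkCyclic_face hx hg hF
  have hAc : IsRkCyclic r (G \ F) := (mem_cyclicFlats.1 (ha.compl_mem hx hy hg hF)).2.2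
  have hmemΦ : ∀ e ∈ G, e ∉ Φ → e ∈ minset w (shift x F s) (G \ F₀) := fun e he he' => by
    by_contra h'
    exact he' (Finset.mem_sdiff.2 ⟨he, h'⟩)
  have hsep : r F + r (G \ F) = r (F ∪ G \ F) := by
    rw [hFA, hr, ha.rk_ground hx hy, rk_face_self hx.nonempty, ← ha.rk_compl hx hy hFG, add_comm]
  constructor
  · rintro ⟨hc, ⟨e, heF, he⟩, hcA⟩
    rw [cyclicPart_eq_iff_of_shift h hF hy ha hs hcA,
      ← hy.isRankFn.nullity_cyclicPart_inter_eq_zero] at hc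
    have h0 := inter_eq_empty_of_separated hy.isRankFn Finset.disjoint_sdiff hsep
      (by rw [hFA]; exact (IsRankFn.cyclicPart_subset _ _).trans hΦG)
      (hy.isRankFn.isRkCyclic_cyclicPart Φ) hc
    refine Finset.ssubset_iff_subset_ne.2 ⟨fun b hb => ?_, fun heq => ?_⟩
    · by_contra hbF
      have : b ∈ cyclicPart r Φ ∩ (G \ F) := Finset.mem_inter.2 ⟨hb, Finset.mem_sdiff.2
        ⟨hΦG (IsRankFn.cyclicPart_subset _ _ hb), hbF⟩⟩
      rw [h0] at this
      simp at this
    · have : e ∈ Φ := IsRankFn.cyclicPart_subset r Φ (heq ▸ heF)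
      exact (Finset.mem_sdiff.1 this).2 he
  · intro hK
    have hcA : ∃ a ∈ G \ F, a ∈ minset w (shift x F s) (G \ F₀) := by
      by_contra hno
      have hsub : G \ F ⊆ Φ := fun a ha' => by
        by_contra h'
        exact hno ⟨a, ha', hmemΦ a (Finset.mem_sdiff.1 ha').1 h'⟩
      have := hy.isRankFn.cyclic_subset_cyclicPart hAc hsub
      obtain ⟨a, ha'⟩ := hne
      exact (Finset.mem_sdiff.1 ha').2 (hK.1 (this ha'))
    refine ⟨?_, ?_, hcA⟩
    · rw [cyclicPart_eq_iff_of_shift h hF hy ha hs hcA,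
        ← hy.isRankFn.nullity_cyclicPart_inter_eq_zero]
      have : cyclicPart r Φ ∩ (G \ F) = ∅ := by
        rw [← Finset.disjoint_iff_inter_eq_empty]
        exact Finset.disjoint_of_subset_left hK.1 Finset.disjoint_sdiff
      rw [← hr, this, hy.isRankFn.nullity_empty]
    · by_contra hno
      have hsub : F ⊆ Φ := fun a ha' => by
        by_contra h'
        exact hno ⟨a, ha', hmemΦ a (hFG ha') h'⟩
      exact hK.2 (hy.isRankFn.cyclic_subset_cyclicPart hFc hsub)

open Classical in
/-- The points that are passed on the way in the direction `F` have total multiplicity zero. -/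
theorem sum_crossing_eq_zero (h : IsValuated 𝓑 v G) (hQ : IsPointSystem 𝓑 v G d Q Fl u τ)
    {x : α → ℝ} (hg : Good (argmin 𝓑 (cost v x)) G)
    (hF : F ∈ cyclicFlats (rk (argmin 𝓑 (cost v x))) G)
    (IH : ∀ y, Good (argmin 𝓑 (cost v y)) G → ∀ F' ∈ cyclicFlats (rk (argmin 𝓑 (cost v y))) G,
      nullity (rk (argmin 𝓑 (cost v y))) F' < nullity (rk (argmin 𝓑 (cost v x))) F →
      IsBalanced 𝓑 v G d Q Fl u τ y F')
    (T : ℝ → Prop) (hT : ∀ s, T s → 0 < s ∧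
      argmin 𝓑 (cost v (shift x F s)) = face (argmin 𝓑 (cost v x)) F) :
    ∑ q ∈ (Q.filter fun q => cyclicPart (rk (argmin 𝓑 (cost v x)))
      (G \ minset (u q) x (G \ Fl q)) = F).filter
        (fun q => ∃ s, T s ∧ IsCrossing G F (u q) x (Fl q) s), τ q = 0 := by
  rcases (G \ F).eq_empty_or_nonempty with hempty | hne
  · refine Finset.sum_eq_zero fun q hq => ?_
    obtain ⟨s, -, -, a, ha, -⟩ := (Finset.mem_filter.1 hq).2
    rw [hempty] at ha
    simp at ha
  let cr : ι → ℝ := fun q =>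
    if hq : ∃ s, T s ∧ IsCrossing G F (u q) x (Fl q) s then hq.choose else 0
  have hcr : ∀ q s, T s → IsCrossing G F (u q) x (Fl q) s → cr q = s := by
    intro q s hs hq
    have hex : ∃ s, T s ∧ IsCrossing G F (u q) x (Fl q) s := ⟨s, hs, hq⟩
    simp only [cr, dif_pos hex]
    exact hex.choose_spec.2.unique hq
  rw [← Finset.sum_fiberwise_of_maps_to (fun q hq => Finset.mem_image_of_mem cr hq)]
  refine Finset.sum_eq_zero fun s hs => ?_
  obtain ⟨q₀, hq₀, rfl⟩ := Finset.mem_image.1 hs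
  obtain ⟨s, hs, hcs⟩ := (Finset.mem_filter.1 hq₀).2
  rw [hcr q₀ s hs hcs]
  obtain ⟨hs0, hsI⟩ := hT s hs
  have hx := h.argmin x
  have hy := hx.face F
  have ha := isAdjacent_face (argmin 𝓑 (cost v x)) F
  have hFG := (mem_cyclicFlats.1 hF).1
  have hFA : F ∪ G \ F = G := Finset.union_sdiff_of_subset hFG
  have hFc : IsRkCyclic (rk (face (argmin 𝓑 (cost v x)) F)) F := isRkCyclic_face hx hg hF
  have hgy : Good (argmin 𝓑 (cost v (shift x F s))) G := by
    rw [hsI]; exact good_face hx hg hF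
  have hset : ((Q.filter fun q => cyclicPart (rk (argmin 𝓑 (cost v x)))
      (G \ minset (u q) x (G \ Fl q)) = F).filter
        (fun q => ∃ s, T s ∧ IsCrossing G F (u q) x (Fl q) s)).filter (fun q => cr q = s)
      = Q.filter fun q => cyclicPart (rk (argmin 𝓑 (cost v (shift x F s))))
        (G \ minset (u q) (shift x F s) (G \ Fl q)) ⊂ F := by
    ext q
    simp only [Finset.mem_filter, hsI, ← crossing_iff h hg hF hne hs0]
    constructor
    · rintro ⟨⟨⟨hq, hc⟩, s', hs', hcr'⟩, he⟩
      rw [hcr q s' hs' hcr'] at he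
      exact ⟨hq, hc, he ▸ hcr'⟩
    · rintro ⟨hq, hc, hcr'⟩
      exact ⟨⟨⟨hq, hc⟩, s, hs, hcr'⟩, hcr q s hs hcr'⟩
  rw [hset, ← Finset.sum_fiberwise_of_maps_to
    (t := (cyclicFlats (rk (argmin 𝓑 (cost v (shift x F s)))) G).filter (· ⊂ F))
    (g := fun q => cyclicPart (rk (argmin 𝓑 (cost v (shift x F s))))
        (G \ minset (u q) (shift x F s) (G \ Fl q)))]
  · refine Finset.sum_eq_zero fun F' hF' => ?_
    obtain ⟨hF', hlt⟩ := Finset.mem_filter.1 hF'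
    have hb := IH _ hgy F' hF' ?_
    · rw [Finset.filter_filter]
      have : (Q.filter fun q => cyclicPart (rk (argmin 𝓑 (cost v (shift x F s))))
          (G \ minset (u q) (shift x F s) (G \ Fl q)) ⊂ F ∧
          cyclicPart (rk (argmin 𝓑 (cost v (shift x F s))))
          (G \ minset (u q) (shift x F s) (G \ Fl q)) = F') =
          Q.filter fun q => cyclicPart (rk (argmin 𝓑 (cost v (shift x F s))))
          (G \ minset (u q) (shift x F s) (G \ Fl q)) = F' := by
        refine Finset.filter_congr fun q _ => ⟨fun h => h.2, fun h => ⟨h ▸ hlt, h⟩⟩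
      rw [this, ← hb, mobRk]
      rw [hsI] at hF' ⊢
      refine hy.isRankFn.mob_eq_zero_of_separated hFA Finset.disjoint_sdiff hFc
        (mem_cyclicFlats.1 (ha.compl_mem hx hy hg hF)).2.2 ?_ hF' hlt.2 ?_
      · rw [ha.rk_ground hx hy, rk_face_self hx.nonempty, ← ha.rk_compl hx hy hFG, add_comm]
      · intro hsub
        obtain ⟨a, ha'⟩ := hne
        exact (Finset.mem_sdiff.1 ha').2 (hlt.1 (hsub ha'))
    · rw [hsI]
      have h1 := nullity_lt_of_ssubset hy.isRankFn hFc hlt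
      have h2 := rk_face_self hx.nonempty F
      unfold nullity at h1 ⊢
      rwa [h2] at h1
  · intro q hq
    obtain ⟨hq, hlt⟩ := Finset.mem_filter.1 hq
    refine Finset.mem_filter.2 ⟨(h.argmin _).isRankFn.cyclicPart_mem Finset.sdiff_subset
      (isRkFlat_compl_minset h (hQ.good q hq)), hlt⟩

end BaseFamily

namespace BaseFamily

variable {α : Type*} [DecidableEq α] {𝓑 𝓒 𝓒₁ : Finset (Finset α)} {v : Finset α → ℝ}
  {G F : Finset α} {ι : Type*} {d : ℤ} {Q : Finset ι} {Fl : ι → Finset α} {u : ι → α → ℝ}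
  {τ : ι → ℤ}

/-- If `w` is out of sight in `F` and `F₀` does not exhaust the ground set, then it either comes
into sight in the direction `F` before time `t`, or is seen in the complement of `F` at `t`. -/
theorem exists_crossing_or {x w : α → ℝ} {F₀ : Finset α} {t : ℝ}
    (hF : F ⊆ G \ minset w x (G \ F₀)) (hD : (G \ F₀).Nonempty) :
    (∃ s, (0 < s ∧ s < t) ∧ IsCrossing G F w x F₀ s) ∨
      ∃ a ∈ G \ F, a ∈ minset w (shift x F t) (G \ F₀) := by
  obtain ⟨a, ha⟩ := minset_nonempty w x hD
  obtain ⟨haD, ham⟩ := mem_minset.1 ha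
  have haF : a ∉ F := fun h => (Finset.mem_sdiff.1 (hF h)).2 ha
  have haA : a ∈ G \ F := Finset.mem_sdiff.2 ⟨(Finset.mem_sdiff.1 haD).1, haF⟩
  by_cases hall : ∀ e ∈ F, e ∈ G \ F₀ → w a - x a ≤ w e - x e - t
  · refine Or.inr ⟨a, haA, mem_minset.2 ⟨haD, fun e he => ?_⟩⟩
    have h1 := ham e he
    simp only [shift, if_neg haF]
    split_ifs with heF
    · have := hall e heF he
      linarith
    · linarith
  · push Not at hall
    obtain ⟨e', he'F, he'D, hlt⟩ := hall
    obtain ⟨e, he, hemin⟩ := (F ∩ (G \ F₀)).exists_min_image (fun e => w e - x e)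
      ⟨e', Finset.mem_inter.2 ⟨he'F, he'D⟩⟩
    obtain ⟨heF, heD⟩ := Finset.mem_inter.1 he
    have h1 := hemin e' (Finset.mem_inter.2 ⟨he'F, he'D⟩)
    have h2 : w a - x a < w e - x e := by
      by_contra hle
      refine (Finset.mem_sdiff.1 (hF heF)).2 (mem_minset.2 ⟨heD, fun b hb => ?_⟩)
      have := ham b hb
      linarith
    refine Or.inl ⟨w e - x e - (w a - x a), ⟨by linarith, by linarith⟩,
      ⟨e, heF, mem_minset.2 ⟨heD, fun b hb => ?_⟩⟩, a, haA, mem_minset.2 ⟨haD, fun b hb => ?_⟩⟩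
    all_goals
      have h3 := ham b hb
      simp only [shift, if_pos heF, if_neg haF]
      split_ifs with hbF
      · have := hemin b (Finset.mem_inter.2 ⟨hbF, hb⟩)
        linarith
      · linarith

theorem far_iff (h : IsValuated 𝓑 v G) {x w : α → ℝ} {F₀ : Finset α} {t : ℝ} (ht : 0 < t)
    (hg : Good (argmin 𝓑 (cost v x)) G)
    (hF : F ∈ cyclicFlats (rk (argmin 𝓑 (cost v x))) G) (hne : (G \ F).Nonempty)
    (ha : IsAdjacent (argmin 𝓑 (cost v x)) (argmin 𝓑 (cost v (shift x F t))) F) :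
    (cyclicPart (rk (argmin 𝓑 (cost v x))) (G \ minset w x (G \ F₀)) = F ∧
        ¬ ∃ s, (0 < s ∧ s < t) ∧ IsCrossing G F w x F₀ s) ↔
      nullity (rk (argmin 𝓑 (cost v (shift x F t))))
        ((G \ minset w (shift x F t) (G \ F₀)) ∩ (G \ F)) = 0 := by
  have hx := h.argmin x
  have h1 := h.argmin (shift x F t)
  obtain ⟨hFG, -, hFc⟩ := mem_cyclicFlats.1 hF
  have hAc := (mem_cyclicFlats.1 (ha.compl_mem hx h1 hg hF)).2.2
  constructor
  · rintro ⟨hc, hno⟩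
    obtain ⟨hFs, hnull⟩ := (hx.isRankFn.cyclicPart_eq_iff hFc).1 hc
    rcases (G \ F₀).eq_empty_or_nonempty with hempty | hD
    · have hm : ∀ y, minset w y (G \ F₀) = ∅ := fun y => by
        rw [hempty]; exact Finset.subset_empty.1 (minset_subset _ _ _)
      rw [hm, Finset.sdiff_empty] at hnull ⊢
      rw [Finset.inter_eq_right.2 Finset.sdiff_subset]
      have := ha.nullity_add hx h1 hFG (subset_refl (G \ F))
      rw [Finset.union_sdiff_of_subset hFG] at this
      omega
    · rcases exists_crossing_or (t := t) hFs hD with hcr | hA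
      · exact absurd hcr hno
      · exact (cyclicPart_eq_iff_of_shift h hF h1 ha ht hA).1 hc
  · intro h0
    have hA : ∃ a ∈ G \ F, a ∈ minset w (shift x F t) (G \ F₀) := by
      by_contra hno
      have hsub : G \ F ⊆ G \ minset w (shift x F t) (G \ F₀) := fun a ha' =>
        Finset.mem_sdiff.2 ⟨(Finset.mem_sdiff.1 ha').1, fun h' => hno ⟨a, ha', h'⟩⟩
      rw [Finset.inter_eq_right.2 hsub] at h0
      exact absurd h0 (nullity_pos_of_isRkCyclic h1.isRankFn hAc hne).ne'
    refine ⟨(cyclicPart_eq_iff_of_shift h hF h1 ha ht hA).2 h0, ?_⟩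
    rintro ⟨s, ⟨-, hst⟩, ⟨e, heF, he⟩, -⟩
    obtain ⟨a, haA, ham⟩ := hA
    have haF := (Finset.mem_sdiff.1 haA).2
    rw [mem_minset] at he ham
    have n1 := he.2 a ham.1
    have n2 := ham.2 e he.1
    simp only [shift, if_pos heF, if_neg haF] at n1 n2
    linarith

/-- The step in which the initial family changes in the direction `F`. -/
theorem isBalanced_of_change (h : IsValuated 𝓑 v G) (hQ : IsPointSystem 𝓑 v G d Q Fl u τ)
    {x : α → ℝ} (hg : Good (argmin 𝓑 (cost v x)) G)
    (hF : F ∈ cyclicFlats (rk (argmin 𝓑 (cost v x))) G)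
    (IH : ∀ y, Good (argmin 𝓑 (cost v y)) G → ∀ F' ∈ cyclicFlats (rk (argmin 𝓑 (cost v y))) G,
      (nullity (rk (argmin 𝓑 (cost v y))) F' < nullity (rk (argmin 𝓑 (cost v x))) F ∨
        nullity (rk (argmin 𝓑 (cost v y))) F' = nullity (rk (argmin 𝓑 (cost v x))) F ∧
          F.card < F'.card) →
      IsBalanced 𝓑 v G d Q Fl u τ y F')
    (hlt : rk (argmin 𝓑 (cost v x)) F < rk 𝓑 F) : IsBalanced 𝓑 v G d Q Fl u τ x F := by
  classical
  obtain ⟨t, ht, hmid, hsub, hge, hex⟩ := exists_first_change h.nonempty v x F hlt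
  have hx := h.argmin x
  have h1 := h.argmin (shift x F t)
  have hFG := (mem_cyclicFlats.1 hF).1
  have ha : IsAdjacent (argmin 𝓑 (cost v x)) (argmin 𝓑 (cost v (shift x F t))) F :=
    ⟨hsub, fun B hB => (hge B hB).1, fun B hB => (hge B hB).2⟩
  have hne : (G \ F).Nonempty := by
    rw [Finset.sdiff_nonempty]
    intro hGF
    obtain rfl := hFG.antisymm hGF
    obtain ⟨B, hB⟩ := hx.nonempty
    rw [← hx.card_inter_ground hB, ← h.card_inter_ground (argmin_subset _ _ hB)] at hlt
    exact lt_irrefl _ hlt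
  have hg1 := ha.good hx hg hF
  have hAm := ha.compl_mem hx h1 hg hF
  have h0m := empty_mem_cyclicFlats hg1
  unfold IsBalanced
  rw [← Finset.sum_filter_add_sum_filter_not (Q.filter _)
    (fun q => ∃ s, (0 < s ∧ s < t) ∧ IsCrossing G F (u q) x (Fl q) s),
    sum_crossing_eq_zero h hQ hg hF (fun y hy F' hF' hn => IH y hy F' hF' (Or.inl hn))
      (fun s => 0 < s ∧ s < t) (fun s hs => ⟨hs.1, hmid s hs.1 hs.2⟩), zero_add,
    Finset.filter_filter, Finset.filter_congr (fun q _ => far_iff h ht hg hF hne ha)]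
  rw [mobRk_contract hx h1 hg hF ha]
  have hminor := h1.isRankFn.mob_minor (ρ := rk (argmin 𝓑 (cost v (shift x F t)))) (d := d)
    (d' := d - rk (argmin 𝓑 (cost v x)) F) hAm h0m
    (Finset.ssubset_iff_subset_ne.2 ⟨Finset.empty_subset _, hne.ne_empty.symm⟩)
    (fun S _ => by rw [h1.isRankFn.empty, Finset.empty_union, add_zero])
  rw [Finset.sdiff_empty] at hminor
  rw [mobRk, hminor]
  have hb : ∀ F' ∈ (cyclicFlats (rk (argmin 𝓑 (cost v (shift x F t)))) G).filter
      (fun F' => cyclicPart (rk (argmin 𝓑 (cost v (shift x F t)))) (F' ∩ (G \ F)) = ∅),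
      mob (cyclicFlats (rk (argmin 𝓑 (cost v (shift x F t)))) G)
        (fun S => d - rk (argmin 𝓑 (cost v (shift x F t))) S) F' =
      ∑ q ∈ Q with cyclicPart (rk (argmin 𝓑 (cost v (shift x F t))))
        (G \ minset (u q) (shift x F t) (G \ Fl q)) = F', τ q := by
    intro F' hF'
    obtain ⟨hF', hc⟩ := Finset.mem_filter.1 hF'
    rw [h1.isRankFn.cyclicPart_eq_empty_iff] at hc
    exact IH _ hg1 F' hF' (ha.potential hx h1 hg hF hex hF' hc)
  rw [Finset.sum_congr rfl hb]
  have hmaps : ∀ q ∈ Q.filter (fun q => nullity (rk (argmin 𝓑 (cost v (shift x F t))))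
        ((G \ minset (u q) (shift x F t) (G \ Fl q)) ∩ (G \ F)) = 0),
      cyclicPart (rk (argmin 𝓑 (cost v (shift x F t))))
        (G \ minset (u q) (shift x F t) (G \ Fl q)) ∈
      (cyclicFlats (rk (argmin 𝓑 (cost v (shift x F t)))) G).filter
      (fun F' => cyclicPart (rk (argmin 𝓑 (cost v (shift x F t)))) (F' ∩ (G \ F)) = ∅) := by
    intro q hq
    obtain ⟨hq, hn⟩ := Finset.mem_filter.1 hq
    refine Finset.mem_filter.2 ⟨h1.isRankFn.cyclicPart_mem Finset.sdiff_subset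
      (isRkFlat_compl_minset h (hQ.good q hq)), ?_⟩
    rwa [h1.isRankFn.cyclicPart_eq_empty_iff, h1.isRankFn.nullity_cyclicPart_inter_eq_zero]
  rw [← Finset.sum_fiberwise_of_maps_to hmaps]
  refine Finset.sum_congr rfl fun F' hF' => ?_
  rw [Finset.filter_filter]
  refine Finset.sum_congr (Finset.filter_congr fun q _ => ⟨fun hq => ⟨?_, hq⟩, fun hq => hq.2⟩)
    fun _ _ => rfl
  have hc := (Finset.mem_filter.1 hF').2
  rwa [← hq, h1.isRankFn.cyclicPart_eq_empty_iff,
    h1.isRankFn.nullity_cyclicPart_inter_eq_zero] at hc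

theorem argmin_face_eq (h𝓑 : 𝓑.Nonempty) {x : α → ℝ}
    (hk : rk (argmin 𝓑 (cost v x)) F = rk 𝓑 F) :
    argmin (face 𝓑 F) (cost v x) = face (argmin 𝓑 (cost v x)) F := by
  ext B
  simp only [mem_argmin, mem_face, hk]
  constructor
  · rintro ⟨⟨hB, hBk⟩, hm⟩
    obtain ⟨B₀, hB₀⟩ := face_nonempty (argmin_nonempty h𝓑 (cost v x)) F
    obtain ⟨hB₀m, hB₀k⟩ := mem_face.1 hB₀
    obtain ⟨hB₀𝓑, hB₀min⟩ := mem_argmin.1 hB₀m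
    exact ⟨⟨hB, fun B' hB' => (hm B₀ ⟨hB₀𝓑, hk ▸ hB₀k⟩).trans (hB₀min B' hB')⟩, hBk⟩
  · rintro ⟨⟨hB, hm⟩, hBk⟩
    exact ⟨⟨hB, hBk⟩, fun B' hB' => hm B' hB'.1⟩

theorem rk_argmin_face_congr (h : IsValuated 𝓑 v G) {x w : α → ℝ} {c : ℝ}
    (hw : ∀ e ∈ G \ F, w e = x e + c) {S : Finset α} (hS : S ⊆ G \ F) :
    rk (argmin (face 𝓑 F) (cost v w)) S = rk (argmin (face 𝓑 F) (cost v x)) S := by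
  have hin : ∀ B : Finset α, B ∩ S = (B \ F) ∩ S := fun B => by
    ext e
    have := @hS e
    simp only [Finset.mem_inter, Finset.mem_sdiff] at *
    tauto
  have key : ∀ (x w : α → ℝ) (c : ℝ), (∀ e ∈ G \ F, w e = x e + c) →
      rk (argmin (face 𝓑 F) (cost v x)) S ≤ rk (argmin (face 𝓑 F) (cost v w)) S := by
    intro x w c hw
    refine rk_le fun B hB => ?_
    obtain ⟨B', hB', he⟩ := h.exists_argmin_face_of_eq
      (fun e he heF => hw e (Finset.mem_sdiff.2 ⟨he, heF⟩)) hB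
    rw [hin, ← he, ← hin]
    exact card_le_rk hB' S
  exact le_antisymm (key w x (-c) fun e he => by rw [hw e he]; ring) (key x w c hw)

theorem mobRk_congr {A : Finset α} (hr : ∀ S ⊆ A, rk 𝓒 S = rk 𝓒₁ S)
    (h0 : ∅ ∈ cyclicFlats (rk 𝓒) A) :
    mobRk 𝓒 A d ∅ = mobRk 𝓒₁ A d ∅ := by
  rw [mobRk, mobRk, ← cyclicFlats_congr hr]
  exact mob_congr (fun F hF => by rw [hr F (mem_cyclicFlats.1 hF).1]) ∅ h0

theorem card_inter_compl_argmin_face (h : IsValuated 𝓑 v G) (hFG : F ⊆ G) (x : α → ℝ)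
    {B : Finset α} (hB : B ∈ argmin (face 𝓑 F) (cost v x)) :
    (B ∩ (G \ F)).card = rk 𝓑 G - rk 𝓑 F := by
  have hB' := argmin_subset _ _ hB
  have h1 := card_inter_sdiff (B := B) hFG
  rw [h.card_inter_ground (face_subset _ _ hB'), (mem_face.1 hB').2] at h1
  omega

/-- A point whose far side is independent at `x` coincides with `x`. -/
theorem minset_eq_of_independent (h : IsValuated 𝓑 v G) (hFG : F ⊆ G) {x w : α → ℝ}
    (hw : Good (argmin (face 𝓑 F) (cost v w)) (G \ F))
    (hn : nullity (rk (argmin (face 𝓑 F) (cost v x))) ((G \ F) \ minset w x (G \ F)) = 0) :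
    minset w x (G \ F) = G \ F := by
  set S := minset w x (G \ F) with hS
  have hSA : S ⊆ G \ F := minset_subset _ _ _
  obtain ⟨B, hB, hBW⟩ := exists_card_eq_rk (((h.face F).argmin x).nonempty) ((G \ F) \ S)
  have hWB : (B ∩ ((G \ F) \ S)).card = ((G \ F) \ S).card := by
    unfold nullity at hn
    omega
  refine hSA.antisymm fun e he => ?_
  by_contra heS
  obtain ⟨X, hX, heX⟩ := (hw e he).2
  have hle := card_inter_minset_le h hX _ B hB rfl
  rw [← hS] at hle
  have c1 := card_inter_sdiff (B := B) hSA
  have c2 := card_inter_sdiff (B := X) hSA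
  rw [card_inter_compl_argmin_face h hFG x hB] at c1
  rw [card_inter_compl_argmin_face h hFG w hX] at c2
  have hXW : X ∩ ((G \ F) \ S) = (G \ F) \ S :=
    Finset.eq_of_subset_of_card_le Finset.inter_subset_right (by omega)
  have : e ∈ X ∩ ((G \ F) \ S) := by rw [hXW]; exact Finset.mem_sdiff.2 ⟨he, heS⟩
  exact heX (Finset.mem_inter.1 this).1

theorem const_of_minset_eq {D : Finset α} {x w : α → ℝ} (h : minset w x D = D) :
    ∃ c, ∀ e ∈ D, w e = x e + c := by
  rcases D.eq_empty_or_nonempty with rfl | ⟨a, ha⟩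
  · exact ⟨0, by simp⟩
  · refine ⟨w a - x a, fun e he => ?_⟩
    have h1 := (mem_minset.1 (h.symm ▸ ha)).2 e he
    have h2 := (mem_minset.1 (h.symm ▸ he)).2 a ha
    linarith

/-- A connected initial family determines its point. -/
theorem minset_eq_of_mobRk_ne_zero (h : IsValuated 𝓑 v G) (hFG : F ⊆ G) {x w : α → ℝ}
    (hg : Good (argmin (face 𝓑 F) (cost v x)) (G \ F))
    (hr : ∀ S ⊆ G \ F, rk (argmin (face 𝓑 F) (cost v w)) S
      = rk (argmin (face 𝓑 F) (cost v x)) S)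
    (hne : mobRk (argmin (face 𝓑 F) (cost v x)) (G \ F) d ∅ ≠ 0) :
    minset w x (G \ F) = G \ F := by
  set S := minset w x (G \ F) with hS
  have hSA : S ⊆ G \ F := minset_subset _ _ _
  by_contra hneq
  obtain ⟨b, hb, hbS⟩ := Finset.exists_of_ssubset (Finset.ssubset_iff_subset_ne.2 ⟨hSA, hneq⟩)
  refine hne (mob_eq_zero_of_const ((h.face F).argmin x)
    (fun B hB => card_inter_compl_argmin_face h hFG x hB) hg hSA
    (n := rk (argmin (face 𝓑 F) (cost v x)) S) (fun B hB => ?_) (minset_nonempty w x ⟨b, hb⟩)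
    ⟨b, Finset.mem_sdiff.2 ⟨hb, hbS⟩⟩)
  refine le_antisymm (card_le_rk hB S) ?_
  rw [← hr S hSA]
  exact rk_le fun X hX => card_inter_minset_le h hX _ B hB rfl

/-- The step in which the initial family does not change in the direction `F`. -/
theorem isBalanced_of_no_change (h : IsValuated 𝓑 v G) (hQ : IsPointSystem 𝓑 v G d Q Fl u τ)
    {x : α → ℝ} (hg : Good (argmin 𝓑 (cost v x)) G)
    (hF : F ∈ cyclicFlats (rk (argmin 𝓑 (cost v x))) G)
    (IH : ∀ y, Good (argmin 𝓑 (cost v y)) G → ∀ F' ∈ cyclicFlats (rk (argmin 𝓑 (cost v y))) G,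
      nullity (rk (argmin 𝓑 (cost v y))) F' < nullity (rk (argmin 𝓑 (cost v x))) F →
      IsBalanced 𝓑 v G d Q Fl u τ y F')
    (hk : rk (argmin 𝓑 (cost v x)) F = rk 𝓑 F) : IsBalanced 𝓑 v G d Q Fl u τ x F := by
  classical
  have hx := h.argmin x
  have hxF := hx.face F
  obtain ⟨hFG, hFf, hFc⟩ := mem_cyclicFlats.1 hF
  have ha := isAdjacent_face (argmin 𝓑 (cost v x)) F
  have hface := argmin_face_eq h.nonempty hk
  have hmono := fun S => rk_mono_family (argmin_subset 𝓑 (cost v x)) S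
  have hFV : F ∈ cyclicFlats (rk 𝓑) G := by
    refine mem_cyclicFlats.2 ⟨hFG, fun e he heF => ?_, fun e he => ?_⟩
    · rw [← hk]
      exact (hFf e he heF).trans_le (hmono _)
    · refine le_antisymm (h.isRankFn.mono _ _ (Finset.erase_subset _ _)) ?_
      rw [← hk, ← hFc e he]
      exact hmono _
  have hmid : ∀ s, 0 < s → 0 < s ∧
      argmin 𝓑 (cost v (shift x F s)) = face (argmin 𝓑 (cost v x)) F := fun s hs =>
    ⟨hs, argmin_shift h.nonempty hs fun B₀ _ B hB hlt => by
      rw [hk] at hlt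
      exact absurd (card_le_rk hB F) (not_le.2 hlt)⟩
  have hgF : Good (argmin (face 𝓑 F) (cost v x)) (G \ F) := by
    rw [hface]
    exact (good_face hx hg hF).mono subset_rfl Finset.sdiff_subset
  have h0 : ∅ ∈ cyclicFlats (rk (argmin (face 𝓑 F) (cost v x))) (G \ F) :=
    empty_mem_cyclicFlats hgF
  have hmult : ∀ q ∈ Q, Fl q = F → (∀ S ⊆ G \ F, rk (argmin (face 𝓑 F) (cost v (u q))) S
      = rk (argmin (face 𝓑 F) (cost v x)) S) →
      τ q = mobRk (argmin 𝓑 (cost v x)) G d F := by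
    rintro q hq rfl hr
    rw [hQ.mult q hq, mobRk_contract hx hxF hg hF ha, ← hface, hk]
    exact (mobRk_congr (fun S hS => (hr S hS).symm) h0).symm
  have hfar : ∀ q ∈ Q, ((cyclicPart (rk (argmin 𝓑 (cost v x)))
      (G \ minset (u q) x (G \ Fl q)) = F ∧
      ¬ ∃ s, 0 < s ∧ IsCrossing G F (u q) x (Fl q) s) ↔
      Fl q = F ∧ minset (u q) x (G \ F) = G \ F) := by
    intro q hq
    constructor
    · rintro ⟨hc, hno⟩
      obtain ⟨hFs, hnull⟩ := (hx.isRankFn.cyclicPart_eq_iff hFc).1 hc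
      obtain ⟨hqG, -, hqc⟩ := mem_cyclicFlats.1 (hQ.flat q hq)
      have hFsub : F ⊆ Fl q := by
        intro e heF
        by_contra heq
        have heD : e ∈ G \ Fl q := Finset.mem_sdiff.2 ⟨hFG heF, heq⟩
        rcases exists_crossing_or (t := |u q e - x e| + |(u q) e - x e| + 1 +
          ∑ b ∈ G, |u q b - x b|) hFs ⟨e, heD⟩ with ⟨s, hs, hcr⟩ | ⟨a, haA, ham⟩
        · exact hno ⟨s, hs.1, hcr⟩
        · obtain ⟨haG, haF⟩ := Finset.mem_sdiff.1 haA
          have h1 := (mem_minset.1 ham).2 e heD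
          simp only [shift, if_pos heF, if_neg haF] at h1
          have h2 : |u q a - x a| ≤ ∑ b ∈ G, |u q b - x b| :=
            Finset.single_le_sum (f := fun b => |u q b - x b|) (fun b _ => abs_nonneg _) haG
          have h3 := le_abs_self (u q e - x e)
          have h4 := neg_abs_le (u q a - x a)
          have h5 := abs_nonneg (u q e - x e)
          linarith
      have hqF : Fl q = F := by
        by_contra hne
        have hss : F ⊂ Fl q := Finset.ssubset_iff_subset_ne.2 ⟨hFsub, fun h => hne h.symm⟩
        have n1 := nullity_lt_of_ssubset h.isRankFn hqc hss
        have hsub : Fl q ⊆ G \ minset (u q) x (G \ Fl q) := fun e he =>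
          Finset.mem_sdiff.2 ⟨hqG he, fun h' =>
            (Finset.mem_sdiff.1 (minset_subset _ _ _ h')).2 he⟩
        have n2 := hx.isRankFn.nullity_mono hsub
        have n3 := hmono (Fl q)
        unfold nullity at *
        omega
      refine ⟨hqF, ?_⟩
      have hgq := hQ.good q hq
      rw [hqF] at hnull hgq
      refine minset_eq_of_independent h hFG hgq ?_
      have e1 : G \ minset (u q) x (G \ F) = F ∪ ((G \ F) \ minset (u q) x (G \ F)) := by
        have := minset_subset (u q) x (G \ F)
        ext e
        have := @this e
        have := @hFG e
        simp only [Finset.mem_union, Finset.mem_sdiff] at *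
        tauto
      rw [e1, ha.nullity_add hx hxF hFG Finset.sdiff_subset] at hnull
      rw [hface]
      omega
    · rintro ⟨rfl, hm⟩
      rw [hm, Finset.sdiff_sdiff_eq_self hFG]
      refine ⟨hx.isRankFn.cyclicPart_of_cyclic hFc, ?_⟩
      rintro ⟨s, -, ⟨e, he, he'⟩, -⟩
      exact (Finset.mem_sdiff.1 (minset_subset _ _ _ he')).2 he
  unfold IsBalanced
  rw [← Finset.sum_filter_add_sum_filter_not (Q.filter _)
    (fun q => ∃ s, 0 < s ∧ IsCrossing G F (u q) x (Fl q) s),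
    sum_crossing_eq_zero h hQ hg hF IH (fun s => 0 < s) hmid, zero_add, Finset.filter_filter,
    Finset.filter_congr hfar]
  by_cases hex : ∃ q ∈ Q, Fl q = F ∧ minset (u q) x (G \ F) = G \ F
  · obtain ⟨q, hq, hqF, hqm⟩ := hex
    obtain ⟨c, hc⟩ := const_of_minset_eq hqm
    rw [Finset.sum_eq_single_of_mem q (Finset.mem_filter.2 ⟨hq, hqF, hqm⟩)]
    · exact (hmult q hq hqF fun S hS => rk_argmin_face_congr h hc hS).symm
    · intro q' hq' hne
      obtain ⟨hq', hqF', hqm'⟩ := Finset.mem_filter.1 hq'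
      obtain ⟨c', hc'⟩ := const_of_minset_eq hqm'
      refine absurd (hQ.unique q' hq' q hq (hqF'.trans hqF.symm) ⟨c' - c, fun e he => ?_⟩) hne
      rw [hqF'] at he
      rw [hc e he, hc' e he]
      ring
  · rw [Finset.filter_false_of_mem fun q hq hq' => hex ⟨q, hq, hq'⟩, Finset.sum_empty]
    obtain ⟨q, hq, hqF, hr⟩ := hQ.exists_point F hFV x hgF
    by_contra hne
    refine hex ⟨q, hq, hqF, minset_eq_of_mobRk_ne_zero h hFG hgF hr
      (d := d - rk (argmin 𝓑 (cost v x)) F) ?_⟩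
    rw [mobRk_contract hx hxF hg hF ha, ← hface] at hne
    exact hne

/-- Every cyclic flat at every point is balanced. -/
theorem isBalanced (h : IsValuated 𝓑 v G) (hQ : IsPointSystem 𝓑 v G d Q Fl u τ) (n : ℕ) :
    ∀ m : ℕ, ∀ x, Good (argmin 𝓑 (cost v x)) G →
      ∀ F ∈ cyclicFlats (rk (argmin 𝓑 (cost v x))) G,
      nullity (rk (argmin 𝓑 (cost v x))) F = n → (G \ F).card = m →
      IsBalanced 𝓑 v G d Q Fl u τ x F := by
  induction n using Nat.strong_induction_on with
  | _ n ihn =>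
    intro m
    induction m using Nat.strong_induction_on with
    | _ m ihm =>
      intro x hg F hF hn hm
      have hlt : ∀ y, Good (argmin 𝓑 (cost v y)) G →
          ∀ F' ∈ cyclicFlats (rk (argmin 𝓑 (cost v y))) G,
          nullity (rk (argmin 𝓑 (cost v y))) F' < nullity (rk (argmin 𝓑 (cost v x))) F →
          IsBalanced 𝓑 v G d Q Fl u τ y F' := by
        intro y hy F' hF' hlt
        have h0 := (h.argmin y).isRankFn.nullity_nonneg F'
        obtain ⟨k, hk⟩ := Int.eq_ofNat_of_zero_le h0
        exact ihn k (by omega) _ y hy F' hF' hk rfl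
      rcases (rk_mono_family (argmin_subset 𝓑 (cost v x)) F).lt_or_eq with hk | hk
      · refine isBalanced_of_change h hQ hg hF (fun y hy F' hF' hor => ?_) hk
        rcases hor with hor | ⟨heq, hcard⟩
        · exact hlt y hy F' hF' hor
        · have c1 := Finset.card_sdiff_add_card_eq_card (mem_cyclicFlats.1 hF).1
          have c2 := Finset.card_sdiff_add_card_eq_card (mem_cyclicFlats.1 hF').1
          exact ihm _ (by omega) y hy F' hF' (heq.trans hn) rfl
      · exact isBalanced_of_no_change h hQ hg hF hlt hk

/-- The multiplicities of a point system add up to the rank. -/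
theorem sum_multiplicity (h : IsValuated 𝓑 v G) (hQ : IsPointSystem 𝓑 v G d Q Fl u τ)
    {x : α → ℝ} (hg : Good (argmin 𝓑 (cost v x)) G) : ∑ q ∈ Q, τ q = d := by
  have h0 := empty_mem_cyclicFlats hg
  have h1 := sum_mob (cyclicFlats (rk (argmin 𝓑 (cost v x))) G)
    (fun S => d - rk (argmin 𝓑 (cost v x)) S) h0
  rw [(h.argmin x).isRankFn.empty, Finset.filter_true_of_mem fun _ _ => Finset.empty_subset _] at h1
  simp only [Nat.cast_zero, sub_zero] at h1
  rw [← h1, ← Finset.sum_fiberwise_of_maps_to (t := cyclicFlats (rk (argmin 𝓑 (cost v x))) G)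
    (g := fun q => cyclicPart (rk (argmin 𝓑 (cost v x))) (G \ minset (u q) x (G \ Fl q)))
    (fun q hq => (h.argmin x).isRankFn.cyclicPart_mem Finset.sdiff_subset
      (isRkFlat_compl_minset h (hQ.good q hq)))]
  refine Finset.sum_congr rfl fun F hF => ?_
  obtain ⟨k, hk⟩ := Int.eq_ofNat_of_zero_le ((h.argmin x).isRankFn.nullity_nonneg F)
  exact (isBalanced h hQ k _ x hg F hF hk rfl).symm

end BaseFamily

namespace BaseFamily

variable {α : Type*} [DecidableEq α] {𝓑 𝓒 𝓒₁ : Finset (Finset α)} {v : Finset α → ℝ}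
  {G F : Finset α} {d : ℤ}

/-- A coordinate vector with given values outside `F` for which the set of initial bases of the
face of `F` has maximal size. -/
theorem exists_maximal (𝓑 : Finset (Finset α)) (v : Finset α → ℝ) (P : (α → ℝ) → Prop)
    {u : α → ℝ} (hu : P u) :
    ∃ y, P y ∧ ∀ y', P y' → (argmin 𝓑 (cost v y')).card ≤ (argmin 𝓑 (cost v y)).card := by
  obtain ⟨y, hy, hmin⟩ := (measure fun y => 𝓑.card - (argmin 𝓑 (cost v y)).card).wf.has_min
    {y | P y} ⟨u, hu⟩
  refine ⟨y, hy, fun y' hy' => ?_⟩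
  have h1 : ¬ 𝓑.card - (argmin 𝓑 (cost v y')).card < 𝓑.card - (argmin 𝓑 (cost v y)).card :=
    hmin y' hy'
  have h2 := Finset.card_le_card (argmin_subset 𝓑 (cost v y'))
  omega

theorem card_argmin_lt (hne : 𝓑.Nonempty) {x : α → ℝ} {n : ℕ}
    (hn : ∀ B ∈ argmin 𝓑 (cost v x), (B ∩ F).card = n) (hlt : n < rk 𝓑 F) :
    ∃ t, (argmin 𝓑 (cost v x)).card < (argmin 𝓑 (cost v (shift x F t))).card := by
  have hk : rk (argmin 𝓑 (cost v x)) F = n := rk_eq_of_const (argmin_nonempty hne _) hn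
  obtain ⟨t, -, -, hsub, -, B, hB, hBk⟩ := exists_first_change hne v x F (by rw [hk]; exact hlt)
  refine ⟨t, Finset.card_lt_card ((Finset.ssubset_iff_of_subset fun X hX =>
    hsub (mem_face.2 ⟨hX, by rw [hk, hn X hX]⟩)).2 ⟨B, hB, fun h => ?_⟩)⟩
  rw [hk, hn B h] at hBk
  exact lt_irrefl _ hBk

theorem exists_good_face (h : IsValuated 𝓑 v G) (hg : Good 𝓑 G) (hF : F ∈ cyclicFlats (rk 𝓑) G)
    {u : α → ℝ} (hu : Good (argmin (face 𝓑 F) (cost v u)) (G \ F)) :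
    ∃ y, (∀ e, e ∉ F → y e = u e) ∧ Good (argmin (face 𝓑 F) (cost v y)) G := by
  have hne := (h.face F).nonempty
  obtain ⟨y, hy, hmax⟩ := exists_maximal (face 𝓑 F) v (fun y => ∀ e, e ∉ F → y e = u e)
    (u := u) fun _ _ => rfl
  have hgf := good_face h hg hF
  have hrk : ∀ D ⊆ F, ∀ n, (∀ B ∈ argmin (face 𝓑 F) (cost v y), (B ∩ D).card = n) →
      rk (face 𝓑 F) D ≤ n := by
    intro D hD n hn
    by_contra hlt
    obtain ⟨t, ht⟩ := card_argmin_lt hne hn (not_le.1 hlt)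
    refine absurd (hmax (shift y D t) fun e he => ?_) (not_le.2 ht)
    rw [shift, if_neg fun h => he (hD h), add_zero, hy e he]
  refine ⟨y, hy, fun e heG => ?_⟩
  obtain ⟨⟨B₁, hB₁, h1⟩, B₂, hB₂, h2⟩ := hgf e heG
  by_cases heF : e ∈ F
  · constructor
    · by_contra hno
      push Not at hno
      have := hrk {e} (Finset.singleton_subset_iff.2 heF) 0 fun B hB => by simp [hno B hB]
      have h3 := card_le_rk hB₁ {e}
      rw [Finset.inter_singleton_of_mem h1, Finset.card_singleton] at h3
      omega
    · by_contra hno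
      push Not at hno
      have := hrk (F.erase e) (Finset.erase_subset _ _) (rk 𝓑 F - 1) fun B hB => by
        have := card_inter_erase_of_mem (hno B hB) heF
        rw [(mem_face.1 (argmin_subset _ _ hB)).2] at this
        omega
      have h3 := card_le_rk hB₂ (F.erase e)
      rw [inter_erase_of_notMem h2, (mem_face.1 hB₂).2] at h3
      have h4 := card_inter_erase_of_mem h1 heF
      rw [(mem_face.1 hB₁).2] at h4
      omega
  · obtain ⟨⟨B₁, hB₁, h1⟩, B₂, hB₂, h2⟩ := hu e (Finset.mem_sdiff.2 ⟨heG, heF⟩)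
    have hyu : ∀ e ∈ G, e ∉ F → y e = u e + 0 := fun e _ he => by rw [hy e he, add_zero]
    obtain ⟨B₁', hB₁', e1⟩ := h.exists_argmin_face_of_eq hyu hB₁
    obtain ⟨B₂', hB₂', e2⟩ := h.exists_argmin_face_of_eq hyu hB₂
    have hm : ∀ {X Y : Finset α}, X \ F = Y \ F → (e ∈ X ↔ e ∈ Y) := fun {X Y} hXY => by
      have := congrArg (e ∈ ·) hXY
      simpa [heF] using this
    exact ⟨⟨B₁', hB₁', (hm e1).2 h1⟩, B₂', hB₂', fun h => h2 ((hm e2).1 h)⟩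

theorem exists_argmin_eq_argmin_face (hne : 𝓑.Nonempty) (v : Finset α → ℝ) (y : α → ℝ)
    (F : Finset α) :
    ∃ s, argmin 𝓑 (cost v (shift y F s)) = argmin (face 𝓑 F) (cost v y) := by
  obtain ⟨B₀, hB₀⟩ := argmin_nonempty (face_nonempty hne F) (cost v y)
  obtain ⟨hB₀f, hB₀m⟩ := mem_argmin.1 hB₀
  obtain ⟨hB₀𝓑, hB₀k⟩ := mem_face.1 hB₀f
  set s : ℝ := 1 + ∑ B ∈ 𝓑, |cost v y B₀ - cost v y B| with hs
  have hpos : 0 < s := by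
    have : 0 ≤ ∑ B ∈ 𝓑, |cost v y B₀ - cost v y B| := Finset.sum_nonneg fun _ _ => abs_nonneg _
    linarith
  have hlt : ∀ B ∈ 𝓑, (B ∩ F).card < rk 𝓑 F →
      cost v (shift y F s) B₀ < cost v (shift y F s) B := by
    intro B hB hlt
    have h1 : |cost v y B₀ - cost v y B| ≤ ∑ B ∈ 𝓑, |cost v y B₀ - cost v y B| :=
      Finset.single_le_sum (f := fun B => |cost v y B₀ - cost v y B|)
        (fun _ _ => abs_nonneg _) hB
    have h2 := le_abs_self (cost v y B₀ - cost v y B)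
    have h3 : ((B ∩ F).card : ℝ) + 1 ≤ rk 𝓑 F := by exact_mod_cast hlt
    have h4 := mul_le_mul_of_nonneg_left h3 hpos.le
    rw [cost_shift, cost_shift, hB₀k]
    linarith
  refine ⟨s, ?_⟩
  ext B
  rw [mem_argmin, mem_argmin]
  constructor
  · rintro ⟨hB, hm⟩
    have hBk : (B ∩ F).card = rk 𝓑 F := by
      by_contra hne
      exact absurd (hm B₀ hB₀𝓑) (not_le.2 (hlt B hB (lt_of_le_of_ne (card_le_rk hB F) hne)))
    refine ⟨mem_face.2 ⟨hB, hBk⟩, fun B' hB' => ?_⟩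
    have := hm B' (mem_face.1 hB').1
    rw [cost_shift, cost_shift, hBk, (mem_face.1 hB').2] at this
    linarith
  · rintro ⟨hB, hm⟩
    obtain ⟨hB𝓑, hBk⟩ := mem_face.1 hB
    refine ⟨hB𝓑, fun B' hB' => ?_⟩
    by_cases hk : (B' ∩ F).card = rk 𝓑 F
    · have := hm B' (mem_face.2 ⟨hB', hk⟩)
      rw [cost_shift, cost_shift, hBk, hk]
      linarith
    · have h1 := hlt B' hB' (lt_of_le_of_ne (card_le_rk hB' F) hk)
      have h2 := hm B₀ hB₀f
      rw [cost_shift, hB₀k] at h1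
      rw [cost_shift, hBk]
      linarith

/-- Every initial family of a face is visible in an initial family without loops and coloops. -/
theorem exists_good_point (h : IsValuated 𝓑 v G) (hg : Good 𝓑 G)
    (hF : F ∈ cyclicFlats (rk 𝓑) G) {u : α → ℝ}
    (hu : Good (argmin (face 𝓑 F) (cost v u)) (G \ F)) :
    ∃ y, Good (argmin 𝓑 (cost v y)) G ∧ argmin 𝓑 (cost v y) ⊆ face 𝓑 F ∧
      ∀ S ⊆ G \ F, rk (argmin 𝓑 (cost v y)) S = rk (argmin (face 𝓑 F) (cost v u)) S := by
  obtain ⟨y, hy, hgy⟩ := exists_good_face h hg hF hu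
  obtain ⟨s, hs⟩ := exists_argmin_eq_argmin_face h.nonempty v y F
  refine ⟨shift y F s, hs.symm ▸ hgy, hs.symm ▸ argmin_subset _ _, fun S hS => ?_⟩
  rw [hs]
  exact rk_argmin_face_congr h (c := 0)
    (fun e he => by rw [hy e (Finset.mem_sdiff.1 he).2, add_zero]) hS

/-- A base of maximal weight that meets `X` in too small a set can be improved. -/
theorem exists_augment (h : IsValuated 𝓒 v G) {w : α → ℝ} {B X : Finset α} (hB : B ∈ 𝓒)
    (hmax : ∀ B' ∈ 𝓒, ∑ i ∈ B', w i ≤ ∑ i ∈ B, w i) (hlt : (B ∩ X).card < rk 𝓒 X) :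
    ∃ e ∈ X \ B, ∃ b ∈ B \ X, b ∈ G ∧ w e ≤ w b ∧ insert e (B.erase b) ∈ 𝓒 := by
  obtain ⟨Z, hZ, hmin⟩ := Finset.exists_min_image (face 𝓒 X) (fun Z => (B \ Z).card)
    (face_nonempty h.nonempty X)
  obtain ⟨hZ𝓒, hZk⟩ := mem_face.1 hZ
  have hns : ¬ Z ∩ X ⊆ B ∩ X := fun hs => by
    have := Finset.card_le_card hs
    omega
  obtain ⟨e, he, he'⟩ := Finset.not_subset.1 hns
  obtain ⟨heZ, heX⟩ := Finset.mem_inter.1 he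
  have heB : e ∉ B := fun h' => he' (Finset.mem_inter.2 ⟨h', heX⟩)
  obtain ⟨b, hb, h1, h2, -⟩ := h.exchange Z hZ𝓒 B hB e (Finset.mem_sdiff.2 ⟨heZ, heB⟩)
  obtain ⟨hbB, hbZ⟩ := Finset.mem_sdiff.1 hb
  have hw : w e ≤ w b := by
    have s1 := sum_exchange hbB heB w
    have := hmax _ h2
    linarith
  refine ⟨e, Finset.mem_sdiff.2 ⟨heX, heB⟩, b, Finset.mem_sdiff.2 ⟨hbB, fun hbX => ?_⟩,
    h.mem_of_mem_sdiff hB hZ𝓒 hb, hw, h2⟩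
  have c1 := card_inter_exchange heZ hbZ X
  rw [if_pos heX, if_pos hbX] at c1
  have := hmin _ (mem_face.2 ⟨h1, by omega⟩)
  exact absurd (card_sdiff_exchange_lt heB hbB hbZ) (not_lt.2 this)

theorem const_inter_union (h : IsValuated 𝓒 v G) {S T : Finset α}
    (hS : ∀ B ∈ 𝓒, (B ∩ S).card = rk 𝓒 S) (hT : ∀ B ∈ 𝓒, (B ∩ T).card = rk 𝓒 T) :
    ∀ B ∈ 𝓒, (B ∩ (S ∩ T)).card = rk 𝓒 (S ∩ T) ∧ (B ∩ (S ∪ T)).card = rk 𝓒 (S ∪ T) := by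
  intro B hB
  have h1 := h.isRankFn.submod S T
  have h2 := card_le_rk hB (S ∩ T)
  have h3 := card_le_rk hB (S ∪ T)
  have h4 := Finset.card_union_add_card_inter (B ∩ S) (B ∩ T)
  rw [← Finset.inter_union_distrib_left, ← Finset.inter_inter_distrib_left, hS B hB, hT B hB] at h4
  omega

theorem mem_cyclicFlats_of_const (hsub : 𝓒₁ ⊆ 𝓒) (hg : Good 𝓒₁ G) {H : Finset α} (hH : H ⊆ G)
    (hc : ∀ B ∈ 𝓒₁, (B ∩ H).card = rk 𝓒 H) : H ∈ cyclicFlats (rk 𝓒) G := by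
  refine mem_cyclicFlats.2 ⟨hH, fun e heG he => ?_, fun e he => le_antisymm ?_ ?_⟩
  · obtain ⟨B, hB, heB⟩ := (hg e heG).1
    have := card_le_rk (hsub hB) (insert e H)
    rw [card_inter_insert heB he, hc B hB] at this
    omega
  · exact rk_le fun B hB => (Finset.card_le_card (Finset.inter_subset_inter_left
      (Finset.erase_subset _ _))).trans (card_le_rk hB H)
  · obtain ⟨B, hB, heB⟩ := (hg e (hH he)).2
    rw [← hc B hB, ← inter_erase_of_notMem heB]
    exact card_le_rk (hsub hB) _

/-- If the multiplicities of the cyclic flats of the facets are nonnegative then so are the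
multiplicities of all initial families of faces. -/
theorem mobRk_nonneg (h : IsValuated 𝓑 v G) (hg : Good 𝓑 G) (hF : F ∈ cyclicFlats (rk 𝓑) G)
    {u : α → ℝ} (hu : Good (argmin (face 𝓑 F) (cost v u)) (G \ F)) {d' : ℤ} (hd : 0 ≤ d')
    (hT : ∀ y, Good (argmin 𝓑 (cost v y)) G →
      (∀ y', argmin 𝓑 (cost v y) ⊆ argmin 𝓑 (cost v y') →
        argmin 𝓑 (cost v y') ⊆ argmin 𝓑 (cost v y)) →
      ∀ F' ∈ cyclicFlats (rk (argmin 𝓑 (cost v y))) G, 0 ≤ mobRk (argmin 𝓑 (cost v y)) G d F') :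
    0 ≤ mobRk (argmin (face 𝓑 F) (cost v u)) (G \ F) d' ∅ := by
  obtain ⟨y, hgy, hyF, hyr⟩ := exists_good_point h hg hF hu
  obtain ⟨z, hyz, hzmax⟩ := exists_maximal 𝓑 v
    (fun z => argmin 𝓑 (cost v y) ⊆ argmin 𝓑 (cost v z)) (u := y) subset_rfl
  have hFG := (mem_cyclicFlats.1 hF).1
  have hy := h.argmin y
  have hz := h.argmin z
  have hgz := hgy.mono hyz subset_rfl
  rw [mobRk_congr (fun S hS => (hyr S hS).symm) (empty_mem_cyclicFlats hu)]
  by_cases h0 : mobRk (argmin 𝓑 (cost v y)) (G \ F) d' ∅ = 0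
  · exact h0.ge
  rcases (G \ F).eq_empty_or_nonempty with hA | ⟨a₀, ha₀⟩
  · have hm : cyclicFlats (rk (argmin 𝓑 (cost v y))) ∅ = {∅} := by
      ext S
      rw [Finset.mem_singleton]
      refine ⟨fun hS => Finset.subset_empty.1 (mem_cyclicFlats.1 hS).1, ?_⟩
      rintro rfl
      exact empty_mem_cyclicFlats fun e he => absurd he (Finset.notMem_empty e)
    have h1 := sum_mob (cyclicFlats (rk (argmin 𝓑 (cost v y))) ∅)
      (fun S => d' - rk (argmin 𝓑 (cost v y)) S) (F := ∅) (by rw [hm]; simp)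
    rw [hm] at h1
    rw [hA, mobRk, hm]
    simp only [Finset.filter_true_of_mem fun _ _ => Finset.empty_subset _, Finset.sum_singleton,
      hy.isRankFn.empty] at h1
    rw [h1]
    simpa using hd
  set w : α → ℝ := fun e => y e - z e with hw
  have hmax : ∀ B ∈ argmin 𝓑 (cost v y), ∀ B' ∈ argmin 𝓑 (cost v z),
      ∑ i ∈ B', w i ≤ ∑ i ∈ B, w i ∧
        (∑ i ∈ B, w i ≤ ∑ i ∈ B', w i → B' ∈ argmin 𝓑 (cost v y)) := by
    intro B hB B' hB'
    obtain ⟨hB𝓑, hBm⟩ := mem_argmin.1 hB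
    obtain ⟨hB'𝓑, hB'm⟩ := mem_argmin.1 hB'
    have e1 := (mem_argmin.1 (hyz hB)).2 B' hB'𝓑
    have e2 := hB'm B hB𝓑
    have e3 := hBm B' hB'𝓑
    have e4 : ∀ X : Finset α, cost v y X = cost v z X - ∑ i ∈ X, w i := fun X => by
      simp only [cost, hw, Finset.sum_sub_distrib]
      ring
    rw [e4, e4] at e3
    refine ⟨by linarith, fun hle => mem_argmin.2 ⟨hB'𝓑, fun X hX => ?_⟩⟩
    have e5 := hBm X hX
    have e6 := e4 B
    have e7 := e4 B'
    linarith
  have hlevel : ∀ T : Finset α, (∀ e ∈ T, ∀ b ∈ G, w e ≤ w b → b ∈ T) →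
      ∀ B ∈ argmin 𝓑 (cost v y), (B ∩ T).card = rk (argmin 𝓑 (cost v z)) T := by
    intro T hTup B hB
    refine le_antisymm (card_le_rk (hyz hB) T) ?_
    by_contra hlt
    obtain ⟨e, he, b, hb, hbG, hwe, -⟩ := exists_augment hz (hyz hB)
      (fun B' hB' => (hmax B hB B' hB').1) (not_le.1 hlt)
    exact (Finset.mem_sdiff.1 hb).2 (hTup e (Finset.mem_sdiff.1 he).1 b hbG hwe)
  have hconst : ∀ T : Finset α, (∀ B ∈ argmin 𝓑 (cost v y),
      (B ∩ T).card = rk (argmin 𝓑 (cost v z)) T) → ∀ B ∈ argmin 𝓑 (cost v y),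
      (B ∩ T).card = rk (argmin 𝓑 (cost v y)) T := fun T hT B hB => by
    rw [hT B hB, rk_eq_of_const hy.nonempty hT]
  have hFc : ∀ B ∈ argmin 𝓑 (cost v y), (B ∩ F).card = rk (argmin 𝓑 (cost v y)) F := by
    intro B hB
    rw [rk_eq_of_const hy.nonempty fun B hB => (mem_face.1 (hyF hB)).2, (mem_face.1 (hyF hB)).2]
  have hAc : ∀ B ∈ argmin 𝓑 (cost v y), (B ∩ (G \ F)).card
      = rk (argmin 𝓑 (cost v y)) G - rk (argmin 𝓑 (cost v y)) F := by
    intro B hB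
    have h1 := card_inter_sdiff (B := B) hFG
    rw [hy.card_inter_ground hB, hFc B hB] at h1
    omega
  obtain ⟨a, ha, hamin⟩ := Finset.exists_min_image (G \ F) w ⟨a₀, ha₀⟩
  set c := w a with hc
  set P := G.filter fun e => c < w e with hP
  set T := G.filter fun e => c ≤ w e with hTdef
  have hPc := hlevel P fun e he b hb hle => Finset.mem_filter.2
    ⟨hb, lt_of_lt_of_le (Finset.mem_filter.1 he).2 hle⟩
  have hTc := hlevel T fun e he b hb hle => Finset.mem_filter.2
    ⟨hb, le_trans (Finset.mem_filter.1 he).2 hle⟩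
  have hAT : G \ F ⊆ T := fun e he =>
    Finset.mem_filter.2 ⟨(Finset.mem_sdiff.1 he).1, hamin e he⟩
  have hPF : P ⊆ F := by
    intro e he
    by_contra heF
    refine h0 (mob_eq_zero_of_const hy (n := rk (argmin 𝓑 (cost v y)) (P ∪ F)
      - rk (argmin 𝓑 (cost v y)) F) hAc (hgy.mono subset_rfl Finset.sdiff_subset)
      (S := (P ∪ F) \ F) ?_ (fun B hB => ?_) ⟨e, by simp [he, heF]⟩ ⟨a, ?_⟩)
    · exact Finset.sdiff_subset_sdiff (Finset.union_subset (Finset.filter_subset _ _) hFG)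
        subset_rfl
    · have h1 := card_inter_sdiff (B := B) (Finset.subset_union_right (s₁ := P) (s₂ := F))
      rw [(const_inter_union hy (hconst P hPc) hFc B hB).2, hFc B hB] at h1
      omega
    · have := (Finset.mem_sdiff.1 ha).2
      simp [ha, this, hP, hc]
  set H := T \ (G \ F) with hH
  have hHT : H ⊂ T := (Finset.ssubset_iff_of_subset Finset.sdiff_subset).2
    ⟨a, hAT ha, fun h' => (Finset.mem_sdiff.1 h').2 ha⟩
  have hPH : P ⊆ H := fun e he => by
    obtain ⟨h1, h2⟩ := Finset.mem_filter.1 he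
    exact Finset.mem_sdiff.2 ⟨Finset.mem_filter.2 ⟨h1, h2.le⟩,
      fun h' => (Finset.mem_sdiff.1 h').2 (hPF he)⟩
  have hrk : ∀ X, P ⊆ X → X ⊆ T → rk (argmin 𝓑 (cost v y)) X = rk (argmin 𝓑 (cost v z)) X := by
    intro X hPX hXT
    refine le_antisymm (rk_mono_family hyz X) ?_
    obtain ⟨B, hB, hBk⟩ := exists_card_eq_rk hy.nonempty X
    by_contra hlt
    rw [← hBk] at hlt
    obtain ⟨e, he, b, hb, hbG, hwe, hmem⟩ := exists_augment hz (hyz hB)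
      (fun B' hB' => (hmax B hB B' hB').1) (not_le.1 hlt)
    obtain ⟨heX, heB⟩ := Finset.mem_sdiff.1 he
    obtain ⟨hbB, hbX⟩ := Finset.mem_sdiff.1 hb
    have hb1 : w b ≤ c := not_lt.1 fun h' => hbX (hPX (Finset.mem_filter.2 ⟨hbG, h'⟩))
    have he1 : c ≤ w e := (Finset.mem_filter.1 (hXT heX)).2
    have hs := sum_exchange hbB heB w
    have := (hmax B hB _ hmem).2 (by linarith)
    have c1 := card_inter_exchange hbB heB X
    have c2 := card_le_rk this X
    rw [if_neg hbX, if_pos heX] at c1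
    omega
  have hHF : H = T ∩ F := by
    ext e
    have : e ∈ T → e ∈ G := fun h' => (Finset.mem_filter.1 h').1
    simp only [hH, Finset.mem_sdiff, Finset.mem_inter]
    tauto
  have hHc : ∀ B ∈ argmin 𝓑 (cost v y), (B ∩ H).card = rk (argmin 𝓑 (cost v z)) H := by
    intro B hB
    rw [← hrk H hPH hHT.1, hHF]
    exact (const_inter_union hy (hconst T hTc) hFc B hB).1
  have hTA : T \ H = G \ F := Finset.sdiff_sdiff_eq_self hAT
  have hTm := mem_cyclicFlats_of_const hyz hgy (Finset.filter_subset _ _) hTc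
  have hHm := mem_cyclicFlats_of_const hyz hgy (hHT.1.trans (Finset.filter_subset _ _)) hHc
  have hρ : ∀ S ⊆ T \ H, rk (argmin 𝓑 (cost v y)) S + rk (argmin 𝓑 (cost v z)) H
      = rk (argmin 𝓑 (cost v z)) (H ∪ S) := by
    intro S hS
    have hd : Disjoint H S := Finset.disjoint_of_subset_right hS Finset.disjoint_sdiff
    rw [← hrk (H ∪ S) (hPH.trans Finset.subset_union_left)
      (Finset.union_subset hHT.1 (hS.trans Finset.sdiff_subset))]
    apply le_antisymm
    · obtain ⟨B, hB, hBk⟩ := exists_card_eq_rk hy.nonempty S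
      rw [← hBk, ← hHc B hB, add_comm, ← card_inter_union hd]
      exact card_le_rk hB _
    · refine rk_le fun B hB => ?_
      rw [card_inter_union hd, hHc B hB, add_comm]
      exact Nat.add_le_add_right (card_le_rk hB S) _
  have key := hz.isRankFn.mob_minor (d := d) (d' := d') hTm hHm hHT hρ
  rw [hTA] at key
  rw [mobRk, key]
  refine Finset.sum_nonneg fun F' hF' => hT z hgz (fun z' hzz' => ?_) F' (Finset.mem_filter.1 hF').1
  exact (Finset.eq_of_subset_of_card_le hzz' (hzmax z' (hyz.trans hzz'))).ge

end BaseFamily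

namespace BaseFamily

variable {α : Type*} [DecidableEq α]

/-- The matroid `M` on the finite set `E` has the family of bases `𝒜`. -/
structure IsBaseFamily (M : Matroid α) (E : Finset α) (𝒜 : Finset (Finset α)) : Prop where
  ground_eq : M.E = E
  isBase_iff : ∀ B : Finset α, M.IsBase B ↔ B ∈ 𝒜

namespace IsBaseFamily

set_option linter.unusedSectionVars false

variable {M N : Matroid α} {E : Finset α} {𝒜 : Finset (Finset α)}

theorem exists_finset (h : IsBaseFamily M E 𝒜) {B : Set α} (hB : M.IsBase B) :
    ∃ B' ∈ 𝒜, (B' : Set α) = B := by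
  obtain ⟨B', rfl⟩ := (E.finite_toSet.subset (h.ground_eq ▸ hB.subset_ground)).exists_finset_coe
  exact ⟨B', (h.isBase_iff B').1 hB, rfl⟩

theorem subset (h : IsBaseFamily M E 𝒜) {B : Finset α} (hB : B ∈ 𝒜) : B ⊆ E := by
  have := ((h.isBase_iff B).2 hB).subset_ground
  rw [h.ground_eq] at this
  exact_mod_cast this

theorem eq (h : IsBaseFamily M E 𝒜) (h' : IsBaseFamily N E 𝒜) : M = N := by
  refine Matroid.ext_isBase (h.ground_eq.trans h'.ground_eq.symm) fun B hB => ?_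
  obtain ⟨B', rfl⟩ := (E.finite_toSet.subset (h.ground_eq ▸ hB)).exists_finset_coe
  rw [h.isBase_iff, h'.isBase_iff]

theorem nonempty (h : IsBaseFamily M E 𝒜) : 𝒜.Nonempty := by
  obtain ⟨B, hB⟩ := M.exists_isBase
  obtain ⟨B', hB', -⟩ := h.exists_finset hB
  exact ⟨B', hB'⟩

theorem indep_iff (h : IsBaseFamily M E 𝒜) {J : Finset α} :
    M.Indep J ↔ ∃ B ∈ 𝒜, J ⊆ B := by
  rw [Matroid.indep_iff]
  constructor
  · rintro ⟨B, hB, hJ⟩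
    obtain ⟨B', hB', rfl⟩ := h.exists_finset hB
    exact ⟨B', hB', Finset.coe_subset.1 hJ⟩
  · rintro ⟨B, hB, hJ⟩
    exact ⟨B, (h.isBase_iff B).2 hB, Finset.coe_subset.2 hJ⟩

theorem eRk_eq (h : IsBaseFamily M E 𝒜) (S : Finset α) : M.eRk S = rk 𝒜 S := by
  obtain ⟨I, hI⟩ := M.exists_isBasis' (S : Set α)
  obtain ⟨I, rfl⟩ := (S.finite_toSet.subset hI.subset).exists_finset_coe
  have hIS : I ⊆ S := Finset.coe_subset.1 hI.subset
  rw [← hI.encard_eq_eRk, Set.encard_coe_eq_coe_finsetCard, Nat.cast_inj]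
  apply le_antisymm
  · obtain ⟨B, hB, hIB⟩ := h.indep_iff.1 hI.indep
    exact (Finset.card_le_card (Finset.subset_inter hIB hIS)).trans (card_le_rk hB S)
  · refine rk_le fun B hB => ?_
    have hi : M.Indep ((B ∩ S : Finset α) : Set α) :=
      h.indep_iff.2 ⟨B, hB, Finset.inter_subset_left⟩
    have := hi.encard_le_eRk_of_subset (Finset.coe_subset.2 (Finset.inter_subset_right (s₁ := B)))
    rw [← hI.encard_eq_eRk, Set.encard_coe_eq_coe_finsetCard,
      Set.encard_coe_eq_coe_finsetCard] at this
    exact_mod_cast this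

theorem natRk_eq (h : IsBaseFamily M E 𝒜) (S : Finset α) : M.natRk S = rk 𝒜 S := by
  rw [Matroid.natRk, h.eRk_eq, ENat.toNat_natCast]

theorem isFlat_iff (h : IsBaseFamily M E 𝒜) (F : Finset α) :
    M.IsFlat F ↔ F ⊆ E ∧ IsRkFlat (rk 𝒜) E F := by
  constructor
  · intro hF
    refine ⟨by exact_mod_cast h.ground_eq ▸ hF.subset_ground, fun e he heF => ?_⟩
    have h1 := M.eRk_insert_eq_add_one (e := e) (X := F)
      ⟨by rw [h.ground_eq]; exact he, by rw [hF.closure]; exact heF⟩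
    rw [← Finset.coe_insert, h.eRk_eq, h.eRk_eq] at h1
    have h2 : rk 𝒜 (insert e F) = rk 𝒜 F + 1 := by exact_mod_cast h1
    omega
  · rintro ⟨hFE, hF⟩
    have hFM : (F : Set α) ⊆ M.E := by rw [h.ground_eq]; exact_mod_cast hFE
    rw [Matroid.isFlat_iff_closure_eq]
    refine Set.Subset.antisymm (fun e he => ?_) (M.subset_closure F hFM)
    by_contra heF
    have heE : e ∈ E := by
      have := M.closure_subset_ground F he
      rwa [h.ground_eq] at this
    have h1 : M.eRk (insert e (F : Set α)) ≤ M.eRk (M.closure F) :=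
      M.eRk_mono (Set.insert_subset he (M.subset_closure F hFM))
    rw [M.eRk_closure_eq, ← Finset.coe_insert, h.eRk_eq, h.eRk_eq, Nat.cast_le] at h1
    exact absurd (hF e heE heF) (not_lt.2 h1)

theorem dual (h : IsBaseFamily M E 𝒜) : IsBaseFamily M✶ E (𝒜.image (E \ ·)) where
  ground_eq := h.ground_eq
  isBase_iff B := by
    rw [Matroid.dual_isBase_iff', h.ground_eq, ← Finset.coe_sdiff, h.isBase_iff, Finset.coe_subset,
      Finset.mem_image]
    constructor
    · rintro ⟨h1, h2⟩
      exact ⟨E \ B, h1, Finset.sdiff_sdiff_eq_self h2⟩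
    · rintro ⟨X, hX, rfl⟩
      rw [Finset.sdiff_sdiff_eq_self (h.subset hX)]
      exact ⟨hX, Finset.sdiff_subset⟩

theorem card_eq (h : IsBaseFamily M E 𝒜) {X Y : Finset α} (hX : X ∈ 𝒜) (hY : Y ∈ 𝒜) :
    X.card = Y.card := by
  have := ((h.isBase_iff X).2 hX).encard_eq_encard_of_isBase ((h.isBase_iff Y).2 hY)
  rw [Set.encard_coe_eq_coe_finsetCard, Set.encard_coe_eq_coe_finsetCard] at this
  exact_mod_cast this

theorem rk_dual (h : IsBaseFamily M E 𝒜) {B X : Finset α} (hB : B ∈ 𝒜) (hX : X ⊆ E) :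
    rk (𝒜.image (E \ ·)) (E \ X) + X.card + B.card = E.card + rk 𝒜 X := by
  have key : ∀ Y ∈ 𝒜, ((E \ Y) ∩ (E \ X)).card + X.card + B.card = E.card + (Y ∩ X).card := by
    intro Y hY
    have hYE := h.subset hY
    have e1 : (E \ Y) ∩ (E \ X) = E \ (Y ∪ X) := by
      ext e
      simp only [Finset.mem_inter, Finset.mem_sdiff, Finset.mem_union]
      tauto
    have h1 := Finset.card_sdiff_add_card_eq_card (Finset.union_subset hYE hX)
    have h2 := Finset.card_union_add_card_inter Y X
    have h3 := h.card_eq hB hY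
    rw [e1]
    omega
  apply le_antisymm
  · obtain ⟨Z, hZ, hZk⟩ := exists_card_eq_rk h.dual.nonempty (E \ X)
    obtain ⟨Y, hY, rfl⟩ := Finset.mem_image.1 hZ
    have h1 := key Y hY
    have h2 := card_le_rk hY X
    omega
  · obtain ⟨Y, hY, hYk⟩ := exists_card_eq_rk h.nonempty X
    have h1 := key Y hY
    have h2 := card_le_rk (Finset.mem_image_of_mem (E \ ·) hY) (E \ X)
    omega

theorem isCyclicFlat_iff (h : IsBaseFamily M E 𝒜) (F : Finset α) :
    M.IsCyclicFlat F ↔ F ∈ cyclicFlats (rk 𝒜) E := by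
  rw [mem_cyclicFlats, Matroid.IsCyclicFlat, h.isFlat_iff, and_assoc]
  refine and_congr_right fun hFE => and_congr_right fun _ => ?_
  rw [h.ground_eq, ← Finset.coe_sdiff, h.dual.isFlat_iff, and_iff_right Finset.sdiff_subset]
  obtain ⟨B, hB⟩ := h.nonempty
  have key : ∀ e ∈ F, (rk (𝒜.image (E \ ·)) (E \ F) < rk (𝒜.image (E \ ·)) (insert e (E \ F)) ↔
      rk 𝒜 (F.erase e) = rk 𝒜 F) := by
    intro e he
    have e1 : insert e (E \ F) = E \ F.erase e := by
      ext x
      have := @hFE x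
      have : x = e → x ∈ E := fun hx => hx ▸ hFE he
      simp only [Finset.mem_insert, Finset.mem_sdiff, Finset.mem_erase]
      tauto
    have h1 := h.rk_dual hB hFE
    have h2 := h.rk_dual hB ((Finset.erase_subset e F).trans hFE)
    have h3 := Finset.card_erase_add_one he
    have h4 : rk 𝒜 (F.erase e) ≤ rk 𝒜 F := rk_le fun B hB => (Finset.card_le_card
      (Finset.inter_subset_inter_left (Finset.erase_subset _ _))).trans (card_le_rk hB F)
    rw [e1]
    omega
  constructor
  · intro hf e he
    exact (key e he).1 (hf e (hFE he) fun h' => (Finset.mem_sdiff.1 h').2 he)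
  · intro hc e heE he
    have heF : e ∈ F := by
      by_contra heF
      exact he (Finset.mem_sdiff.2 ⟨heE, heF⟩)
    exact (key e heF).2 (hc e heF)

theorem isLoop_iff (h : IsBaseFamily M E 𝒜) {e : α} :
    M.IsLoop e ↔ e ∈ E ∧ ∀ B ∈ 𝒜, e ∉ B := by
  rw [Matroid.isLoop_iff_forall_mem_compl_isBase, h.ground_eq]
  constructor
  · intro hl
    obtain ⟨B, hB⟩ := h.nonempty
    exact ⟨(hl B ((h.isBase_iff B).2 hB)).1, fun B hB => (hl B ((h.isBase_iff B).2 hB)).2⟩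
  · rintro ⟨heE, hl⟩ B hB
    obtain ⟨B', hB', rfl⟩ := h.exists_finset hB
    exact ⟨heE, hl B' hB'⟩

theorem isColoop_iff (h : IsBaseFamily M E 𝒜) {e : α} : M.IsColoop e ↔ ∀ B ∈ 𝒜, e ∈ B := by
  rw [Matroid.isColoop_iff_forall_mem_isBase]
  constructor
  · exact fun hl B hB => hl ((h.isBase_iff B).2 hB)
  · intro hl B hB
    obtain ⟨B', hB', rfl⟩ := h.exists_finset hB
    exact hl B' hB'

end IsBaseFamily

theorem sum_mu_mul {β : Type*} [PartialOrder β] [Fintype β] [LocallyFiniteOrder β]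
    [DecidableEq β] [DecidableLE β] (a : β) {f g : β → ℤ} (h : ∀ b, ∑ c with b ≤ c, g c = f b) :
    ∑ b with a ≤ b, IncidenceAlgebra.mu ℤ a b * f b = g a := by
  calc ∑ b with a ≤ b, IncidenceAlgebra.mu ℤ a b * f b
      = ∑ b with a ≤ b, ∑ c with b ≤ c, IncidenceAlgebra.mu ℤ a b * g c := by
        simp_rw [← h, Finset.mul_sum]
    _ = ∑ c, ∑ b ∈ Finset.Icc a c, IncidenceAlgebra.mu ℤ a b * g c := by
        refine Finset.sum_comm' fun b c => ?_
        simp [Finset.mem_Icc]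
    _ = ∑ c, if a = c then g c else 0 := by
        refine Finset.sum_congr rfl fun c _ => ?_
        rw [← Finset.sum_mul, IncidenceAlgebra.sum_Icc_mu_right]
        split_ifs <;> simp
    _ = g a := by simp

open Classical in
theorem IsBaseFamily.tau_eq [Fintype α] {M : Matroid α} {E : Finset α} {𝒜 : Finset (Finset α)}
    (h : IsBaseFamily M E 𝒜) {F : Finset α} (hF : F ∈ cyclicFlats (rk 𝒜) E) :
    M.tau F = mobRk 𝒜 E (rk 𝒜 E) F := by
  have hc := (h.isCyclicFlat_iff F).2 hF
  have hs : ∀ F' : M.CyclicFlat, ∑ K : M.CyclicFlat with F' ≤ K, mobRk 𝒜 E (rk 𝒜 E) (K : Finset α)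
      = M.corank ((F' : Finset α) : Set α) := by
    intro F'
    have h1 := sum_mob (cyclicFlats (rk 𝒜) E) (fun S => (rk 𝒜 E : ℤ) - rk 𝒜 S)
      ((h.isCyclicFlat_iff F').1 F'.2)
    rw [Matroid.corank, h.ground_eq, h.natRk_eq, h.natRk_eq, ← h1]
    refine Finset.sum_bij (fun c _ => (c : Finset α)) (fun c hc => ?_) (fun a _ b _ => Subtype.ext)
      (fun S hS => ?_) fun _ _ => rfl
    · exact Finset.mem_filter.2 ⟨(h.isCyclicFlat_iff c).1 c.2, (Finset.mem_filter.1 hc).2⟩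
    · obtain ⟨hS, hle⟩ := Finset.mem_filter.1 hS
      exact ⟨⟨S, (h.isCyclicFlat_iff S).2 hS⟩, Finset.mem_filter.2 ⟨Finset.mem_univ _, hle⟩, rfl⟩
  rw [Matroid.tau, dif_pos hc]
  refine Eq.trans ?_ (sum_mu_mul (⟨F, hc⟩ : M.CyclicFlat) hs)
  congr!

end BaseFamily

namespace BaseFamily

variable {α : Type*} [DecidableEq α] {𝓑 : Finset (Finset α)} {v : Finset α → ℝ}
  {G F : Finset α}

theorem swap_cost (h : IsValuated 𝓑 v G) {X Y : Finset α} (hX : X ∈ face 𝓑 F)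
    (hY : Y ∈ face 𝓑 F) (x : α → ℝ) :
    cost v x ((X \ F) ∪ (Y ∩ F)) + cost v x ((Y \ F) ∪ (X ∩ F)) ≤ cost v x X + cost v x Y := by
  have hd : ∀ S T : Finset α, Disjoint (S \ F) (T ∩ F) := fun S T =>
    Finset.disjoint_of_subset_right Finset.inter_subset_right Finset.sdiff_disjoint
  have hsp : ∀ S : Finset α, ∑ i ∈ S, x i = ∑ i ∈ S \ F, x i + ∑ i ∈ S ∩ F, x i := fun S => by
    rw [← Finset.sum_union (hd S S), Finset.sdiff_union_inter]
  have := h.swap _ X hX Y hY rfl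
  unfold cost
  rw [Finset.sum_union (hd X Y), Finset.sum_union (hd Y X), hsp X, hsp Y]
  linarith

theorem union_inter_of_disjoint {B I : Finset α} (hB : Disjoint B F) (hI : I ⊆ F) :
    (B ∪ I) ∩ F = I ∧ (B ∪ I) \ F = B := by
  have h1 : ∀ e ∈ B, e ∉ F := fun e he => Finset.disjoint_left.1 hB he
  constructor
  · ext e
    have := h1 e
    have := @hI e
    simp only [Finset.mem_inter, Finset.mem_union]
    tauto
  · ext e
    have := h1 e
    have := @hI e
    simp only [Finset.mem_sdiff, Finset.mem_union]
    tauto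

theorem mem_image_face_iff (h : IsValuated 𝓑 v G) {Y : Finset α} (hY : Y ∈ face 𝓑 F)
    (B : Finset α) :
    B ∈ (face 𝓑 F).image (· \ F) ↔ Disjoint B F ∧ B ∪ (Y ∩ F) ∈ face 𝓑 F := by
  rw [Finset.mem_image]
  constructor
  · rintro ⟨X, hX, rfl⟩
    exact ⟨Finset.sdiff_disjoint, h.swap_mem _ X hX Y hY rfl⟩
  · rintro ⟨hd, hB⟩
    exact ⟨_, hB, (union_inter_of_disjoint hd Finset.inter_subset_right).2⟩

theorem mem_image_argmin_face_iff (h : IsValuated 𝓑 v G) {Y : Finset α} (hY : Y ∈ face 𝓑 F)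
    (x : α → ℝ) (B : Finset α) :
    B ∈ (argmin (face 𝓑 F) (cost v x)).image (· \ F) ↔ (Disjoint B F ∧ B ∪ (Y ∩ F) ∈ face 𝓑 F) ∧
      ∀ C, Disjoint C F ∧ C ∪ (Y ∩ F) ∈ face 𝓑 F →
        cost v x (B ∪ (Y ∩ F)) ≤ cost v x (C ∪ (Y ∩ F)) := by
  have hYF : Y ∩ F ⊆ F := Finset.inter_subset_right
  rw [Finset.mem_image]
  constructor
  · rintro ⟨X, hX, rfl⟩
    obtain ⟨hXf, hXm⟩ := mem_argmin.1 hX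
    refine ⟨⟨Finset.sdiff_disjoint, h.swap_mem _ X hXf Y hY rfl⟩, fun C ⟨hC, hCf⟩ => ?_⟩
    obtain ⟨e1, e2⟩ := union_inter_of_disjoint hC hYF
    have h1 := swap_cost h hCf hXf x
    have h2 := hXm _ (h.swap_mem _ _ hCf X hXf rfl)
    rw [e1] at h1
    linarith
  · rintro ⟨⟨hd, hB⟩, hm⟩
    obtain ⟨e1, e2⟩ := union_inter_of_disjoint hd hYF
    obtain ⟨X, hX⟩ := (h.face F).argmin x |>.nonempty
    obtain ⟨hXf, hXm⟩ := mem_argmin.1 hX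
    have h1 := swap_cost h hB hXf x
    have h2 := hm (X \ F) ⟨Finset.sdiff_disjoint, h.swap_mem _ X hXf Y hY rfl⟩
    rw [e1, e2] at h1
    refine ⟨B ∪ (X ∩ F), mem_argmin.2 ⟨?_, fun Z hZ => ?_⟩,
      (union_inter_of_disjoint hd Finset.inter_subset_right).2⟩
    · have := h.swap_mem _ _ hB X hXf rfl
      rwa [e2] at this
    · have := hXm Z hZ
      linarith

end BaseFamily

namespace ValuatedMatroid

open BaseFamily

variable {α : Type*} [DecidableEq α] (V : ValuatedMatroid α)

open Classical in
/-- The bases of a valuated matroid. -/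
noncomputable def bases : Finset (Finset α) := V.ground.powerset.filter fun B => V.val B ≠ ⊤

/-- The real values of a valuated matroid on its bases. -/
noncomputable def realVal (B : Finset α) : ℝ := (V.val B).untopD 0

open Classical in
/-- The elements which are neither loops nor coloops. -/
noncomputable def core : Finset α :=
  V.ground.filter fun e => (∃ B ∈ V.bases, e ∈ B) ∧ ∃ B ∈ V.bases, e ∉ B

theorem mem_bases {B : Finset α} : B ∈ V.bases ↔ V.val B ≠ ⊤ := by
  simp only [bases, Finset.mem_filter, Finset.mem_powerset, and_iff_right_iff_imp]
  exact fun h => (V.subset_card_of_ne_top B h).1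

theorem coe_realVal {B : Finset α} (hB : V.val B ≠ ⊤) : (V.realVal B : WithTop ℝ) = V.val B :=
  WithTop.untopD_eq_iff.1 rfl |>.elim (fun h => h.symm) fun h => absurd h.1 hB

theorem isBaseFamily_underlying : IsBaseFamily V.underlying V.ground V.bases where
  ground_eq := rfl
  isBase_iff B := by
    rw [mem_bases]
    exact matroidOfBases_isBase _ _ _ _ _ _

theorem isValuated : IsValuated V.bases V.realVal V.core where
  nonempty := V.isBaseFamily_underlying.nonempty
  card_eq _ hX _ hY := V.isBaseFamily_underlying.card_eq hX hY
  rest := by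
    have key : ∀ X ∈ V.bases, ∀ Y ∈ V.bases, X \ V.core ⊆ Y \ V.core := by
      intro X hX Y hY e he
      obtain ⟨heX, heC⟩ := Finset.mem_sdiff.1 he
      refine Finset.mem_sdiff.2 ⟨?_, heC⟩
      by_contra heY
      exact heC (Finset.mem_filter.2 ⟨V.isBaseFamily_underlying.subset hX heX,
        ⟨X, hX, heX⟩, Y, hY, heY⟩)
    exact fun X hX Y hY => (key X hX Y hY).antisymm (key Y hY X hX)
  exchange X hX Y hY a ha := by
    rw [mem_bases] at hX hY
    obtain ⟨b, hb, hle⟩ := V.exists_exchange hX hY ha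
    have hab : a ≠ b := fun h => (Finset.mem_sdiff.1 ha).2 (h ▸ (Finset.mem_sdiff.1 hb).1)
    rw [Finset.erase_insert_of_ne hab] at hle
    have htop : V.val (insert b (X.erase a)) + V.val (insert a (Y.erase b)) ≠ ⊤ := fun h => by
      rw [h, top_le_iff, WithTop.add_eq_top] at hle
      exact hle.elim hX hY
    rw [Ne, WithTop.add_eq_top, not_or] at htop
    refine ⟨b, hb, V.mem_bases.2 htop.1, V.mem_bases.2 htop.2, ?_⟩
    rw [← V.coe_realVal hX, ← V.coe_realVal hY, ← V.coe_realVal htop.1,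
      ← V.coe_realVal htop.2] at hle
    exact_mod_cast hle

theorem good_bases : Good V.bases V.core := fun _ he => (Finset.mem_filter.1 he).2

theorem card_of_mem_bases {B : Finset α} (hB : B ∈ V.bases) : B.card = V.rank :=
  (V.subset_card_of_ne_top B (V.mem_bases.1 hB)).2

theorem tilt_eq {B : Finset α} (hB : B ∈ V.bases) (x : α → ℝ) :
    V.tilt x B = (cost V.realVal x B : ℝ) := by
  rw [tilt, ← V.coe_realVal (V.mem_bases.1 hB), ← WithTop.coe_add, cost, sub_eq_add_neg]

theorem isInitialBase_iff {x : α → ℝ} {B : Finset α} :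
    V.IsInitialBase x B ↔ B ∈ argmin V.bases (cost V.realVal x) := by
  rw [IsInitialBase, mem_argmin, ← mem_bases]
  refine and_congr_right fun hB => ⟨fun h B' hB' => ?_, fun h B' => ?_⟩
  · have := h B'
    rw [V.tilt_eq hB, V.tilt_eq hB'] at this
    exact_mod_cast this
  · by_cases hB' : V.val B' = ⊤
    · simp [tilt, hB']
    · rw [V.tilt_eq hB, V.tilt_eq (V.mem_bases.2 hB')]
      exact_mod_cast h B' (V.mem_bases.2 hB')

theorem isBaseFamily_initialMatroid (x : α → ℝ) :
    IsBaseFamily (V.initialMatroid x) V.ground (argmin V.bases (cost V.realVal x)) where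
  ground_eq := rfl
  isBase_iff B := by
    rw [← isInitialBase_iff]
    exact matroidOfBases_isBase _ _ _ _ _ _

theorem exists_mem_face_inter (F : Finset α) :
    ∃ Y ∈ face V.bases F, Y ∩ F = V.basisOf F := by
  have hI := V.basisOf_isBasis' F
  obtain ⟨Y, hY, hIY⟩ := V.isBaseFamily_underlying.indep_iff.1 hI.indep
  have hrk : (V.basisOf F).card = rk V.bases F := by
    have := hI.encard_eq_eRk
    rw [V.isBaseFamily_underlying.eRk_eq, Set.encard_coe_eq_coe_finsetCard] at this
    exact_mod_cast this
  have heq : V.basisOf F = Y ∩ F := Finset.eq_of_subset_of_card_le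
    (Finset.subset_inter hIY (V.basisOf_subset F)) (by rw [hrk]; exact card_le_rk hY F)
  exact ⟨Y, mem_face.2 ⟨hY, by rw [← heq, hrk]⟩, heq.symm⟩

theorem mem_bases_contract {F Y : Finset α} (hY : Y ∈ face V.bases F)
    (hYF : Y ∩ F = V.basisOf F) (B : Finset α) :
    B ∈ (V.contract F).bases ↔ Disjoint B F ∧ B ∪ (Y ∩ F) ∈ face V.bases F := by
  rw [mem_bases]
  change (if B ⊆ V.ground \ F then V.val (B ∪ V.basisOf F) else ⊤) ≠ ⊤ ↔ _
  rw [← hYF]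
  constructor
  · intro h
    split_ifs at h with hB
    · have hd := Finset.disjoint_of_subset_left hB Finset.sdiff_disjoint
      exact ⟨hd, mem_face.2 ⟨V.mem_bases.2 h, by
        rw [(union_inter_of_disjoint hd Finset.inter_subset_right).1, (mem_face.1 hY).2]⟩⟩
    · exact absurd rfl h
  · rintro ⟨hd, hB⟩
    have hB' := V.mem_bases.1 (mem_face.1 hB).1
    rwa [if_pos (Finset.subset_sdiff.2
      ⟨Finset.union_subset_left (V.subset_card_of_ne_top _ hB').1, hd⟩)]

theorem isBaseFamily_contract (F : Finset α) : IsBaseFamily (V.contract F).underlying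
    (V.ground \ F) ((face V.bases F).image (· \ F)) where
  ground_eq := rfl
  isBase_iff B := by
    obtain ⟨Y, hY, hYF⟩ := V.exists_mem_face_inter F
    rw [(V.contract F).isBaseFamily_underlying.isBase_iff, V.mem_bases_contract hY hYF,
      mem_image_face_iff V.isValuated hY]

theorem isBaseFamily_contract_initialMatroid (F : Finset α) (x : α → ℝ) :
    IsBaseFamily ((V.contract F).initialMatroid x) (V.ground \ F)
      ((argmin (face V.bases F) (cost V.realVal x)).image (· \ F)) where
  ground_eq := rfl
  isBase_iff B := by
    obtain ⟨Y, hY, hYF⟩ := V.exists_mem_face_inter F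
    have hcost : ∀ C ∈ (V.contract F).bases, cost (V.contract F).realVal x C
        = cost V.realVal x (C ∪ (Y ∩ F)) + ∑ i ∈ Y ∩ F, x i := by
      intro C hC
      have hCd := ((V.mem_bases_contract hY hYF C).1 hC).1
      have hCE : C ⊆ V.ground \ F := ((V.contract F).isBaseFamily_underlying).subset hC
      have h1 : (V.contract F).realVal C = V.realVal (C ∪ (Y ∩ F)) := by
        change (if C ⊆ V.ground \ F then V.val (C ∪ V.basisOf F) else ⊤).untopD 0 = _
        rw [if_pos hCE, ← hYF, realVal]
      rw [cost, cost, h1, Finset.sum_union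
        (Finset.disjoint_of_subset_right Finset.inter_subset_right hCd)]
      ring
    rw [((V.contract F).isBaseFamily_initialMatroid x).isBase_iff,
      mem_image_argmin_face_iff V.isValuated hY, mem_argmin, ← V.mem_bases_contract hY hYF]
    refine and_congr_right fun hB => ⟨fun h C hC => ?_, fun h C hC => ?_⟩
    · rw [← V.mem_bases_contract hY hYF] at hC
      have := h C hC
      rw [hcost B hB, hcost C hC] at this
      linarith
    · have := h C ((V.mem_bases_contract hY hYF C).1 hC)
      rw [hcost B hB, hcost C hC]
      linarith

end ValuatedMatroid

namespace BaseFamily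

variable {α : Type*} [DecidableEq α] {𝓒 : Finset (Finset α)} {S L : Finset α}

theorem inter_union_of_loops (hL : ∀ e ∈ L, ∀ B ∈ 𝓒, e ∉ B) {B : Finset α} (hB : B ∈ 𝓒)
    (S : Finset α) : B ∩ (S ∪ L) = B ∩ S := by
  ext e
  have : e ∈ L → e ∉ B := fun he => hL e he B hB
  simp only [Finset.mem_inter, Finset.mem_union]
  tauto

theorem rk_union_of_loops (hL : ∀ e ∈ L, ∀ B ∈ 𝓒, e ∉ B) (S : Finset α) :
    rk 𝓒 (S ∪ L) = rk 𝓒 S :=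
  Finset.sup_congr rfl fun B hB => by rw [inter_union_of_loops hL hB]

theorem face_union_of_loops (hL : ∀ e ∈ L, ∀ B ∈ 𝓒, e ∉ B) (S : Finset α) :
    face 𝓒 (S ∪ L) = face 𝓒 S := by
  ext B
  rw [mem_face, mem_face, rk_union_of_loops hL]
  exact and_congr_right fun hB => by rw [inter_union_of_loops hL hB]

theorem rk_lt_insert_of_coloop (hne : 𝓒.Nonempty) {e : α} (he : ∀ B ∈ 𝓒, e ∈ B) (heS : e ∉ S) :
    rk 𝓒 S < rk 𝓒 (insert e S) := by
  obtain ⟨B, hB, hBk⟩ := exists_card_eq_rk hne S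
  have := card_le_rk hB (insert e S)
  rw [card_inter_insert (he B hB) heS] at this
  omega

theorem cyclicFlats_of_coloops (hne : 𝓒.Nonempty) {A D : Finset α} (hAD : A ⊆ D)
    (hD : ∀ e ∈ D, e ∉ A → ∀ B ∈ 𝓒, e ∈ B) :
    cyclicFlats (rk 𝓒) D = cyclicFlats (rk 𝓒) A := by
  ext S
  rw [mem_cyclicFlats, mem_cyclicFlats]
  constructor
  · rintro ⟨hS, hf, hc⟩
    refine ⟨fun e he => ?_, fun e he => hf e (hAD he), hc⟩
    by_contra heA
    have h1 := rk_lt_insert_of_coloop hne (hD e (hS he) heA) (Finset.notMem_erase e S)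
    rw [Finset.insert_erase he, hc e he] at h1
    exact lt_irrefl _ h1
  · rintro ⟨hS, hf, hc⟩
    refine ⟨hS.trans hAD, fun e heD he => ?_, hc⟩
    by_cases heA : e ∈ A
    · exact hf e heA he
    · exact rk_lt_insert_of_coloop hne (hD e heD heA) he

theorem subset_of_mem_cyclicFlats {D F : Finset α} (hL : ∀ e ∈ L, ∀ B ∈ 𝓒, e ∉ B) (hLD : L ⊆ D)
    (hF : F ∈ cyclicFlats (rk 𝓒) D) : L ⊆ F := by
  intro e he
  by_contra heF
  have h1 := (mem_cyclicFlats.1 hF).2.1 e (hLD he) heF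
  have h2 := rk_union_of_loops (L := {e}) (fun e' he' => by
    rw [Finset.mem_singleton.1 he']; exact hL e he) F
  rw [Finset.union_comm, ← Finset.insert_eq] at h2
  omega

theorem union_mem_cyclicFlats_iff {G F : Finset α} (hL : ∀ e ∈ L, ∀ B ∈ 𝓒, e ∉ B)
    (hGL : Disjoint G L) (hF : F ⊆ G) :
    F ∪ L ∈ cyclicFlats (rk 𝓒) (G ∪ L) ↔ F ∈ cyclicFlats (rk 𝓒) G := by
  have hins : ∀ e, rk 𝓒 (insert e (F ∪ L)) = rk 𝓒 (insert e F) := fun e => by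
    rw [← Finset.insert_union, rk_union_of_loops hL]
  have her : ∀ e ∈ F, rk 𝓒 ((F ∪ L).erase e) = rk 𝓒 (F.erase e) := fun e he => by
    rw [Finset.erase_union_distrib,
      Finset.erase_eq_of_notMem fun h => Finset.disjoint_left.1 hGL (hF he) h,
      rk_union_of_loops hL]
  rw [mem_cyclicFlats, mem_cyclicFlats]
  constructor
  · rintro ⟨-, hf, hc⟩
    refine ⟨hF, fun e heG heF => ?_, fun e he => ?_⟩
    · rw [← hins, ← rk_union_of_loops hL]
      exact hf e (Finset.mem_union_left _ heG) fun h =>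
        (Finset.mem_union.1 h).elim heF fun h => Finset.disjoint_left.1 hGL heG h
    · rw [← her e he, hc e (Finset.mem_union_left _ he), rk_union_of_loops hL]
  · rintro ⟨-, hf, hc⟩
    refine ⟨Finset.union_subset_union hF subset_rfl, fun e heG heF => ?_, fun e he => ?_⟩
    · rw [Finset.mem_union, not_or] at heF
      rw [hins, rk_union_of_loops hL]
      exact hf e ((Finset.mem_union.1 heG).resolve_right heF.2) heF.1
    · by_cases heF : e ∈ F
      · rw [her e heF, hc e heF, rk_union_of_loops hL]
      · have heL := (Finset.mem_union.1 he).resolve_left heF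
        rw [Finset.erase_union_distrib, Finset.erase_eq_of_notMem heF, rk_union_of_loops hL,
          rk_union_of_loops fun e' he' => hL e' (Finset.mem_of_mem_erase he')]

theorem rk_image_sdiff {X : Finset α} (hS : Disjoint S X) :
    rk (𝓒.image (· \ X)) S = rk 𝓒 S := by
  rw [rk, Finset.sup_image]
  refine Finset.sup_congr rfl fun B _ => congrArg Finset.card ?_
  ext e
  have : e ∈ S → e ∉ X := fun h => Finset.disjoint_left.1 hS h
  simp only [Finset.mem_inter, Finset.mem_sdiff]
  tauto

end BaseFamily

namespace ValuatedMatroid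

open BaseFamily

variable {α : Type*} [DecidableEq α] (V : ValuatedMatroid α)

open Classical in
/-- The loops of a valuated matroid. -/
noncomputable def loopSet : Finset α := V.ground.filter fun e => ∀ B ∈ V.bases, e ∉ B

theorem notMem_of_mem_loopSet : ∀ e ∈ V.loopSet, ∀ B ∈ V.bases, e ∉ B :=
  fun _ he => (Finset.mem_filter.1 he).2

theorem loopSet_subset : V.loopSet ⊆ V.ground := Finset.filter_subset _ _

theorem core_subset : V.core ⊆ V.ground := Finset.filter_subset _ _

theorem disjoint_core_loopSet : Disjoint V.core V.loopSet :=
  Finset.disjoint_left.2 fun e he he' => by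
    obtain ⟨⟨B, hB, heB⟩, -⟩ := (Finset.mem_filter.1 he).2
    exact V.notMem_of_mem_loopSet e he' B hB heB

theorem mem_of_notMem_core {e : α} (he : e ∈ V.ground) (heL : e ∉ V.loopSet) (heG : e ∉ V.core) :
    ∀ B ∈ V.bases, e ∈ B := by
  simp only [loopSet, core, Finset.mem_filter, he, true_and] at heL heG
  push Not at heL heG
  exact heG heL

theorem cyclicFlats_ground : cyclicFlats (rk V.bases) V.ground
    = cyclicFlats (rk V.bases) (V.core ∪ V.loopSet) :=
  cyclicFlats_of_coloops V.isValuated.nonempty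
    (Finset.union_subset V.core_subset V.loopSet_subset) fun e he he' => by
      rw [Finset.mem_union, not_or] at he'
      exact V.mem_of_notMem_core he he'.2 he'.1

theorem isCyclicFlat_iff {F : Finset α} : V.underlying.IsCyclicFlat F ↔
    ∃ H ∈ cyclicFlats (rk V.bases) V.core, F = H ∪ V.loopSet := by
  rw [V.isBaseFamily_underlying.isCyclicFlat_iff, cyclicFlats_ground]
  constructor
  · intro hF
    have hL := subset_of_mem_cyclicFlats V.notMem_of_mem_loopSet Finset.subset_union_right hF
    have heq : F = (F \ V.loopSet) ∪ V.loopSet := (Finset.sdiff_union_of_subset hL).symm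
    refine ⟨F \ V.loopSet, ?_, heq⟩
    rw [heq] at hF
    refine (union_mem_cyclicFlats_iff V.notMem_of_mem_loopSet V.disjoint_core_loopSet ?_).1 hF
    intro e he
    obtain ⟨heF, heL⟩ := Finset.mem_sdiff.1 he
    have := (mem_cyclicFlats.1 hF).1 (heq ▸ heF)
    exact (Finset.mem_union.1 this).resolve_right heL
  · rintro ⟨H, hH, rfl⟩
    exact (union_mem_cyclicFlats_iff V.notMem_of_mem_loopSet V.disjoint_core_loopSet
      (mem_cyclicFlats.1 hH).1).2 hH

/-- The bases of the initial matroid of a contraction, extended by parts of the contracted set. -/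
noncomputable def faceBases (F : Finset α) (x : α → ℝ) : Finset (Finset α) :=
  argmin (face V.bases F) (cost V.realVal x)

theorem isValuated_faceBases (F : Finset α) (x : α → ℝ) :
    IsValuated (V.faceBases F x) V.realVal V.core := (V.isValuated.face F).argmin x

theorem faceBases_subset (F : Finset α) (x : α → ℝ) : V.faceBases F x ⊆ V.bases :=
  (argmin_subset _ _).trans (face_subset _ _)

theorem isBaseFamily_faceBases (F : Finset α) (x : α → ℝ) :
    IsBaseFamily ((V.contract (F ∪ V.loopSet)).initialMatroid x) (V.ground \ (F ∪ V.loopSet))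
      ((V.faceBases F x).image (· \ (F ∪ V.loopSet))) := by
  have := V.isBaseFamily_contract_initialMatroid (F ∪ V.loopSet) x
  rwa [face_union_of_loops V.notMem_of_mem_loopSet] at this

theorem sdiff_core_subset (F : Finset α) :
    V.core \ F ⊆ V.ground \ (F ∪ V.loopSet) := by
  intro e he
  obtain ⟨h1, h2⟩ := Finset.mem_sdiff.1 he
  exact Finset.mem_sdiff.2 ⟨V.core_subset h1, fun h => (Finset.mem_union.1 h).elim h2
    fun h => Finset.disjoint_left.1 V.disjoint_core_loopSet h1 h⟩

theorem mem_of_mem_ground_sdiff {F : Finset α} {e : α} (he : e ∈ V.ground \ (F ∪ V.loopSet))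
    (heG : e ∉ V.core \ F) : ∀ B ∈ V.bases, e ∈ B := by
  obtain ⟨h1, h2⟩ := Finset.mem_sdiff.1 he
  rw [Finset.mem_union, not_or] at h2
  exact V.mem_of_notMem_core h1 h2.2 fun h => heG (Finset.mem_sdiff.2 ⟨h, h2.1⟩)

theorem mem_distinguishedCandidates_iff {M : Matroid α} : M ∈ V.distinguishedCandidates ↔
    ∃ F ∈ cyclicFlats (rk V.bases) V.core, ∃ x, Good (V.faceBases F x) (V.core \ F) ∧
      M = (V.contract (F ∪ V.loopSet)).initialMatroid x := by
  constructor
  · rintro ⟨⟨F, hF, ⟨x, rfl⟩, hloop⟩, hcoloop⟩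
    obtain ⟨H, hH, rfl⟩ := V.isCyclicFlat_iff.1 hF
    refine ⟨H, hH, x, fun e he => ?_, rfl⟩
    have hb := V.isBaseFamily_faceBases H x
    have heE := V.sdiff_core_subset H he
    obtain ⟨heG, heH⟩ := Finset.mem_sdiff.1 he
    have heF := (Finset.mem_sdiff.1 heE).2
    constructor
    · by_contra hno
      push Not at hno
      have h1 := hloop e (hb.isLoop_iff.2 ⟨heE, fun B hB => by
        obtain ⟨X, hX, rfl⟩ := Finset.mem_image.1 hB
        exact fun h => hno X hX (Finset.mem_sdiff.1 h).1⟩)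
      obtain ⟨⟨X, hX, heX⟩, -⟩ := good_face V.isValuated V.good_bases hH e heG
      rw [(V.isBaseFamily_contract (H ∪ V.loopSet)).isLoop_iff,
        face_union_of_loops V.notMem_of_mem_loopSet] at h1
      exact h1.2 _ (Finset.mem_image_of_mem _ hX) (Finset.mem_sdiff.2 ⟨heX, heF⟩)
    · by_contra hno
      push Not at hno
      have h1 := hcoloop e (hb.isColoop_iff.2 fun B hB => by
        obtain ⟨X, hX, rfl⟩ := Finset.mem_image.1 hB
        exact Finset.mem_sdiff.2 ⟨hno X hX, heF⟩)
      obtain ⟨-, X, hX, heX⟩ := V.good_bases e heG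
      exact heX (V.isBaseFamily_underlying.isColoop_iff.1 h1 X hX)
  · rintro ⟨F, hF, x, hg, rfl⟩
    have hb := V.isBaseFamily_faceBases F x
    obtain ⟨X, hX⟩ := (V.isValuated_faceBases F x).nonempty
    refine ⟨⟨F ∪ V.loopSet, V.isCyclicFlat_iff.2 ⟨F, hF, rfl⟩, ⟨x, rfl⟩, fun e he => ?_⟩,
      fun e he => ?_⟩
    · exfalso
      obtain ⟨heE, hno⟩ := hb.isLoop_iff.1 he
      have heF := (Finset.mem_sdiff.1 heE).2
      by_cases heG : e ∈ V.core \ F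
      · obtain ⟨⟨B, hB, heB⟩, -⟩ := hg e heG
        exact hno _ (Finset.mem_image_of_mem _ hB) (Finset.mem_sdiff.2 ⟨heB, heF⟩)
      · exact hno _ (Finset.mem_image_of_mem _ hX) (Finset.mem_sdiff.2
          ⟨V.mem_of_mem_ground_sdiff heE heG X (V.faceBases_subset F x hX), heF⟩)
    · have hall := hb.isColoop_iff.1 he
      have heE : e ∈ V.ground \ (F ∪ V.loopSet) :=
        hb.subset (Finset.mem_image_of_mem _ hX) (hall _ (Finset.mem_image_of_mem _ hX))
      refine V.isBaseFamily_underlying.isColoop_iff.2 (V.mem_of_mem_ground_sdiff heE fun heG => ?_)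
      obtain ⟨-, B, hB, heB⟩ := hg e heG
      exact heB (Finset.mem_sdiff.1 (hall _ (Finset.mem_image_of_mem _ hB))).1

theorem natRk_contract_initialMatroid {F S : Finset α} {x : α → ℝ} (hS : S ⊆ V.core \ F) :
    ((V.contract (F ∪ V.loopSet)).initialMatroid x).natRk S = rk (V.faceBases F x) S := by
  rw [(V.isBaseFamily_faceBases F x).natRk_eq, rk_image_sdiff]
  exact Finset.disjoint_of_subset_left (hS.trans (V.sdiff_core_subset F)) Finset.sdiff_disjoint

theorem tau_contract_initialMatroid [Fintype α] {F : Finset α} {x : α → ℝ}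
    (hF : F ⊆ V.core) (hg : Good (V.faceBases F x) (V.core \ F)) :
    ((V.contract (F ∪ V.loopSet)).initialMatroid x).tau ∅
      = mobRk (V.faceBases F x) (V.core \ F) (V.rank - rk V.bases F) ∅ := by
  set D := V.ground \ (F ∪ V.loopSet) with hD
  set X := F ∪ V.loopSet with hX
  have hb := V.isBaseFamily_faceBases F x
  have hv := V.isValuated_faceBases F x
  have hdis : ∀ S ⊆ D, rk ((V.faceBases F x).image (· \ X)) S = rk (V.faceBases F x) S :=
    fun S hS => rk_image_sdiff (Finset.disjoint_of_subset_left hS Finset.sdiff_disjoint)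
  have hcf : cyclicFlats (rk ((V.faceBases F x).image (· \ X))) D
      = cyclicFlats (rk (V.faceBases F x)) (V.core \ F) := by
    rw [cyclicFlats_congr hdis]
    exact cyclicFlats_of_coloops hv.nonempty (V.sdiff_core_subset F) fun e he heG B hB =>
      V.mem_of_mem_ground_sdiff he heG B (V.faceBases_subset F x hB)
  have hrk : (rk (V.faceBases F x) D : ℤ) = V.rank - rk V.bases F := by
    have : rk (V.faceBases F x) D = V.rank - rk V.bases F := by
      refine rk_eq_of_const hv.nonempty fun B hB => ?_
      have hBm := V.faceBases_subset F x hB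
      have h1 := card_inter_sdiff (B := B) (Finset.union_subset
        (hF.trans V.core_subset) V.loopSet_subset : X ⊆ V.ground)
      rw [Finset.inter_eq_left.2 (V.isBaseFamily_underlying.subset hBm), V.card_of_mem_bases hBm,
        inter_union_of_loops V.notMem_of_mem_loopSet hBm,
        (mem_face.1 (argmin_subset _ _ hB)).2] at h1
      rw [hD, hX]
      omega
    obtain ⟨B, hB, hBk⟩ := exists_card_eq_rk V.isValuated.nonempty F
    have h2 := Finset.card_le_card (Finset.inter_subset_left (s₁ := B) (s₂ := F))
    rw [hBk, V.card_of_mem_bases hB] at h2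
    omega
  have h0 := empty_mem_cyclicFlats hg
  rw [hb.tau_eq (by rw [hcf]; exact h0), mobRk, mobRk, hcf]
  refine mob_congr (fun S hS => ?_) ∅ h0
  rw [hdis _ subset_rfl, hrk, hdis]
  exact (mem_cyclicFlats.1 hS).1.trans (V.sdiff_core_subset F)

end ValuatedMatroid

namespace BaseFamily

variable {α : Type*} [DecidableEq α]

/-- A cyclic set of a transversal matroid has exactly as many neighbours as its rank. -/
theorem card_biUnion_of_isRkCyclic {ι : Type*} [DecidableEq ι] (R : α → Finset ι)
    {r : Finset α → ℕ} (hle : ∀ S J : Finset α, J ⊆ S →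
      (∃ f : J → ι, Function.Injective f ∧ ∀ j : J, f j ∈ R j) → J.card ≤ r S)
    (hex : ∀ S : Finset α, ∃ J ⊆ S, (∃ f : J → ι, Function.Injective f ∧ ∀ j : J, f j ∈ R j) ∧
      J.card = r S) {C : Finset α} (hC : IsRkCyclic r C) : (C.biUnion R).card = r C := by
  have hbound : ∀ J T : Finset α, (∃ f : J → ι, Function.Injective f ∧ ∀ j : J, f j ∈ R j) →
      J.card ≤ (T.biUnion R).card + (J \ T).card := by
    rintro J T ⟨f, hf, hfR⟩
    have h1 : (Finset.univ.filter fun j : J => (j : α) ∈ T).card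
        ≤ (T.biUnion R).card :=
      Finset.card_le_card_of_injOn f (fun j hj => Finset.mem_biUnion.2
        ⟨j, (Finset.mem_filter.1 hj).2, hfR j⟩) hf.injOn
    have h2 : (J ∩ T).card = (Finset.univ.filter fun j : J => (j : α) ∈ T).card := by
      rw [← Finset.card_map (Function.Embedding.subtype _)]
      congr 1
      ext e
      simp [and_comm]
    have h3 := Finset.card_sdiff_add_card_inter J T
    omega
  apply le_antisymm
  · obtain ⟨T, hT, hTr⟩ : ∃ T ⊆ C, (T.biUnion R).card + (C \ T).card ≤ r C := by
      by_contra hno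
      push Not at hno
      have h0 := hno ∅ (Finset.empty_subset _)
      simp only [Finset.biUnion_empty, Finset.card_empty, Finset.sdiff_empty, zero_add] at h0
      let k := C.card - r C - 1
      let t : C → Finset (ι ⊕ Fin k) := fun c => (R c).disjSum Finset.univ
      obtain ⟨f, hf, hft⟩ := (Finset.all_card_le_biUnion_card_iff_exists_injective t).1 (by
        intro s
        rcases s.eq_empty_or_nonempty with rfl | ⟨c, hc⟩
        · simp
        have h1 : s.biUnion t
            = ((s.map (Function.Embedding.subtype _)).biUnion R).disjSum Finset.univ := by
          ext y
          rcases y with y | y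
          · simp [t]
          · simp only [t, Finset.mem_biUnion, Finset.inr_mem_disjSum, Finset.mem_univ, and_true,
              iff_true]
            exact ⟨c, hc⟩
        have hsub : s.map (Function.Embedding.subtype (· ∈ C)) ⊆ C := fun e he => by
          obtain ⟨c, -, rfl⟩ := Finset.mem_map.1 he
          exact c.2
        have h2 := hno _ hsub
        have h3 := Finset.card_sdiff_add_card_eq_card hsub
        rw [Finset.card_map] at h3
        rw [h1, Finset.card_disjSum, Finset.card_univ, Fintype.card_fin]
        omega)
      set P := (Finset.univ : Finset C).filter fun c => (f c).isLeft with hP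
      have h1 : ((Finset.univ : Finset C).filter fun c => ¬ (f c).isLeft).card ≤ k := by
        calc _ ≤ ((Finset.univ : Finset (Fin k)).map ⟨Sum.inr, Sum.inr_injective⟩ :
              Finset (ι ⊕ Fin k)).card := by
              refine Finset.card_le_card_of_injOn f (fun c hc => ?_) hf.injOn
              have := (Finset.mem_filter.1 hc).2
              rcases hfc : f c with y | y
              · simp [hfc] at this
              · simp
          _ = k := by simp
      have h2 : P.card + ((Finset.univ : Finset C).filter fun c => ¬ (f c).isLeft).card
          = (Finset.univ : Finset C).card := Finset.card_filter_add_card_filter_not _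
      rw [Finset.card_univ, Fintype.card_coe] at h2
      have h3 := hle C (P.map (Function.Embedding.subtype _)) (fun e he => by
        obtain ⟨c, -, rfl⟩ := Finset.mem_map.1 he
        exact c.2) (by
        have key : ∀ j : (P.map (Function.Embedding.subtype (· ∈ C)) : Finset α),
            ∃ i, ∃ h : (j : α) ∈ C, i ∈ R j ∧ f ⟨j, h⟩ = Sum.inl i := by
          rintro ⟨j, hj⟩
          obtain ⟨c, hc, rfl⟩ := Finset.mem_map.1 hj
          obtain ⟨i, hi⟩ := Sum.isLeft_iff.1 (Finset.mem_filter.1 hc).2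
          have := hft c
          rw [hi, Finset.inl_mem_disjSum] at this
          exact ⟨i, c.2, this, hi⟩
        choose g hgC hgR hgf using key
        refine ⟨g, fun j j' hjj' => ?_, hgR⟩
        have := hf ((hgf j).trans ((congrArg Sum.inl hjj').trans (hgf j').symm))
        exact Subtype.ext (congrArg (fun c : C => (c : α)) this))
      rw [Finset.card_map] at h3
      omega
    have hTC : T = C := by
      refine hT.antisymm fun e he => ?_
      by_contra heT
      obtain ⟨J, hJ, hJm, hJc⟩ := hex (C.erase e)
      have h1 := hbound J T hJm
      have h2 : (J \ T).card < (C \ T).card := by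
        refine Finset.card_lt_card ((Finset.ssubset_iff_of_subset
          (Finset.sdiff_subset_sdiff (hJ.trans (Finset.erase_subset _ _)) subset_rfl)).2
          ⟨e, Finset.mem_sdiff.2 ⟨he, heT⟩, fun h => ?_⟩)
        exact Finset.notMem_erase e C (hJ (Finset.mem_sdiff.1 h).1)
      rw [hC e he] at hJc
      omega
    subst hTC
    simpa using hTr
  · obtain ⟨J, hJ, hJm, hJc⟩ := hex C
    have h1 := hbound J C hJm
    rw [Finset.sdiff_eq_empty_iff_subset.2 hJ, Finset.card_empty] at h1
    omega

theorem IsBaseFamily.mobRk_nonneg_of_isTransversal {M : Matroid α} {E G F : Finset α}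
    {𝒜 : Finset (Finset α)} (h : IsBaseFamily M E 𝒜) (hM : M.IsTransversal)
    (hr : IsRankFn (rk 𝒜)) (hg : Good 𝒜 G) (hF : F ∈ cyclicFlats (rk 𝒜) G) :
    0 ≤ mobRk 𝒜 G (rk 𝒜 E) F := by
  classical
  obtain ⟨A, -, hA⟩ := hM
  let R : α → Finset (Fin (M.natRk M.E)) := fun e => Finset.univ.filter fun i => e ∈ A i
  have hind : ∀ J : Finset α, (∃ f : J → Fin (M.natRk M.E), Function.Injective f ∧
      ∀ j : J, f j ∈ R j) ↔ ∃ B ∈ 𝒜, J ⊆ B := by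
    intro J
    rw [← h.indep_iff, hA]
    simp only [R, Finset.mem_filter, Finset.mem_univ, true_and]
    rfl
  have h1 := hr.mob_nonneg_of_neighbours (G := G) (F := F) (fun S => S.biUnion R)
    (fun S T => Finset.union_biUnion)
    (fun C _ hC => card_biUnion_of_isRkCyclic R (fun S J hJS hJ => by
        obtain ⟨B, hB, hJB⟩ := (hind J).1 hJ
        exact (Finset.card_le_card (Finset.subset_inter hJB hJS)).trans (card_le_rk hB S))
      (fun S => by
        obtain ⟨B, hB, hBk⟩ := exists_card_eq_rk h.nonempty S
        exact ⟨B ∩ S, Finset.inter_subset_right, (hind _).2 ⟨B, hB, Finset.inter_subset_left⟩,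
          hBk⟩) hC)
    (isRkFlat_empty hg) hF
  rwa [Fintype.card_fin, h.ground_eq, h.natRk_eq] at h1

end BaseFamily

namespace ValuatedMatroid

open BaseFamily

variable {α : Type*} [DecidableEq α] (V : ValuatedMatroid α)

theorem rk_ground {𝒜 : Finset (Finset α)} (hne : 𝒜.Nonempty) (h𝒜 : 𝒜 ⊆ V.bases) :
    rk 𝒜 V.ground = V.rank :=
  rk_eq_of_const hne fun B hB => by
    rw [Finset.inter_eq_left.2 (V.isBaseFamily_underlying.subset (h𝒜 hB)),
      V.card_of_mem_bases (h𝒜 hB)]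

theorem mobRk_nonneg_of_hasTransversalFacets (hV : V.HasTransversalFacets) {y : α → ℝ}
    (hg : Good (argmin V.bases (cost V.realVal y)) V.core)
    (hmax : ∀ y', argmin V.bases (cost V.realVal y) ⊆ argmin V.bases (cost V.realVal y') →
      argmin V.bases (cost V.realVal y') ⊆ argmin V.bases (cost V.realVal y))
    {F : Finset α} (hF : F ∈ cyclicFlats (rk (argmin V.bases (cost V.realVal y))) V.core) :
    0 ≤ mobRk (argmin V.bases (cost V.realVal y)) V.core V.rank F := by
  have hb := fun y => V.isBaseFamily_initialMatroid y
  have hv := V.isValuated.argmin y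
  have hM : (V.initialMatroid y).IsTransversal := by
    refine hV _ ⟨⟨y, rfl⟩, fun y' hle B hB => ?_⟩
    obtain ⟨B, hB', rfl⟩ := (hb y').exists_finset hB
    refine ((hb y).isBase_iff B).2 (hmax y' (fun X hX => ?_) hB')
    exact ((hb y').isBase_iff X).1 (hle X (((hb y).isBase_iff X).2 hX))
  have := (hb y).mobRk_nonneg_of_isTransversal hM hv.isRankFn hg hF
  rwa [V.rk_ground hv.nonempty (argmin_subset _ _)] at this

theorem tau_nonneg [Fintype α] (hV : V.HasTransversalFacets) {M : Matroid α}
    (hM : M ∈ V.distinguishedCandidates) : 0 ≤ M.tau ∅ := by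
  obtain ⟨F, hF, x, hg, rfl⟩ := V.mem_distinguishedCandidates_iff.1 hM
  rw [V.tau_contract_initialMatroid (mem_cyclicFlats.1 hF).1 hg]
  refine mobRk_nonneg (d := V.rank) V.isValuated V.good_bases hF hg ?_ fun y hgy hmax F' hF' =>
    V.mobRk_nonneg_of_hasTransversalFacets hV hgy hmax hF'
  obtain ⟨B, hB, hBk⟩ := exists_card_eq_rk V.isValuated.nonempty F
  have h := Finset.card_le_card (Finset.inter_subset_left (s₁ := B) (s₂ := F))
  rw [hBk, V.card_of_mem_bases hB] at h
  omega

theorem exists_good : ∃ x, Good (argmin V.bases (cost V.realVal x)) V.core := by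
  have hG : V.core ∈ cyclicFlats (rk V.bases) V.core := mem_cyclicFlats.2
    ⟨subset_rfl, fun e h h' => absurd h h', V.good_bases.isRkCyclic V.isValuated⟩
  obtain ⟨x, hx, -⟩ := exists_good_point V.isValuated V.good_bases hG (u := 0)
    fun e he => by simp at he
  exact ⟨x, hx⟩

theorem sum_tau [Fintype α] :
    ∑ M ∈ V.finite_distinguishedCandidates.toFinset, M.tau ∅ = V.rank := by
  have hex : ∀ M : Matroid α, ∃ F x, M ∈ V.finite_distinguishedCandidates.toFinset →
      F ∈ cyclicFlats (rk V.bases) V.core ∧ Good (V.faceBases F x) (V.core \ F) ∧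
        M = (V.contract (F ∪ V.loopSet)).initialMatroid x := by
    intro M
    by_cases hM : M ∈ V.distinguishedCandidates
    · obtain ⟨F, hF, x, hg, h⟩ := V.mem_distinguishedCandidates_iff.1 hM
      exact ⟨F, x, fun _ => ⟨hF, hg, h⟩⟩
    · exact ⟨∅, 0, fun h => absurd (V.finite_distinguishedCandidates.mem_toFinset.1 h) hM⟩
  choose Fl u hFu using hex
  obtain ⟨x, hx⟩ := V.exists_good
  refine sum_multiplicity V.isValuated (Fl := Fl) (u := u) ⟨fun q hq => (hFu q hq).1,
    fun q hq => (hFu q hq).2.1, fun q hq => ?_, fun q hq q' hq' hFl hc => ?_,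
    fun F hF y hy => ?_⟩ hx
  · obtain ⟨hF, hg, h⟩ := hFu q hq
    have := V.tau_contract_initialMatroid (mem_cyclicFlats.1 hF).1 hg
    rwa [← h] at this
  · obtain ⟨hF, hg, h⟩ := hFu q hq
    obtain ⟨hF', hg', h'⟩ := hFu q' hq'
    obtain ⟨c, hc⟩ := hc
    rw [h, h', ← hFl]
    refine (V.isBaseFamily_faceBases (Fl q) (u q)).eq ?_
    have hb := V.isBaseFamily_faceBases (Fl q) (u q')
    have key : ∀ (x w : α → ℝ) (c : ℝ), (∀ e ∈ V.core \ Fl q, w e = x e + c) →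
        (V.faceBases (Fl q) x).image (· \ (Fl q ∪ V.loopSet))
          ⊆ (V.faceBases (Fl q) w).image (· \ (Fl q ∪ V.loopSet)) := by
      intro x w c hc B hB
      obtain ⟨X, hX, rfl⟩ := Finset.mem_image.1 hB
      obtain ⟨Y, hY, hYX⟩ := V.isValuated.exists_argmin_face_of_eq
        (fun e heG heF => hc e (Finset.mem_sdiff.2 ⟨heG, heF⟩)) hX
      refine Finset.mem_image.2 ⟨Y, hY, ?_⟩
      ext e
      have := Finset.ext_iff.1 hYX e
      simp only [Finset.mem_sdiff, Finset.mem_union] at this ⊢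
      tauto
    rwa [(key _ _ c hc).antisymm (key _ _ (-c) fun e he => by rw [hc e he]; ring)] at hb
  · have hM : (V.contract (F ∪ V.loopSet)).initialMatroid y
        ∈ V.finite_distinguishedCandidates.toFinset :=
      V.finite_distinguishedCandidates.mem_toFinset.2
        (V.mem_distinguishedCandidates_iff.2 ⟨F, hF, y, hy, rfl⟩)
    refine ⟨_, hM, ?_⟩
    obtain ⟨hF', hg', h⟩ := hFu _ hM
    set F' := Fl ((V.contract (F ∪ V.loopSet)).initialMatroid y) with hF'def
    have hFF : F' = F := by
      have h1 : V.ground \ (F ∪ V.loopSet) = V.ground \ (F' ∪ V.loopSet) := by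
        have := congrArg Matroid.E h
        rw [(V.isBaseFamily_faceBases _ _).ground_eq,
          (V.isBaseFamily_faceBases _ _).ground_eq] at this
        exact_mod_cast this
      have h2 : ∀ H ∈ cyclicFlats (rk V.bases) V.core,
          V.core \ (V.ground \ (H ∪ V.loopSet)) = H := by
        intro H hH
        have hHG := (mem_cyclicFlats.1 hH).1
        ext e
        have a1 := @hHG e
        have a2 : e ∈ V.core → e ∈ V.ground := fun h => V.core_subset h
        have a3 : e ∈ V.core → e ∉ V.loopSet := fun h =>
          Finset.disjoint_left.1 V.disjoint_core_loopSet h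
        simp only [Finset.mem_sdiff, Finset.mem_union]
        tauto
      rw [← h2 F hF, ← h2 F' hF', h1]
    refine ⟨hFF, fun S hS => ?_⟩
    have h3 := V.natRk_contract_initialMatroid (F := F) (x := y) hS
    rw [h, V.natRk_contract_initialMatroid (by rw [hFF]; exact hS), hFF] at h3
    exact h3

end ValuatedMatroid

open Classical in
theorem mainTheorem9 {α : Type*} [Fintype α] [DecidableEq α] (V : ValuatedMatroid α)
    (hV : V.HasTransversalFacets) :
    (∀ M ∈ V.distinguishedCandidates, (V.distinguishedMatroids.count M : ℤ) = M.tau ∅) ∧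
      (∀ M ∈ V.distinguishedMatroids, M ∈ V.distinguishedCandidates) ∧
      V.distinguishedMatroids.card = V.rank := by
  have hmem := fun M => V.finite_distinguishedCandidates.mem_toFinset (a := M)
  refine ⟨fun M hM => ?_, fun M hM => ?_, ?_⟩
  · have h : V.distinguishedMatroids.count M = (M.tau ∅).toNat := by
      rw [ValuatedMatroid.distinguishedMatroids, Multiset.count_sum']
      simp only [Multiset.count_replicate]
      rw [Finset.sum_ite_eq', if_pos ((hmem M).2 hM)]
    rw [h, Int.toNat_of_nonneg (V.tau_nonneg hV hM)]
  · rw [ValuatedMatroid.distinguishedMatroids, Multiset.mem_sum] at hM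
    obtain ⟨N, hN, hMN⟩ := hM
    rw [Multiset.eq_of_mem_replicate hMN]
    exact (hmem N).1 hN
  · have h : (V.distinguishedMatroids.card : ℤ) = V.rank := by
      rw [ValuatedMatroid.distinguishedMatroids, Multiset.card_sum, ← V.sum_tau]
      push_cast
      refine Finset.sum_congr rfl fun M hM => ?_
      rw [Multiset.card_replicate, Int.toNat_of_nonneg (V.tau_nonneg hV ((hmem M).1 hM))]
    exact_mod_cast h
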